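/- \textbf{Setting.} Let $n,k\ge 1$, let $\gamma\subset\mathbb R^{n+1}$ be a closed (compact, without boundary, embedded) $C^2$ hypersurface, let $K(x)$ be the largest absolute value of a principal curvature of $\gamma$ at $x$, and assume that the closest point projection $P_d$ onto $\gamma$ is well defined on $\mathcal N=\{x:\operatorname{dist}(x,\gamma)<\|K\|_{L_\infty(\gamma)}^{-1}\}$. Let $\overline\Gamma=\bigcup\overline T$ be a polyhedral surface (a finite conforming collection of $n$-simplices in $\mathbb R^{n+1}$) and $P:\overline\Gamma\to\gamma$ a bi-Lipschitz homeomorphism fixing the vertices of $\overline\Gamma$. Put $h_T=|\overline T|^{1/n}$, $\widetilde T=P(\overline T)$, let $\overline\omega_T$ be the union of all $\overline T'$ that meet $\overline T$, and $\widetilde\omega_T=P(\overline\omega_T)$. Let $\widehat T\subset\mathbb R^n$ be the unit reference simplex. For every $T$ there is a convex reference patch $\widehat\omega_T\subset\mathbb R^n$, a finite union of simplices one of which is $\widehat T$, with $\widehat T$ in its interior, taken from a finite collection $\mathcal W$ of such patches, and a continuous bijection $\overline X_T:\widehat\omega_T\to\overline\omega_T$ which is affine on each simplex of the patch, maps it onto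 some $\overline T'$, and maps $\widehat T$ onto $\overline T$. Put $\chi_T=P\circ\overline X_T$ and $X_T=I_k\chi_T$, where $I_k$ is componentwise Lagrange interpolation of degree $k$ on $\widehat T$; let $\Gamma$ be the surface with elements $T=X_T(\widehat T)$, and let $P:\Gamma\to\gamma$ also denote the map $X_T(\hat x)\mapsto\chi_T(\hat x)$. For a parametrization $F$ let its area element be $\sqrt{\det(DF^{\mathsf T}DF)}$; let $q$, $q_\Gamma$, $q_d$ be the area elements of $\chi_T$, $X_T$, $P_d\circ X_T$ on $\widehat T$. Put $$\beta_T=\|P-I_kP\|_{L_\infty(\overline T)},\quad \beta=\max_T\beta_T,\quad \lambda_T=\|\nabla(P-I_kP)\|_{L_\infty(\overline T)}.$$ \textbf{Assumptions.} For constants $\bar c,c,C_1,C_2>0$, $L\ge1$ and a threshold $\delta>0$, for all $T$: \begin{itemize} \item $\bar c^{-1}\operatorname{diam}(\overline T)|w|\le|D\overline X_T(\hat x)\,w|\le\bar c\operatorname{diam}(\overline T)|w|$ and $c^{-1}\operatorname{diam}(\overline T)|w|\le|DX_T(\hat x)\,w|\le c\operatorname{diam}(\overline T)|w|$ for $\hat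 x\in\widehat T$, $w\in\mathbb R^n$; \item $h_TL^{-1}|\hat x-\hat y|\le|\chi_T(\hat x)-\chi_T(\hat y)|\le Lh_T|\hat x-\hat y|$ for $\hat x,\hat y\in\widehat\omega_T$; \item $\beta\,\|K\|_{L_\infty(\gamma)}\le\frac12$, and $P_d\circ P^{-1}(\widetilde T)\subset\widetilde\omega_T$, where $P^{-1}:\gamma\to\Gamma$; \item $C_1\le q/q_\Gamma\le C_2$ and $C_1\le q_d/q_\Gamma\le C_2$ almost everywhere; \item $\lambda_T\le\delta$ and $L^{4n-2}\lambda_T^2+L^4(\|K\|_{L_\infty(\widetilde\omega_T)}\beta_T)^2+\|K\|_{L_\infty(\widetilde\omega_T)}\beta_T\le\delta$. \end{itemize} \textbf{Lemma (Data Geometric Consistency Error).} Given $n,k,\bar c,c,L,C_1,C_2$ and $\mathcal W$, there are constants $\delta>0$ and $D>0$ depending only on these quantities such that the following holds in every such setting. For all $f\in L_2(\gamma)$ and $v\in H^1(\gamma)$ the two integrals $$\int_\Gamma (fv)\circ P_d\,\frac{q_d}{q_\Gamma},\qquad \int_\Gamma (f\circ P)(v\circ P_d)\,\frac q{q_\Gamma}$$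 exist; let $II(v\circ P_d)$ denote the first minus the second. Then $$|II(v\circ P_d)|\le D\sum_T\beta_T\|f\|_{L_2(\widetilde T)}\|v\|_{H^1(\widetilde\omega_T)},$$ $$\sum_T\beta_T\|f\|_{L_2(\widetilde T)}\|v\|_{H^1(\widetilde\omega_T)}\le D\Big(\sum_T\beta_T^2\|f\|_{L_2(\widetilde T)}^2\Big)^{1/2}\|v\|_{H^1(\gamma)},$$ $$\Big(\sum_T\beta_T^2\|f\|_{L_2(\widetilde T)}^2\Big)^{1/2}\|v\|_{H^1(\gamma)}\le D\,\|f\|_{L_2(\gamma)}\|v\|_{H^1(\gamma)}\,\beta .$$ Consequently, the supremum being over all $v\in H^1(\gamma)$ with $\int_\gamma v=0$ and $\|\nabla_\gamma v\|_{L_2(\gamma)}=1$, $$\sup_v II(v\circ P_d)\le D\Big(\sum_T\big[\beta_T\|f\|_{L_2(\widetilde T)}\big]^2\Big)^{1/2},\qquad \Big(\sum_T\big[\beta_T\|f\|_{L_2(\widetilde T)}\big]^2\Big)^{1/2}\le D\,\|f\|_{L_2(\gamma)}\,\beta .$$ -/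

import Mathlib

open MeasureTheory Set
open scoped ENNReal ContDiff Topology RealInnerProductSpace

noncomputable section

namespace SurfaceFEM

/-- Parameter domain `ℝⁿ`. -/
abbrev Par (n : ℕ) := EuclideanSpace ℝ (Fin n)

/-- Ambient space `ℝⁿ⁺¹`. -/
abbrev Amb (n : ℕ) := EuclideanSpace ℝ (Fin (n + 1))

/-! ### Closed `C²` hypersurfaces, closest point projection, curvature -/

/-- `φ` is a local `C²` defining function of `γ` near the point `p`. -/
def IsLocalDefining {n : ℕ} (γ : Set (Amb n)) (p : Amb n) (φ : Amb n → ℝ) : Prop :=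
  ContDiffAt ℝ 2 φ p ∧ gradient φ p ≠ 0 ∧ ∀ᶠ x in 𝓝 p, (x ∈ γ ↔ φ x = 0)

/-- `γ` is a (closed, i.e. compact without boundary, embedded) `C²` hypersurface of `ℝⁿ⁺¹`. -/
def IsClosedC2Hypersurface {n : ℕ} (γ : Set (Amb n)) : Prop :=
  IsCompact γ ∧ ∀ p ∈ γ, ∃ φ : Amb n → ℝ, IsLocalDefining γ p φ

/-- The unit normal field `∇φ / |∇φ|` given by a defining function. -/
def unitNormal {n : ℕ} (φ : Amb n → ℝ) (x : Amb n) : Amb n :=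
  ‖gradient φ x‖⁻¹ • gradient φ x

/-- The maximal absolute principal curvature `K(p) = maxᵢ |κᵢ(p)|` of `γ` at `p ∈ γ`: the operator
norm of the Weingarten map `τ ↦ D ν(p) τ` on the tangent space at `p`. (A different choice of the
defining function changes `ν` along `γ` at most by its sign.) -/
def maxCurvature {n : ℕ} (γ : Set (Amb n)) (p : Amb n) : ℝ :=
  sSup {r : ℝ | ∃ φ : Amb n → ℝ, IsLocalDefining γ p φ ∧
    ∃ τ : Amb n, ‖τ‖ = 1 ∧ ⟪gradient φ p, τ⟫ = 0 ∧ r = ‖fderiv ℝ (unitNormal φ) p τ‖}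

/-- `‖K‖_{L_∞(S)}` for `S ⊆ γ` (`K` is continuous on `γ`). -/
def curvatureSup {n : ℕ} (γ S : Set (Amb n)) : ℝ :=
  sSup (maxCurvature γ '' S)

/-- `p` is a closest point to `x` on `γ`. -/
def IsClosestPoint {n : ℕ} (γ : Set (Amb n)) (x p : Amb n) : Prop :=
  p ∈ γ ∧ dist x p = Metric.infDist x γ

open Classical in
/-- The closest point projection `P_d` onto `γ` (with value `x` where no closest point exists). -/
def closestPoint {n : ℕ} (γ : Set (Amb n)) (x : Amb n) : Amb n :=
  if h : ∃ p, IsClosestPoint γ x p then h.choose else x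

/-- The tube `𝒩 = {x : dist(x, γ) < ‖K‖_{L_∞(γ)}⁻¹}`. -/
def tube {n : ℕ} (γ : Set (Amb n)) : Set (Amb n) :=
  {x | Metric.infDist x γ * curvatureSup γ γ < 1}

/-- The closest point projection is well defined on the tube `𝒩`. -/
def ProjectionWellDefined {n : ℕ} (γ : Set (Amb n)) : Prop :=
  ∀ x ∈ tube γ, ∃! p, IsClosestPoint γ x p

/-! ### Reference simplex, Lagrange interpolation, area elements -/

/-- The unit reference simplex `T̂`. -/
def refSimplex (n : ℕ) : Set (Par n) :=
  {x | (∀ i, 0 ≤ x i) ∧ ∑ i, x i ≤ 1}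

/-- Barycentric coordinates with respect to the reference simplex. -/
def bary {n : ℕ} (x : Par n) : Fin (n + 1) → ℝ :=
  Fin.cons (1 - ∑ i, x i) (fun i => x i)

/-- The point of the principal lattice of order `k` with barycentric coordinates `α / k`. -/
def latticeNode {n : ℕ} (k : ℕ) (α : Fin (n + 1) → ℕ) : Par n :=
  WithLp.toLp 2 (fun i : Fin n => (α i.succ : ℝ) / (k : ℝ))

/-- The Lagrange basis polynomial, of degree `|α| = k`, of the lattice node `α / k`: it is `1` at
this node and `0` at every other node of the principal lattice of order `k`. -/
def lagrangeBasis {n : ℕ} (k : ℕ) (α : Fin (n + 1) → ℕ) (x : Par n) : ℝ :=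
  ∏ i, ∏ j ∈ Finset.range (α i), ((k : ℝ) * bary x i - (j : ℝ)) / ((j : ℝ) + 1)

/-- Componentwise Lagrange interpolation `I_k` of degree `k` on the reference simplex. -/
def lagrangeInterp {n : ℕ} (k : ℕ) (g : Par n → Amb n) (x : Par n) : Amb n :=
  ∑ α ∈ Finset.piAntidiag (Finset.univ : Finset (Fin (n + 1))) k,
    lagrangeBasis k α x • g (latticeNode k α)

/-- The area element `√det(GᵀG)`, `G = [∂₁F, …, ∂ₙF]`, of a parametrization `F`. -/
def areaElement {n : ℕ} (F : Par n → Amb n) (x : Par n) : ℝ :=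
  Real.sqrt (Matrix.det (Matrix.of fun i j : Fin n =>
    ⟪fderiv ℝ F x (EuclideanSpace.single i 1), fderiv ℝ F x (EuclideanSpace.single j 1)⟫))

/-- The affine map taking the vertices of the reference simplex to `a 0, …, a n`. -/
def affineParam {n : ℕ} (a : Fin (n + 1) → Amb n) (x : Par n) : Amb n :=
  ∑ i, bary x i • a i

/-- A reference patch `ω̂`: the reference simplex together with finitely many further simplices
(given by their vertices), with convex union and with the reference simplex inside (i.e. at
positive distance from the boundary of the patch). -/
structure RefPatch (n : ℕ) where
  simplices : Finset (Fin (n + 1) → Par n)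
  nondegenerate : ∀ s ∈ simplices, AffineIndependent ℝ s
  convex_union : Convex ℝ (refSimplex n ∪ ⋃ s ∈ simplices, convexHull ℝ (range s))
  inside : refSimplex n ⊆ interior (refSimplex n ∪ ⋃ s ∈ simplices, convexHull ℝ (range s))

/-- The set `ω̂ ⊆ ℝⁿ`. -/
def RefPatch.carrier {n : ℕ} (w : RefPatch n) : Set (Par n) :=
  refSimplex n ∪ ⋃ s ∈ w.simplices, convexHull ℝ (range s)

/-! ### Parametric surfaces -/

/-- A polyhedral surface `Γ̄ = ⋃ T̄` (a conforming collection of `n`-simplices in `ℝⁿ⁺¹`) with a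
globally bi-Lipschitz map `P` onto `γ` that fixes the vertices of `Γ̄`, and with the patchwise
parametrizations `X̄_T : ω̂_T → ω̄_T`, where the reference patches `ω̂_T` belong to `W`. -/
structure ParamSurface (n : ℕ) (γ : Set (Amb n)) (W : Finset (RefPatch n)) where
  /-- number of elements -/
  card : ℕ
  /-- vertices of the element `T̄` -/
  vert : Fin card → Fin (n + 1) → Amb n
  nondegenerate : ∀ T, AffineIndependent ℝ (vert T)
  distinct : Function.Injective fun T => range (vert T)
  conforming : ∀ T T', convexHull ℝ (range (vert T)) ∩ convexHull ℝ (range (vert T')) ⊆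
    convexHull ℝ (range (vert T) ∩ range (vert T'))
  /-- the parametrization `P : Γ̄ → γ`; its values off `Γ̄` are irrelevant -/
  P : Amb n → Amb n
  biLipschitz : ∃ L : ℝ, 0 < L ∧
    ∀ x ∈ ⋃ T, convexHull ℝ (range (vert T)), ∀ y ∈ ⋃ T, convexHull ℝ (range (vert T)),
      L⁻¹ * ‖x - y‖ ≤ ‖P x - P y‖ ∧ ‖P x - P y‖ ≤ L * ‖x - y‖
  P_image : P '' (⋃ T, convexHull ℝ (range (vert T))) = γ
  P_vert : ∀ T i, P (vert T i) = vert T i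
  /-- the reference patch `ω̂_T` -/
  patch : Fin card → RefPatch n
  patch_mem : ∀ T, patch T ∈ W
  /-- the map `X̄_T : ω̂_T → ω̄_T`; its values off `ω̂_T` are irrelevant -/
  Xbar : Fin card → Par n → Amb n
  Xbar_elem : ∀ T, EqOn (Xbar T) (affineParam (vert T)) (refSimplex n)
  Xbar_affine : ∀ T, ∀ s ∈ (patch T).simplices, ∃ A : Par n →ᵃ[ℝ] Amb n,
    EqOn (Xbar T) A (convexHull ℝ (range s)) ∧
    ∃ T', A '' convexHull ℝ (range s) = convexHull ℝ (range (vert T'))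
  Xbar_cont : ∀ T, ContinuousOn (Xbar T) (patch T).carrier
  Xbar_inj : ∀ T, InjOn (Xbar T) (patch T).carrier
  Xbar_image : ∀ T, Xbar T '' (patch T).carrier =
    ⋃ T', ⋃ _ : (convexHull ℝ (range (vert T')) ∩ convexHull ℝ (range (vert T))).Nonempty,
      convexHull ℝ (range (vert T'))

namespace ParamSurface

variable {n : ℕ} {γ : Set (Amb n)} {W : Finset (RefPatch n)} (M : ParamSurface n γ W)

/-- The closed simplex `T̄`. -/
def elemBar (T : Fin M.card) : Set (Amb n) := convexHull ℝ (range (M.vert T))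

/-- The local parametrization `χ_T = P ∘ X̄_T : ω̂_T → ω̃_T` of `γ`. -/
def chi (T : Fin M.card) (x : Par n) : Amb n := M.P (M.Xbar T x)

/-- The local parametrization `X_T = I_k χ_T` of the approximate surface `Γ`. -/
def X (k : ℕ) (T : Fin M.card) : Par n → Amb n := lagrangeInterp k (M.chi T)

/-- The curved element `T̃ = P(T̄) ⊆ γ`. -/
def elem (T : Fin M.card) : Set (Amb n) := M.P '' M.elemBar T

/-- The macro patch `ω̃_T = P(ω̄_T)`, with `ω̄_T` the union of all `T̄'` that meet `T̄`. -/
def omega (T : Fin M.card) : Set (Amb n) :=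
  M.P '' ⋃ T', ⋃ _ : (M.elemBar T' ∩ M.elemBar T).Nonempty, M.elemBar T'

/-- `h_T = |T̄|^{1/n}`. -/
def h (T : Fin M.card) : ℝ :=
  (∫ x in refSimplex n, areaElement (affineParam (M.vert T)) x) ^ (1 / (n : ℝ))

/-- `β_T = ‖P - I_k P‖_{L_∞(T̄)}`. -/
def beta (k : ℕ) (T : Fin M.card) : ℝ :=
  sSup ((fun x => ‖M.chi T x - M.X k T x‖) '' refSimplex n)

/-- `β = max_T β_T`. -/
def betaMax (k : ℕ) : ℝ := ⨆ T, M.beta k T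

/-- The operator norm at `X̄_T(x)` of the gradient along `T̄` of `P - I_k P`. -/
def gradError (k : ℕ) (T : Fin M.card) (x : Par n) : ℝ :=
  sSup {r : ℝ | ∃ w : Par n, ‖fderiv ℝ (affineParam (M.vert T)) x w‖ ≤ 1 ∧
    r = ‖fderiv ℝ (fun y => M.chi T y - M.X k T y) x w‖}

/-- `λ_T = ‖∇(P - I_k P)‖_{L_∞(T̄)}`. -/
def lam (k : ℕ) (T : Fin M.card) : ℝ :=
  (eLpNorm (M.gradError k T) ∞ (volume.restrict (refSimplex n))).toReal

/-- The area element `q` of `γ` in the parametrization `χ_T`. -/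
def q (T : Fin M.card) : Par n → ℝ := areaElement (M.chi T)

/-- The area element `q_d` of `γ` in the parametrization `P_d ∘ X_T`. -/
def qd (k : ℕ) (T : Fin M.card) : Par n → ℝ :=
  areaElement fun x => closestPoint γ (M.X k T x)

/-- The area element `q_Γ` of `Γ` in the parametrization `X_T`. -/
def qGamma (k : ℕ) (T : Fin M.card) : Par n → ℝ := areaElement (M.X k T)

/-- The surface measure of `γ`. -/
def surf : Measure (Amb n) :=
  ∑ T, Measure.map (M.chi T)
    ((volume.restrict (refSimplex n)).withDensity fun x => ENNReal.ofReal (M.q T x))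

/-- Integrability over `Γ` of the function whose value at the point `X_T(x)` is `F T x`. -/
def IntegrableOnGamma (k : ℕ) (F : Fin M.card → Par n → ℝ) : Prop :=
  ∀ T, IntegrableOn (fun x => F T x * M.qGamma k T x) (refSimplex n)

/-- The surface integral over `Γ` of the function whose value at the point `X_T(x)` is `F T x`. -/
def integralGamma (k : ℕ) (F : Fin M.card → Par n → ℝ) : ℝ :=
  ∑ T, ∫ x in refSimplex n, F T x * M.qGamma k T x

/-- The theoretical integrand `(f v) ∘ P_d · q_d / q_Γ` on `Γ`. -/
def theoretical (k : ℕ) (f v : Amb n → ℝ) (T : Fin M.card) (x : Par n) : ℝ :=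
  f (closestPoint γ (M.X k T x)) * v (closestPoint γ (M.X k T x)) *
    (M.qd k T x / M.qGamma k T x)

/-- The practical integrand `(f ∘ P) (v ∘ P_d) · q / q_Γ` on `Γ`, where `P : Γ → γ` maps `X_T(x)`
to `χ_T(x)`. -/
def practical (k : ℕ) (f v : Amb n → ℝ) (T : Fin M.card) (x : Par n) : ℝ :=
  f (M.chi T x) * v (closestPoint γ (M.X k T x)) * (M.q T x / M.qGamma k T x)

/-- The term `II(v ∘ P_d)`. -/
def termII (k : ℕ) (f v : Amb n → ℝ) : ℝ :=
  M.integralGamma k (M.theoretical k f v) - M.integralGamma k (M.practical k f v)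

/-- `‖g‖_{L_2(S)}` for `S ⊆ γ` and a scalar or vector valued function `g` on `γ`. -/
def l2norm {F : Type*} [NormedAddCommGroup F] (g : Amb n → F) (S : Set (Amb n)) : ℝ :=
  (eLpNorm g 2 (M.surf.restrict S)).toReal

/-- `v ∈ H¹(γ)` with weak tangential gradient `∇_γ v = gv`: both are square integrable, `gv` is
tangential, and in every chart `χ_T`, on the interior of `ω̂_T`, the function `v ∘ χ_T` has the weak
gradient `(gv ∘ χ_T) · Dχ_T`. -/
structure HasWeakGradient (v : Amb n → ℝ) (gv : Amb n → Amb n) : Prop where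
  memLp : MemLp v 2 M.surf
  memLp_grad : MemLp gv 2 M.surf
  tangential : ∀ T, ∀ᵐ x ∂(volume.restrict (refSimplex n)),
    ∃ w : Par n, gv (M.chi T x) = fderiv ℝ (M.chi T) x w
  weak : ∀ T, ∀ φ : Par n → ℝ, ContDiff ℝ ∞ φ → HasCompactSupport φ →
    tsupport φ ⊆ interior (M.patch T).carrier → ∀ w : Par n,
      ∫ x, v (M.chi T x) * fderiv ℝ φ x w =
        -∫ x, ⟪gv (M.chi T x), fderiv ℝ (M.chi T) x w⟫ * φ x

/-- `‖v‖_{H¹(S)}`, where `gv` is the weak tangential gradient of `v`. -/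
def h1norm (v : Amb n → ℝ) (gv : Amb n → Amb n) (S : Set (Amb n)) : ℝ :=
  Real.sqrt (M.l2norm v S ^ 2 + M.l2norm gv S ^ 2)

/-- The values `II(v ∘ P_d)` for `v ∈ H¹(γ)` with `∫_γ v = 0` and `‖∇_γ v‖_{L_2(γ)} = 1`. -/
def termIIValues (k : ℕ) (f : Amb n → ℝ) : Set EReal :=
  {s | ∃ (v : Amb n → ℝ) (gv : Amb n → Amb n), M.HasWeakGradient v gv ∧
    ∫ x, v x ∂M.surf = 0 ∧ M.l2norm gv γ = 1 ∧ s = ((M.termII k f v : ℝ) : EReal)}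

/-- The standing assumptions: shape regularity of both triangulations (constants `cbar`, `c`), the
patchwise bi-Lipschitz property with element scaling (constant `L`), the geometric resolution
assumptions, and nondegeneracy of the area elements (constants `C₁`, `C₂`); `δ` is the threshold in
the two assumptions of the form "is sufficiently small". -/
structure Admissible (k : ℕ) (cbar c L C₁ C₂ δ : ℝ) : Prop where
  shape_init : ∀ T, ∀ x ∈ refSimplex n, ∀ w : Par n,
    cbar⁻¹ * Metric.diam (M.elemBar T) * ‖w‖ ≤ ‖fderiv ℝ (affineParam (M.vert T)) x w‖ ∧
    ‖fderiv ℝ (affineParam (M.vert T)) x w‖ ≤ cbar * Metric.diam (M.elemBar T) * ‖w‖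
  shape : ∀ T, ∀ x ∈ refSimplex n, ∀ w : Par n,
    c⁻¹ * Metric.diam (M.elemBar T) * ‖w‖ ≤ ‖fderiv ℝ (M.X k T) x w‖ ∧
    ‖fderiv ℝ (M.X k T) x w‖ ≤ c * Metric.diam (M.elemBar T) * ‖w‖
  biLipschitz_patch : ∀ T, ∀ x ∈ (M.patch T).carrier, ∀ y ∈ (M.patch T).carrier,
    M.h T * L⁻¹ * ‖x - y‖ ≤ ‖M.chi T x - M.chi T y‖ ∧
    ‖M.chi T x - M.chi T y‖ ≤ L * M.h T * ‖x - y‖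
  /-- `β ≤ ½ ‖K‖_{L_∞(γ)}⁻¹` -/
  resolution : M.betaMax k * curvatureSup γ γ ≤ 1 / 2
  /-- `P_d ∘ P⁻¹ (T̃) ⊆ ω̃_T` -/
  mismatch : ∀ T, ∀ x ∈ refSimplex n, closestPoint γ (M.X k T x) ∈ M.omega T
  area : ∀ T, ∀ᵐ x ∂(volume.restrict (refSimplex n)),
    (C₁ ≤ M.q T x / M.qGamma k T x ∧ M.q T x / M.qGamma k T x ≤ C₂) ∧
    (C₁ ≤ M.qd k T x / M.qGamma k T x ∧ M.qd k T x / M.qGamma k T x ≤ C₂)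
  lam_small : ∀ T, M.lam k T ≤ δ
  curvature_small : ∀ T,
    L ^ (4 * n - 2) * M.lam k T ^ 2 + L ^ 4 * (curvatureSup γ (M.omega T) * M.beta k T) ^ 2 +
      curvatureSup γ (M.omega T) * M.beta k T ≤ δ

end ParamSurface

end SurfaceFEM

end

open SurfaceFEM

open MeasureTheory Set
open scoped ENNReal ContDiff Topology RealInnerProductSpace
open SurfaceFEM

/-! Let `drift` be the map `P_d ∘ P⁻¹` of γ to itself. If it is a bijection, the maps `P_d ∘ X_T`
with area elements `q_d` parametrize γ up to null sets, so the first integral is the integral of `f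
v` over γ. In the charts `χ_T` this is the sum over T of the integrals of `f(χ_T) v(χ_T) q`
(`integralGamma_theoretical`), and the second integral is the same sum with `v(P_d X_T)` in place of
`v(χ_T)`. Cauchy–Schwarz on each element leaves one local estimate: the L₂ norm of `v(P_d X_T) -
v(χ_T)` is at most a constant times β_T times the L₂ norm of the gradient of v on the macro patch
(`lintegral_comp_sub_sq_le`). Bounded overlap of elements and patches gives the remaining
inequalities.

Local estimate. In reference coordinates `P_d ∘ X_T = χ_T ∘ F`, where F moves points by at most ε =
2Lβ_T/h_T and pushes Lebesgue measure on the reference simplex forward to at most a constant times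
Lebesgue measure (`exists_chart_drift`). Nothing more about F is needed. For smooth V and |ξ| < ε,
compare V(Fx) with V(Fx+ξ), that with V(x+ξ), and that with V(x). The outer differences are
translations; the middle one is controlled by averaging over ξ (`lintegral_enorm_comp_sub_sq_le`).
Mollification transfers this to weak gradients. The powers of h_T cancel and the factor β_T² remains
in the squared estimate.

Bijectivity. `P_d` is never differentiated. Writing `X_T(x) = p + t N(p)` with p the closest point,
and subtracting the same identity at a nearby point, shows that `drift` minus the identity has
pointwise Lipschitz constant O(δ) (`eventually_closestPoint_X_sub_le`). Following images of segments
in the convex reference patches makes it 1/8-Lipschitz on each macro patch. Injectivity follows once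
two points with equal drift lie in a common patch (`eq_of_drift_eq`). For surjectivity, the image is
compact and relatively open (`image_drift_mem_nhdsWithin`), and it meets every connected patch.

Change of variables. A surface measure on γ obeying the area formula for arbitrary parametrizations
is built from local graphs (`exists_isSurfaceMeasureOn`). Both the chart parametrization and the
closest point parametrization represent it. -/

/-! ### Lipschitz bounds from pointwise and almost-everywhere information -/

/-- A continuous path whose pointwise right Lipschitz constant is at most `m` everywhere has
displacement at most `m`. -/
theorem norm_sub_le_of_right_lipschitz {E : Type*} [NormedAddCommGroup E] {f : ℝ → E} {m : ℝ}
    (hf : ContinuousOn f (Icc 0 1))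
    (h : ∀ t ∈ Ico (0 : ℝ) 1, ∀ ε > 0, ∃ᶠ s in 𝓝[>] t, ‖f s - f t‖ ≤ (m + ε) * (s - t)) :
    ∀ t ∈ Icc (0 : ℝ) 1, ‖f t - f 0‖ ≤ m * t := by
  intro t ht
  have key : ∀ ε > 0, ‖f t - f 0‖ ≤ (m + ε) * t := by
    intro ε hε
    refine image_norm_le_of_liminf_right_slope_norm_lt_deriv_boundary
      (f := fun s => f s - f 0) (f' := fun _ => m + ε / 2) (B := fun s => (m + ε) * s)
      (B' := fun _ => m + ε) (a := 0) (b := 1) ?_ ?_ ?_ ?_ ?_ ?_ ht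
    · exact hf.sub continuousOn_const
    · intro x hx r hr
      -- The slacks `ε / 4 < ε / 2 < ε` leave room twice: the slope must stay below every `r > m + ε
      -- / 2`, and the barrier must climb strictly faster than `m + ε / 2`.
      have h1 := h x hx (ε / 4) (by positivity)
      refine (h1.and_eventually self_mem_nhdsWithin).mono ?_
      rintro z ⟨hz, hxz⟩
      have hpos : 0 < z - x := sub_pos.2 hxz
      rw [slope_def_field, div_lt_iff₀ hpos]
      have h2 : ‖f z - f 0‖ - ‖f x - f 0‖ ≤ ‖f z - f x‖ := by
        have := norm_sub_norm_le (f z - f 0) (f x - f 0)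
        simpa using this
      simp only [Function.comp]
      nlinarith
    · simp
    · fun_prop
    · intro x _
      simpa using ((hasDerivAt_id x).const_mul (m + ε)).hasDerivWithinAt
    · intro x _ _
      linarith
  have : Filter.Tendsto (fun ε : ℝ => (m + ε) * t) (𝓝[>] 0) (𝓝 ((m + 0) * t)) :=
    Filter.Tendsto.mono_left (Continuous.tendsto (by fun_prop) 0) nhdsWithin_le_nhds
  rw [add_zero] at this
  exact ge_of_tendsto this (by filter_upwards [self_mem_nhdsWithin] with ε hε using key ε hε)

/-- A Lipschitz map with derivative bounded by `m` almost everywhere on an open convex set is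
`m`-Lipschitz there. -/
theorem Convex.norm_sub_le_of_ae_norm_fderiv_le {E F : Type*} [NormedAddCommGroup E]
    [NormedSpace ℝ E] [FiniteDimensional ℝ E] [MeasureSpace E] [BorelSpace E]
    [(volume : Measure E).IsAddHaarMeasure]
    [NormedAddCommGroup F] [InnerProductSpace ℝ F] [FiniteDimensional ℝ F] {f : E → F}
    {Ω : Set E} (hΩ : Convex ℝ Ω) (hΩo : IsOpen Ω) {K : NNReal} (hK : LipschitzOnWith K f Ω) {m : ℝ}
    (hm : ∀ᵐ x ∂(volume.restrict Ω), ‖fderiv ℝ f x‖ ≤ m) {x y : E} (hx : x ∈ Ω) (hy : y ∈ Ω) :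
    ‖f y - f x‖ ≤ m * ‖y - x‖ := by
  have hdiff := hK.ae_differentiableWithinAt (μ := volume) hΩo.measurableSet
  have hG : ∀ᵐ z ∂(volume : Measure E), z ∈ Ω → DifferentiableAt ℝ f z ∧ ‖fderiv ℝ f z‖ ≤ m := by
    rw [ae_restrict_iff' hΩo.measurableSet] at hdiff hm
    filter_upwards [hdiff, hm] with z h1 h2 hz
    exact ⟨(h1 hz).differentiableAt (hΩo.mem_nhds hz), h2 hz⟩
  -- The segment from `x` to `y` is in general a null set and may contain no good point. By Fubini,
  -- for almost every shift `u` almost every point of the shifted segment is good.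
  have hprod : ∀ᵐ u ∂(volume : Measure E), ∀ᵐ t ∂(volume : Measure ℝ),
      x + u + t • (y - x) ∈ Ω →
        DifferentiableAt ℝ f (x + u + t • (y - x)) ∧ ‖fderiv ℝ f (x + u + t • (y - x))‖ ≤ m := by
    set P : E → Prop := fun z => z ∈ Ω → DifferentiableAt ℝ f z ∧ ‖fderiv ℝ f z‖ ≤ m with hP
    obtain ⟨S, hPS, hSm, hS0⟩ := exists_measurable_superset_of_null (ae_iff.1 hG)
    have hmeas : MeasurableSet {p : E × ℝ | x + p.1 + p.2 • (y - x) ∈ S} := by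
      apply hSm.preimage
      fun_prop
    have h1 : ∀ᵐ t ∂(volume : Measure ℝ), ∀ᵐ u ∂(volume : Measure E),
        x + u + t • (y - x) ∉ S := by
      refine Filter.Eventually.of_forall fun t => ?_
      have h2 : (volume : Measure E) ((fun u => u + (x + t • (y - x))) ⁻¹' S) = 0 := by
        rw [measure_preimage_add_right, hS0]
      rw [ae_iff]
      convert h2 using 2
      ext u
      simp only [not_not, mem_ofPred_eq, mem_preimage]
      rw [show x + u + t • (y - x) = u + (x + t • (y - x)) by abel]
    have h3 := (Measure.ae_ae_comm (μ := (volume : Measure E)) (ν := (volume : Measure ℝ))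
      (p := fun u t => x + u + t • (y - x) ∉ S) hmeas.compl).2 h1
    filter_upwards [h3] with u hu
    filter_upwards [hu] with t ht
    by_contra hcon
    exact ht (hPS hcon)
  obtain ⟨r, hr, hrx⟩ := Metric.isOpen_iff.1 hΩo x hx
  obtain ⟨r', hr', hry⟩ := Metric.isOpen_iff.1 hΩo y hy
  have step : ∀ ε > 0, ‖f y - f x‖ ≤ m * ‖y - x‖ + 2 * K * ε := by
    intro ε hε
    have hball : (volume : Measure E) (Metric.ball 0 (min ε (min r r'))) ≠ 0 :=
      (Metric.measure_ball_pos _ _ (by positivity)).ne'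
    obtain ⟨u, hu, hub⟩ : ∃ u, (∀ᵐ t ∂(volume : Measure ℝ), x + u + t • (y - x) ∈ Ω →
        DifferentiableAt ℝ f (x + u + t • (y - x)) ∧ ‖fderiv ℝ f (x + u + t • (y - x))‖ ≤ m) ∧
        u ∈ Metric.ball (0 : E) (min ε (min r r')) := by
      by_contra! hcon
      apply hball
      refine measure_mono_null ?_ (ae_iff.1 hprod)
      intro u hu h'
      exact hcon u h' hu
    simp only [mem_ball_zero_iff, lt_min_iff] at hub
    have hxu : x + u ∈ Ω := hrx (by simpa using hub.2.1)
    have hyu : y + u ∈ Ω := hry (by simpa using hub.2.2)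
    have hseg : ∀ t ∈ Icc (0 : ℝ) 1, x + u + t • (y - x) ∈ Ω := by
      intro t ht
      have := hΩ.add_smul_sub_mem hxu hyu ht
      simpa using this
    set a := f (y + u) - f (x + u) with ha
    have hmid : ‖a‖ ≤ m * ‖y - x‖ := by
      -- Pairing with the displacement `a` gives a scalar Lipschitz, hence absolutely continuous,
      -- function with increment `‖a‖ ^ 2`. Its derivative is at most `‖a‖ * (m * ‖y - x‖)` almost
      -- everywhere, and one factor `‖a‖` cancels.
      set φ : ℝ → ℝ := fun t => ⟪a, f (x + u + t • (y - x))⟫ with hφ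
      have hlip : LipschitzOnWith (‖a‖₊ * (K * ‖y - x‖₊)) φ (uIcc 0 1) := by
        rw [uIcc_of_le zero_le_one]
        refine LipschitzOnWith.of_dist_le_mul fun s hs t ht => ?_
        have h1 := hK.dist_le_mul _ (hseg s hs) _ (hseg t ht)
        rw [Real.dist_eq, hφ, ← inner_sub_right]
        refine (abs_real_inner_le_norm _ _).trans ?_
        push_cast
        rw [mul_assoc]
        refine mul_le_mul_of_nonneg_left ?_ (norm_nonneg _)
        rw [dist_eq_norm, dist_eq_norm] at h1
        refine h1.trans (le_of_eq ?_)
        rw [show x + u + s • (y - x) - (x + u + t • (y - x)) = (s - t) • (y - x) by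
          rw [sub_smul]; abel, norm_smul, Real.dist_eq, Real.norm_eq_abs]
        ring
      have hftc := hlip.absolutelyContinuousOnInterval.integral_deriv_eq_sub
      have hb : ‖∫ t in (0 : ℝ)..1, deriv φ t‖ ≤ (‖a‖ * (m * ‖y - x‖)) * |1 - 0| := by
        refine intervalIntegral.norm_integral_le_of_norm_le_const_ae ?_
        filter_upwards [hu] with t ht htI
        rw [uIoc_of_le zero_le_one] at htI
        obtain ⟨hd, hn⟩ := ht (hseg t ⟨htI.1.le, htI.2⟩)
        have hc : HasDerivAt (fun t : ℝ => x + u + t • (y - x)) (y - x) t := by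
          simpa using ((hasDerivAt_id t).smul_const (y - x)).const_add (x + u)
        have hder : HasDerivAt φ ⟪a, fderiv ℝ f (x + u + t • (y - x)) (y - x)⟫ t := by
          have := (hd.hasFDerivAt.comp_hasDerivAt t hc)
          simpa using (hasDerivAt_const t a).inner ℝ this
        rw [hder.deriv]
        refine (norm_inner_le_norm _ _).trans ?_
        refine mul_le_mul_of_nonneg_left ?_ (norm_nonneg _)
        exact ((fderiv ℝ f _).le_opNorm _).trans (by gcongr)
      rw [hftc] at hb
      have h01 : φ 1 - φ 0 = ‖a‖ * ‖a‖ := by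
        simp only [hφ, ← inner_sub_right, one_smul, zero_smul, add_zero]
        rw [show x + u + (y - x) = y + u by abel, ← ha, real_inner_self_eq_norm_mul_norm]
      rw [h01, sub_zero, abs_one, mul_one, Real.norm_of_nonneg (by positivity)] at hb
      rcases (norm_nonneg a).eq_or_lt with h0 | h0
      · rw [← h0]
        -- With `a = 0` there is nothing to divide by and the sign of `m` is needed; a single good
        -- point of the segment provides it.
        have hm0 : 0 ≤ m * ‖y - x‖ := by
          obtain ⟨t, ht, htI⟩ : ∃ t, (x + u + t • (y - x) ∈ Ω →
              DifferentiableAt ℝ f (x + u + t • (y - x)) ∧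
              ‖fderiv ℝ f (x + u + t • (y - x))‖ ≤ m) ∧ t ∈ Ioo (0 : ℝ) 1 := by
            by_contra! hcon
            have : (volume : Measure ℝ) (Ioo 0 1) = 0 := by
              refine measure_mono_null ?_ (ae_iff.1 hu)
              intro t ht h'
              exact hcon t h' ht
            simp at this
          have := (ht (hseg t ⟨htI.1.le, htI.2.le⟩)).2
          exact mul_nonneg ((norm_nonneg _).trans this) (norm_nonneg _)
        exact hm0
      · exact le_of_mul_le_mul_left hb h0
    have h1 := hK.dist_le_mul _ hx _ hxu
    have h2 := hK.dist_le_mul _ hy _ hyu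
    rw [dist_eq_norm, dist_eq_norm] at h1 h2
    have h3 : ‖x - (x + u)‖ = ‖u‖ := by simp
    have h4 : ‖y - (y + u)‖ = ‖u‖ := by simp
    rw [h3] at h1
    rw [h4] at h2
    have h5 : f y - f x = (f y - f (y + u)) + a - (f x - f (x + u)) := by rw [ha]; abel
    have h6 : ‖f y - f x‖ ≤ ‖f y - f (y + u)‖ + ‖a‖ + ‖f x - f (x + u)‖ := by
      rw [h5]
      exact (norm_sub_le _ _).trans (by gcongr; exact norm_add_le _ _)
    have h7 : (K : ℝ) * ‖u‖ ≤ K * ε := mul_le_mul_of_nonneg_left hub.1.le K.2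
    linarith
  have : Filter.Tendsto (fun ε : ℝ => m * ‖y - x‖ + 2 * K * ε) (𝓝[>] 0)
      (𝓝 (m * ‖y - x‖ + 2 * K * 0)) :=
    Filter.Tendsto.mono_left (Continuous.tendsto (by fun_prop) 0) nhdsWithin_le_nhds
  rw [mul_zero, add_zero] at this
  exact ge_of_tendsto this (by filter_upwards [self_mem_nhdsWithin] with ε hε using step ε hε)

/-! ### Composition of a Sobolev function with a map close to the identity -/

section SobolevComposition

theorem ENNReal.sq_lintegral_mul_le {α : Type*} [MeasurableSpace α] {μ : Measure α}
    {a b : α → ℝ≥0∞} (ha : AEMeasurable a μ) (hb : AEMeasurable b μ) :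
    (∫⁻ x, a x * b x ∂μ) ^ 2 ≤ (∫⁻ x, a x ^ 2 ∂μ) * ∫⁻ x, b x ^ 2 ∂μ := by
  have h := ENNReal.lintegral_mul_le_Lp_mul_Lq μ Real.HolderConjugate.two_two ha hb
  simp only [Pi.mul_apply] at h
  calc (∫⁻ x, a x * b x ∂μ) ^ 2
      ≤ ((∫⁻ x, a x ^ (2 : ℝ) ∂μ) ^ (1 / (2 : ℝ)) * (∫⁻ x, b x ^ (2 : ℝ) ∂μ) ^ (1 / (2 : ℝ))) ^ 2 :=
        by gcongr
    _ = _ := by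
        rw [mul_pow, ← ENNReal.rpow_natCast, ← ENNReal.rpow_natCast, ← ENNReal.rpow_mul,
          ← ENNReal.rpow_mul]
        norm_num

/-- Cauchy–Schwarz for the factors `a √b` and `√b`. For a mollifier `b` of mass one this is Jensen's
inequality. -/
theorem ENNReal.sq_lintegral_mul_le_of_weight {α : Type*} [MeasurableSpace α] {μ : Measure α}
    {a b : α → ℝ≥0∞} (ha : AEMeasurable a μ) (hb : AEMeasurable b μ) :
    (∫⁻ x, a x * b x ∂μ) ^ 2 ≤ (∫⁻ x, a x ^ 2 * b x ∂μ) * ∫⁻ x, b x ∂μ := by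
  have h := ENNReal.sq_lintegral_mul_le (a := fun x => a x * b x ^ (1 / 2 : ℝ))
    (b := fun x => b x ^ (1 / 2 : ℝ)) (ha.mul (hb.pow_const _)) (hb.pow_const _) (μ := μ)
  have h2 : ∀ x, (b x ^ (1 / 2 : ℝ)) ^ 2 = b x := by
    intro x
    rw [← ENNReal.rpow_natCast, ← ENNReal.rpow_mul]
    norm_num
  have h3 : ∀ x, a x * b x ^ (1 / 2 : ℝ) * b x ^ (1 / 2 : ℝ) = a x * b x := by
    intro x
    rw [mul_assoc, ← sq, h2]
  simpa only [h3, mul_pow, h2] using h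

variable {E : Type*} [NormedAddCommGroup E] [NormedSpace ℝ E]

/-- Fundamental theorem of calculus along the segment, then Cauchy–Schwarz on the unit interval. -/
theorem ContDiff.enorm_sub_sq_le_lintegral_segment {V : E → ℝ} (hV : ContDiff ℝ 1 V) (p d : E) :
    ‖V (p + d) - V p‖ₑ ^ 2 ≤
      ‖d‖ₑ ^ 2 * ∫⁻ t in Icc (0 : ℝ) 1, ‖fderiv ℝ V (p + t • d)‖ₑ ^ 2 := by
  have hc : Continuous fun t : ℝ => fderiv ℝ V (p + t • d) :=
    (hV.continuous_fderiv one_ne_zero).comp (by fun_prop)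
  have hder : ∀ t : ℝ, HasDerivAt (fun t : ℝ => V (p + t • d)) (fderiv ℝ V (p + t • d) d) t := by
    intro t
    have h1 : HasDerivAt (fun t : ℝ => p + t • d) d t := by
      simpa using ((hasDerivAt_id t).smul_const d).const_add p
    exact ((hV.differentiable one_ne_zero _).hasFDerivAt).comp_hasDerivAt t h1
  have hftc : V (p + d) - V p = ∫ t in (0 : ℝ)..1, fderiv ℝ V (p + t • d) d := by
    rw [intervalIntegral.integral_eq_sub_of_hasDerivAt (fun t _ => hder t)
      ((hc.clm_apply continuous_const).intervalIntegrable _ _)]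
    simp
  rw [hftc, intervalIntegral.integral_of_le zero_le_one, ← integral_Icc_eq_integral_Ioc]
  have h1 : ‖∫ t in Icc (0 : ℝ) 1, fderiv ℝ V (p + t • d) d‖ₑ ≤
      ∫⁻ t in Icc (0 : ℝ) 1, ‖fderiv ℝ V (p + t • d)‖ₑ * ‖d‖ₑ :=
    (enorm_integral_le_lintegral_enorm _).trans
      (lintegral_mono fun t => ContinuousLinearMap.le_opENorm _ _)
  refine (pow_le_pow_left' h1 2).trans ?_
  have hm : Measurable fun t : ℝ => ‖fderiv ℝ V (p + t • d)‖ₑ := hc.enorm.measurable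
  rw [lintegral_mul_const _ hm, mul_pow, mul_comm]
  gcongr
  have := ENNReal.sq_lintegral_mul_le (μ := volume.restrict (Icc (0 : ℝ) 1))
    (a := fun t => ‖fderiv ℝ V (p + t • d)‖ₑ) (b := fun _ => 1) hm.aemeasurable aemeasurable_const
  simpa using this

variable [FiniteDimensional ℝ E]
  [MeasureSpace E] [BorelSpace E] [(volume : Measure E).IsAddHaarMeasure]

/-- After exchanging integrals in the segment estimate, each `t` contributes an integral over a
translate of `S` that lies in `K`; translation invariance removes the shift. -/
theorem lintegral_enorm_translate_sub_sq_le {V : E → ℝ} (hV : ContDiff ℝ 1 V) {S K : Set E}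
    (hS : MeasurableSet S) (hK : MeasurableSet K) {d : E}
    (h : ∀ z ∈ S, ∀ t ∈ Icc (0 : ℝ) 1, z + t • d ∈ K) :
    ∫⁻ z in S, ‖V (z + d) - V z‖ₑ ^ 2 ≤ ‖d‖ₑ ^ 2 * ∫⁻ z in K, ‖fderiv ℝ V z‖ₑ ^ 2 := by
  have hc : Continuous fun z : E => ‖fderiv ℝ V z‖ₑ ^ 2 :=
    (ENNReal.continuous_pow 2).comp (hV.continuous_fderiv one_ne_zero).enorm
  calc ∫⁻ z in S, ‖V (z + d) - V z‖ₑ ^ 2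
      ≤ ∫⁻ z in S, ‖d‖ₑ ^ 2 * ∫⁻ t in Icc (0 : ℝ) 1, ‖fderiv ℝ V (z + t • d)‖ₑ ^ 2 :=
        lintegral_mono fun z => hV.enorm_sub_sq_le_lintegral_segment z d
    _ = ‖d‖ₑ ^ 2 * ∫⁻ z in S, ∫⁻ t in Icc (0 : ℝ) 1, ‖fderiv ℝ V (z + t • d)‖ₑ ^ 2 :=
        lintegral_const_mul' _ _ (by simp)
    _ = ‖d‖ₑ ^ 2 * ∫⁻ t in Icc (0 : ℝ) 1, ∫⁻ z in S, ‖fderiv ℝ V (z + t • d)‖ₑ ^ 2 := by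
        rw [lintegral_lintegral_swap]
        exact (hc.comp (by fun_prop : Continuous fun q : E × ℝ => q.1 + q.2 • d)).aemeasurable
    _ ≤ ‖d‖ₑ ^ 2 * ∫⁻ _ in Icc (0 : ℝ) 1, ∫⁻ z in K, ‖fderiv ℝ V z‖ₑ ^ 2 := by
        refine mul_le_mul' le_rfl ?_
        refine setLIntegral_mono' (measurableSet_Icc (a := (0 : ℝ)) (b := 1)) fun t ht => ?_
        rw [← lintegral_indicator hS, ← lintegral_indicator hK]
        rw [← lintegral_add_right_eq_self (μ := volume) (K.indicator _) (t • d)]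
        refine lintegral_mono fun z => ?_
        by_cases hz : z ∈ S
        · rw [indicator_of_mem hz, indicator_of_mem (h z hz t ht)]
        · rw [indicator_of_notMem hz]
          exact bot_le
    _ = _ := by simp

theorem ENNReal.add_add_sq_le (a b c : ℝ≥0∞) :
    (a + b + c) ^ 2 ≤ 3 * (a ^ 2 + b ^ 2 + c ^ 2) := by
  by_cases h : a = ⊤ ∨ b = ⊤ ∨ c = ⊤
  · rcases h with rfl | rfl | rfl <;> simp
  push Not at h
  lift a to NNReal using h.1
  lift b to NNReal using h.2.1
  lift c to NNReal using h.2.2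
  norm_cast
  rw [← NNReal.coe_le_coe]
  push_cast
  nlinarith [sq_nonneg ((a : ℝ) - b), sq_nonneg ((b : ℝ) - c), sq_nonneg ((a : ℝ) - c)]

/-- The difference of a `C¹` function and its composition with a map `F` close to the identity. -/
theorem lintegral_enorm_comp_sub_sq_le {V : E → ℝ} (hV : ContDiff ℝ 1 V) {S K : Set E}
    (hSc : IsCompact S) (hK : MeasurableSet K) {F : E → E} (hF : Measurable F) {ε : ℝ}
    (hε : 0 < ε) (hFε : ∀ x ∈ S, ‖F x - x‖ ≤ ε) (hSK : ∀ x ∈ S, Metric.closedBall x (2 * ε) ⊆ K)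
    {C : ℝ≥0∞} (hC : Measure.map F (volume.restrict S) ≤ C • volume) :
    ∫⁻ x in S, ‖V (F x) - V x‖ₑ ^ 2 ≤
      3 * (C + 1 + 2 ^ Module.finrank ℝ E) * ENNReal.ofReal ε ^ 2 *
        ∫⁻ x in K, ‖fderiv ℝ V x‖ₑ ^ 2 := by
  have hS : MeasurableSet S := hSc.measurableSet
  set I := ∫⁻ x in K, ‖fderiv ℝ V x‖ₑ ^ 2 with hI
  set B := Metric.ball (0 : E) ε with hB
  set b := (volume : Measure E) B with hb
  have hVc : Continuous V := hV.continuous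
  have hb0 : b ≠ 0 := (Metric.measure_ball_pos _ _ hε).ne'
  have hbt : b ≠ ⊤ := measure_ball_lt_top.ne
  have hnorm : ∀ ξ ∈ B, ‖ξ‖ₑ ^ 2 ≤ ENNReal.ofReal ε ^ 2 := by
    intro ξ hξ
    gcongr
    rw [← ofReal_norm]
    exact ENNReal.ofReal_le_ofReal (mem_ball_zero_iff.1 hξ).le
  have h3 : ∀ ξ ∈ B, ∫⁻ x in S, ‖V (x + ξ) - V x‖ₑ ^ 2 ≤ ENNReal.ofReal ε ^ 2 * I := by
    intro ξ hξ
    refine (lintegral_enorm_translate_sub_sq_le hV hS hK (d := ξ) ?_).trans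
      (mul_le_mul_left (hnorm ξ hξ) _)
    intro z hz t ht
    refine hSK z hz ?_
    rw [Metric.mem_closedBall, dist_eq_norm, add_sub_cancel_left, norm_smul, Real.norm_of_nonneg ht.1]
    have := (mem_ball_zero_iff.1 hξ).le
    nlinarith [ht.1, ht.2, norm_nonneg ξ]
  -- This is where the push-forward bound enters: the integrand depends on `F x` alone, so it can be
  -- integrated against the image measure, which lives within `ε` of `S`, and compared with Lebesgue
  -- measure.
  have h1 : ∀ ξ ∈ B, ∫⁻ x in S, ‖V (F x + ξ) - V (F x)‖ₑ ^ 2 ≤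
      C * (ENNReal.ofReal ε ^ 2 * I) := by
    intro ξ hξ
    set S' := Metric.cthickening ε S with hS'
    have hS'm : MeasurableSet S' := Metric.isClosed_cthickening.measurableSet
    have hm : Measurable fun z => ‖V (z + ξ) - V z‖ₑ ^ 2 := by
      apply Continuous.measurable
      exact (ENNReal.continuous_pow 2).comp
        (((hVc.comp (continuous_id.add continuous_const)).sub hVc).enorm)
    have hmap : ∫⁻ x in S, ‖V (F x + ξ) - V (F x)‖ₑ ^ 2 ≤
        ∫⁻ z in S', ‖V (z + ξ) - V z‖ₑ ^ 2 ∂(Measure.map F (volume.restrict S)) := by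
      rw [← lintegral_indicator hS'm, lintegral_map (hm.indicator hS'm) hF]
      refine setLIntegral_mono' hS fun x hx => ?_
      have : F x ∈ S' := by
        refine Metric.mem_cthickening_of_dist_le (F x) x ε S hx ?_
        rw [dist_eq_norm]
        exact hFε x hx
      rw [indicator_of_mem this]
    have hS'K : ∀ z ∈ S', ∀ t ∈ Icc (0 : ℝ) 1, z + t • ξ ∈ K := by
      intro z hz t ht
      rw [hS', hSc.cthickening_eq_biUnion_closedBall hε.le] at hz
      simp only [mem_iUnion, Metric.mem_closedBall, exists_prop] at hz
      obtain ⟨x, hx, hzx⟩ := hz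
      refine hSK x hx ?_
      rw [dist_eq_norm] at hzx
      rw [Metric.mem_closedBall, dist_eq_norm]
      have h2 : ‖t • ξ‖ ≤ ε := by
        rw [norm_smul, Real.norm_of_nonneg ht.1]
        have := (mem_ball_zero_iff.1 hξ).le
        nlinarith [ht.1, ht.2, norm_nonneg ξ]
      calc ‖z + t • ξ - x‖ = ‖(z - x) + t • ξ‖ := by congr 1; abel
        _ ≤ ‖z - x‖ + ‖t • ξ‖ := norm_add_le _ _
        _ ≤ 2 * ε := by linarith
    calc _ ≤ _ := hmap
      _ ≤ ∫⁻ z in S', ‖V (z + ξ) - V z‖ₑ ^ 2 ∂(C • (volume : Measure E)) :=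
          lintegral_mono' (Measure.restrict_mono le_rfl hC) le_rfl
      _ = C * ∫⁻ z in S', ‖V (z + ξ) - V z‖ₑ ^ 2 := by
          rw [Measure.restrict_smul, lintegral_smul_measure, smul_eq_mul]
      _ ≤ C * (ENNReal.ofReal ε ^ 2 * I) := by
          gcongr
          exact (lintegral_enorm_translate_sub_sq_le hV hS'm hK hS'K).trans
            (mul_le_mul_left (hnorm ξ hξ) _)
  -- For fixed `x` the segments from `x + ξ` to `F x + ξ`, with `ξ` in `B`, stay in the ball of
  -- radius `2 ε` about `x`. Averaging over `ξ` thus replaces any control of the intermediate maps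
  -- `x + t • (F x - x)`. The factor `2 ^ n`, with `n` the dimension, is the volume ratio of the two
  -- balls.
  have h2 : ∫⁻ ξ in B, ∫⁻ x in S, ‖V (F x + ξ) - V (x + ξ)‖ₑ ^ 2 ≤
      ENNReal.ofReal ε ^ 2 * (2 ^ Module.finrank ℝ E * b * I) := by
    have hm : Measurable fun p : E × E => ‖V (F p.2 + p.1) - V (p.2 + p.1)‖ₑ ^ 2 := by
      have hVm := hVc.measurable
      fun_prop
    have hG : Measurable (K.indicator fun z => ‖fderiv ℝ V z‖ₑ ^ 2) :=
      (((hV.continuous_fderiv one_ne_zero).enorm.measurable).pow_const 2).indicator hK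
    set G : E → ℝ≥0∞ := K.indicator fun z => ‖fderiv ℝ V z‖ₑ ^ 2 with hGdef
    rw [lintegral_lintegral_swap hm.aemeasurable]
    set B₂ := Metric.ball (0 : E) (2 * ε) with hB₂
    have hx : ∀ x ∈ S, ∫⁻ ξ in B, ‖V (F x + ξ) - V (x + ξ)‖ₑ ^ 2 ≤
        ENNReal.ofReal ε ^ 2 * ∫⁻ ξ in B₂, G (x + ξ) := by
      intro x hx
      have hd : ‖F x - x‖ₑ ^ 2 ≤ ENNReal.ofReal ε ^ 2 := by
        gcongr
        rw [← ofReal_norm]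
        exact ENNReal.ofReal_le_ofReal (hFε x hx)
      calc ∫⁻ ξ in B, ‖V (F x + ξ) - V (x + ξ)‖ₑ ^ 2
          ≤ ∫⁻ ξ in B, ENNReal.ofReal ε ^ 2 *
              ∫⁻ t in Icc (0 : ℝ) 1, ‖fderiv ℝ V (x + ξ + t • (F x - x))‖ₑ ^ 2 := by
            refine lintegral_mono fun ξ => ?_
            have := hV.enorm_sub_sq_le_lintegral_segment (x + ξ) (F x - x)
            rw [show x + ξ + (F x - x) = F x + ξ by abel] at this
            exact this.trans (mul_le_mul_left hd _)
        _ = ENNReal.ofReal ε ^ 2 * ∫⁻ t in Icc (0 : ℝ) 1, ∫⁻ ξ in B,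
              ‖fderiv ℝ V (x + ξ + t • (F x - x))‖ₑ ^ 2 := by
            rw [lintegral_const_mul' _ _ (by simp), lintegral_lintegral_swap]
            apply Continuous.aemeasurable
            exact (ENNReal.continuous_pow 2).comp
              ((hV.continuous_fderiv one_ne_zero).comp
                (by fun_prop : Continuous fun q : E × ℝ => x + q.1 + q.2 • (F x - x))).enorm
        _ ≤ ENNReal.ofReal ε ^ 2 * ∫⁻ _ in Icc (0 : ℝ) 1, ∫⁻ ξ in B₂, G (x + ξ) := by
            refine mul_le_mul' le_rfl ?_
            refine setLIntegral_mono' (measurableSet_Icc (a := (0 : ℝ)) (b := 1)) fun t ht => ?_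
            rw [← lintegral_indicator Metric.isOpen_ball.measurableSet,
              ← lintegral_indicator Metric.isOpen_ball.measurableSet,
              ← lintegral_add_right_eq_self (μ := volume) (B₂.indicator _) (t • (F x - x))]
            refine lintegral_mono fun ξ => ?_
            by_cases hξ : ξ ∈ B
            · have h5 : ‖t • (F x - x)‖ ≤ ε := by
                rw [norm_smul, Real.norm_of_nonneg ht.1]
                nlinarith [ht.1, ht.2, norm_nonneg (F x - x), hFε x hx]
              have h6 : ‖ξ + t • (F x - x)‖ < 2 * ε := by
                have := norm_add_le ξ (t • (F x - x))
                have := mem_ball_zero_iff.1 hξ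
                linarith
              have h4 : ξ + t • (F x - x) ∈ B₂ := by
                rw [hB₂, mem_ball_zero_iff]
                exact h6
              rw [indicator_of_mem hξ, indicator_of_mem h4, hGdef, indicator_of_mem, ← add_assoc]
              refine hSK x hx ?_
              rw [Metric.mem_closedBall, dist_eq_norm, add_sub_cancel_left]
              exact h6.le
            · rw [indicator_of_notMem hξ]
              exact bot_le
        _ = _ := by simp
    calc ∫⁻ x in S, ∫⁻ ξ in B, ‖V (F x + ξ) - V (x + ξ)‖ₑ ^ 2
        ≤ ∫⁻ x in S, ENNReal.ofReal ε ^ 2 * ∫⁻ ξ in B₂, G (x + ξ) := setLIntegral_mono' hS hx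
      _ = ENNReal.ofReal ε ^ 2 * ∫⁻ ξ in B₂, ∫⁻ x in S, G (x + ξ) := by
          rw [lintegral_const_mul' _ _ (by simp), lintegral_lintegral_swap]
          exact (hG.comp measurable_add).aemeasurable
      _ ≤ ENNReal.ofReal ε ^ 2 * ∫⁻ _ in B₂, I := by
          gcongr with ξ
          refine (setLIntegral_le_lintegral _ _).trans (le_of_eq ?_)
          rw [lintegral_add_right_eq_self G ξ, hGdef, lintegral_indicator hK]
      _ = _ := by
          rw [lintegral_const, Measure.restrict_apply_univ, hB₂, hb, hB,
            Measure.addHaar_ball_of_pos _ _ (by positivity : (0 : ℝ) < 2 * ε),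
            Measure.addHaar_ball_of_pos _ _ hε, mul_pow, ENNReal.ofReal_mul (by positivity),
            ENNReal.ofReal_pow (by norm_num : (0 : ℝ) ≤ 2)]
          simp only [ENNReal.ofReal_ofNat]
          ring
  -- The left side does not depend on `ξ`, so integration over `B` multiplies it by the volume `b`.
  -- The three differences contribute `C`, `2 ^ n` and `1`, each times `b`, which is cancelled at
  -- the end.
  have hmain : b * ∫⁻ x in S, ‖V (F x) - V x‖ₑ ^ 2 ≤
      b * (3 * (C + 1 + 2 ^ Module.finrank ℝ E) * ENNReal.ofReal ε ^ 2 * I) := by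
    have hVm := hVc.measurable
    calc b * ∫⁻ x in S, ‖V (F x) - V x‖ₑ ^ 2
        = ∫⁻ _ in B, ∫⁻ x in S, ‖V (F x) - V x‖ₑ ^ 2 := by
          rw [lintegral_const, Measure.restrict_apply_univ, mul_comm]
      _ ≤ ∫⁻ ξ in B, 3 * (C * (ENNReal.ofReal ε ^ 2 * I) +
            (∫⁻ x in S, ‖V (F x + ξ) - V (x + ξ)‖ₑ ^ 2) + ENNReal.ofReal ε ^ 2 * I) := by
          refine setLIntegral_mono' Metric.isOpen_ball.measurableSet fun ξ hξ => ?_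
          have hp : ∀ x, ‖V (F x) - V x‖ₑ ^ 2 ≤ 3 * (‖V (F x + ξ) - V (F x)‖ₑ ^ 2 +
              ‖V (F x + ξ) - V (x + ξ)‖ₑ ^ 2 + ‖V (x + ξ) - V x‖ₑ ^ 2) := by
            intro x
            refine le_trans ?_ (ENNReal.add_add_sq_le _ _ _)
            gcongr
            rw [show V (F x) - V x = -(V (F x + ξ) - V (F x)) + (V (F x + ξ) - V (x + ξ)) +
              (V (x + ξ) - V x) by ring]
            refine (enorm_add_le _ _).trans ?_
            gcongr
            refine (enorm_add_le _ _).trans ?_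
            rw [enorm_neg]
          refine (lintegral_mono hp).trans ?_
          rw [lintegral_const_mul' _ _ (by simp), lintegral_add_left (by fun_prop),
            lintegral_add_left (by fun_prop)]
          gcongr
          · exact h1 ξ hξ
          · exact h3 ξ hξ
      _ = 3 * (b * (C * (ENNReal.ofReal ε ^ 2 * I)) +
            (∫⁻ ξ in B, ∫⁻ x in S, ‖V (F x + ξ) - V (x + ξ)‖ₑ ^ 2) +
            b * (ENNReal.ofReal ε ^ 2 * I)) := by
          rw [lintegral_const_mul' _ _ (by simp), lintegral_add_right _ (by fun_prop),
            lintegral_add_left (by fun_prop)]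
          rw [lintegral_const, lintegral_const, Measure.restrict_apply_univ, mul_comm b, mul_comm b]
      _ ≤ 3 * (b * (C * (ENNReal.ofReal ε ^ 2 * I)) +
            ENNReal.ofReal ε ^ 2 * (2 ^ Module.finrank ℝ E * b * I) +
            b * (ENNReal.ofReal ε ^ 2 * I)) := by gcongr
      _ = _ := by ring
  exact (ENNReal.mul_le_mul_iff_right hb0 hbt).1 hmain

/-- The difference of a function with square integrable weak gradient on `Ω` and its composition
with a map `F` close to the identity. -/
theorem lintegral_enorm_comp_sub_sq_le_of_weak {v : E → ℝ} {g : E → E →L[ℝ] ℝ} {Ω S : Set E}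
    (hΩ : IsOpen Ω) (hv : IntegrableOn v Ω) (hg : IntegrableOn g Ω)
    (hweak : ∀ φ : E → ℝ, ContDiff ℝ ∞ φ → HasCompactSupport φ → tsupport φ ⊆ Ω → ∀ w : E,
      ∫ x, v x * fderiv ℝ φ x w = -∫ x, g x w * φ x)
    (hSc : IsCompact S) {F : E → E} (hF : Measurable F) {ε : ℝ}
    (hε : 0 < ε) (hFε : ∀ x ∈ S, ‖F x - x‖ ≤ ε) (hSΩ : Metric.cthickening (3 * ε) S ⊆ Ω)
    {C : ℝ≥0∞} (hC : Measure.map F (volume.restrict S) ≤ C • volume) :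
    ∫⁻ x in S, ‖v (F x) - v x‖ₑ ^ 2 ≤
      3 * (C + 1 + 2 ^ Module.finrank ℝ E) * ENNReal.ofReal ε ^ 2 *
        ∫⁻ x in Ω, ‖g x‖ₑ ^ 2 := by
  set v₀ := Ω.indicator v with hv₀
  have hv₀i : Integrable v₀ := hv.integrable_indicator hΩ.measurableSet
  -- The smooth estimate uses gradients within `2 ε` of `S`, and mollifiers of radius at most `ε`
  -- reach `ε` further; this explains the `3 * ε` in `hSΩ`.
  set K := Metric.cthickening (2 * ε) S with hK
  have hKc : IsCompact K := hSc.cthickening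
  have hSK : ∀ x ∈ S, Metric.closedBall x (2 * ε) ⊆ K := by
    intro x hx y hy
    exact Metric.mem_cthickening_of_dist_le y x _ S hx hy
  have hKΩ : ∀ x ∈ K, Metric.closedBall x ε ⊆ Ω := by
    intro x hx y hy
    refine hSΩ ?_
    rw [hK, hSc.cthickening_eq_biUnion_closedBall (by positivity)] at hx
    simp only [mem_iUnion, Metric.mem_closedBall, exists_prop] at hx hy
    obtain ⟨z, hz, hxz⟩ := hx
    refine Metric.mem_cthickening_of_dist_le y z _ S hz ?_
    linarith [dist_triangle y x z]
  -- The inner radius is half the outer one: the bounded ratio yields almost everywhere convergence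
  -- of the mollifications of a function that is only locally integrable.
  let η : ℕ → ContDiffBump (0 : E) := fun i =>
    ⟨ε / (i + 2) / 2, ε / (i + 2), by positivity, half_lt_self (by positivity)⟩
  have hηε : ∀ i, (η i).rOut ≤ ε := by
    intro i
    change ε / (i + 2) ≤ ε
    exact div_le_self hε.le (by linarith [(Nat.cast_nonneg i : (0 : ℝ) ≤ i)])
  have hη0 : Filter.Tendsto (fun i => (η i).rOut) Filter.atTop (𝓝 0) := by
    change Filter.Tendsto (fun i : ℕ => ε / ((i : ℝ) + 2)) Filter.atTop (𝓝 0)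
    exact Filter.Tendsto.const_div_atTop
      (Filter.tendsto_atTop_add_const_right _ _ tendsto_natCast_atTop_atTop) _
  set V : ℕ → E → ℝ := fun i =>
    MeasureTheory.convolution ((η i).normed volume) v₀ (ContinuousLinearMap.lsmul ℝ ℝ) volume with hV
  have hVsmooth : ∀ i, ContDiff ℝ 1 (V i) := fun i =>
    (η i).hasCompactSupport_normed.contDiff_convolution_left _ (η i).contDiff_normed
      hv₀i.locallyIntegrable
  have hae : ∀ᵐ x ∂(volume : Measure E), Filter.Tendsto (fun i => V i x) Filter.atTop (𝓝 (v₀ x)) :=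
    ContDiffBump.ae_convolution_tendsto_right_of_locallyIntegrable (K := 2) hη0
      (Filter.Eventually.of_forall fun i => by
        change ε / (i + 2) ≤ 2 * (ε / (i + 2) / 2)
        linarith) hv₀i.locallyIntegrable
  -- On `K` the kernel recentred at `x` is a test function supported in `Ω`, so the gradient of the
  -- mollification is the mollification of `g`. Jensen for the kernel of mass one and Fubini then do
  -- not increase the square integral.
  have hgrad : ∀ i, ∫⁻ x in K, ‖fderiv ℝ (V i) x‖ₑ ^ 2 ≤ ∫⁻ x in Ω, ‖g x‖ₑ ^ 2 := by
    intro i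
    set φ : E → ℝ := (η i).normed volume with hφ
    have hφs : ContDiff ℝ ∞ φ := (η i).contDiff_normed
    have hφm : Measurable φ := hφs.continuous.measurable
    have hφ1 : ∫⁻ y, ‖φ y‖ₑ = 1 := by
      have h := (η i).integral_normed (μ := (volume : Measure E))
      rw [integral_eq_lintegral_of_nonneg_ae (Filter.Eventually.of_forall (η i).nonneg_normed)
        hφm.aestronglyMeasurable] at h
      have h2 : ∀ y, ‖φ y‖ₑ = ENNReal.ofReal (φ y) := fun y =>
        Real.enorm_of_nonneg ((η i).nonneg_normed y)
      simp_rw [h2]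
      rwa [ENNReal.toReal_eq_one_iff] at h
    have hpt : ∀ x ∈ K, ‖fderiv ℝ (V i) x‖ₑ ≤ ∫⁻ y in Ω, ‖g y‖ₑ * ‖φ (x - y)‖ₑ := by
      intro x hx
      have hder := ((η i).hasCompactSupport_normed (μ := volume)).hasFDerivAt_convolution_left
        (ContinuousLinearMap.lsmul ℝ ℝ) ((η i).contDiff_normed) hv₀i.locallyIntegrable
        (μ := (volume : Measure E)) x
      refine ContinuousLinearMap.opENorm_le_bound _ fun w => ?_
      set ψ : E → ℝ := fun y => φ (x - y) with hψ
      have hψs : ContDiff ℝ ∞ ψ := hφs.comp (contDiff_const.sub contDiff_id)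
      have hψt : tsupport ψ ⊆ Metric.closedBall x ε := by
        refine closure_minimal ?_ Metric.isClosed_closedBall
        intro y hy
        have h1 : x - y ∈ Function.support φ := hy
        rw [hφ, (η i).support_normed_eq, mem_ball_zero_iff] at h1
        rw [Metric.mem_closedBall, dist_comm, dist_eq_norm]
        exact h1.le.trans (hηε i)
      have hψc : HasCompactSupport ψ := (isCompact_closedBall x ε).of_isClosed_subset
        (isClosed_tsupport _) hψt
      have hψd : ∀ y, fderiv ℝ ψ y w = -fderiv ℝ φ (x - y) w := by
        intro y
        have h1 : HasFDerivAt (fun y => x - y) (-ContinuousLinearMap.id ℝ E) y :=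
          (hasFDerivAt_id y).const_sub x
        have h2 := ((hφs.differentiable (by simp)) (x - y)).hasFDerivAt.comp y h1
        rw [hψ]
        erw [h2.fderiv]
        simp
      have hw := hweak ψ hψs hψc (hψt.trans (hKΩ x hx)) w
      have heq : fderiv ℝ (V i) x w = ∫ y, g y w * φ (x - y) := by
        have hd : fderiv ℝ (V i) x = MeasureTheory.convolution (fderiv ℝ φ) v₀
            ((ContinuousLinearMap.lsmul ℝ ℝ).precompL E) volume x := hder.fderiv
        have hex := (((η i).hasCompactSupport_normed (μ := volume)).fderiv (𝕜 := ℝ)).convolutionExists_left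
          ((ContinuousLinearMap.lsmul ℝ ℝ).precompL E) (hφs.continuous_fderiv (by simp))
          hv₀i.locallyIntegrable x
        rw [hd, convolution_def, ContinuousLinearMap.integral_apply hex]
        simp only [ContinuousLinearMap.precompL_apply, ContinuousLinearMap.lsmul_apply, smul_eq_mul]
        have h3 := integral_sub_left_eq_self (fun y => fderiv ℝ φ (x - y) w * v₀ y) volume x
        simp only [sub_sub_cancel] at h3
        rw [h3]
        have h4 : ∀ y, fderiv ℝ φ (x - y) w * v₀ y = -(v y * fderiv ℝ ψ y w) := by
          intro y
          rw [hψd y]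
          by_cases hy : y ∈ Ω
          · rw [hv₀, indicator_of_mem hy]
            ring
          -- Outside `Ω` the zero extension `v₀` and `v` may differ, but the test function vanishes
          -- there.
          · have : fderiv ℝ ψ y = 0 := by
              by_contra hne
              exact hy (hKΩ x hx (hψt (support_fderiv_subset ℝ hne)))
            have h5 := hψd y
            rw [this] at h5
            rw [← h5, hv₀, indicator_of_notMem hy]
            simp
        simp_rw [h4]
        rw [integral_neg, hw, neg_neg]
      rw [heq]
      refine (enorm_integral_le_lintegral_enorm _).trans ?_
      rw [← lintegral_mul_const' _ _ (by simp)]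
      rw [← lintegral_indicator hΩ.measurableSet]
      refine lintegral_mono fun y => ?_
      by_cases hy : y ∈ Ω
      · rw [indicator_of_mem hy, enorm_mul, mul_right_comm]
        gcongr
        exact ContinuousLinearMap.le_opENorm _ _
      · have : φ (x - y) = 0 := by
          by_contra hne
          exact hy (hKΩ x hx (hψt (subset_tsupport _ hne)))
        simp [this]
    have hgm : AEMeasurable (fun y => ‖g y‖ₑ) (volume.restrict Ω) := hg.1.enorm
    calc ∫⁻ x in K, ‖fderiv ℝ (V i) x‖ₑ ^ 2
        ≤ ∫⁻ x in K, ∫⁻ y in Ω, ‖g y‖ₑ ^ 2 * ‖φ (x - y)‖ₑ := by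
          refine setLIntegral_mono' hKc.measurableSet fun x hx => ?_
          refine (pow_le_pow_left' (hpt x hx) 2).trans ?_
          refine (ENNReal.sq_lintegral_mul_le_of_weight hgm
            (by fun_prop : Measurable fun y => ‖φ (x - y)‖ₑ).aemeasurable).trans ?_
          refine (mul_le_mul' le_rfl ?_).trans (mul_one _).le
          refine (setLIntegral_le_lintegral _ _).trans ?_
          rw [lintegral_sub_left_eq_self (fun y => ‖φ y‖ₑ) x, hφ1]
      _ = ∫⁻ y in Ω, ∫⁻ x in K, ‖g y‖ₑ ^ 2 * ‖φ (x - y)‖ₑ := by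
          refine lintegral_lintegral_swap ?_
          refine AEMeasurable.mul ?_ (by fun_prop : Measurable fun p : E × E => ‖φ (p.1 - p.2)‖ₑ).aemeasurable
          exact (hgm.comp_quasiMeasurePreserving Measure.quasiMeasurePreserving_snd).pow_const 2
      _ ≤ ∫⁻ y in Ω, ‖g y‖ₑ ^ 2 := by
          refine lintegral_mono fun y => ?_
          rw [lintegral_const_mul _ (by fun_prop)]
          refine (mul_le_mul' le_rfl ?_).trans (mul_one _).le
          refine (setLIntegral_le_lintegral _ _).trans ?_
          rw [lintegral_sub_right_eq_self (fun x => ‖φ x‖ₑ) y, hφ1]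
  have hSm := hSc.measurableSet
  have hSΩ' : S ⊆ Ω := (Metric.self_subset_cthickening S).trans hSΩ
  have hFΩ : ∀ x ∈ S, F x ∈ Ω := fun x hx => hSΩ (Metric.mem_cthickening_of_dist_le _ x _ S hx (by
    rw [dist_eq_norm]
    linarith [hFε x hx]))
  -- The null set where the mollifications fail to converge has a null preimage under `F`, by the
  -- bound on the image measure. Fatou's lemma then passes the smooth estimate to the limit.
  have hlim : ∀ᵐ x ∂(volume.restrict S),
      Filter.Tendsto (fun i => ‖V i (F x) - V i x‖ₑ ^ 2) Filter.atTop
        (𝓝 (‖v (F x) - v x‖ₑ ^ 2)) := by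
    have h1 : ∀ᵐ x ∂(volume.restrict S),
        Filter.Tendsto (fun i => V i (F x)) Filter.atTop (𝓝 (v₀ (F x))) := by
      refine ae_of_ae_map (p := fun y => Filter.Tendsto (fun i => V i y) Filter.atTop (𝓝 (v₀ y)))
        hF.aemeasurable ?_
      exact (Measure.absolutelyContinuous_of_le_smul hC).ae_le hae
    filter_upwards [h1, ae_restrict_of_ae hae, ae_restrict_mem hSm] with x h1 h2 hx
    rw [hv₀, indicator_of_mem (hFΩ x hx)] at h1
    rw [hv₀, indicator_of_mem (hSΩ' hx)] at h2
    exact ((ENNReal.continuous_pow 2).tendsto _).comp (h1.sub h2).enorm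
  calc ∫⁻ x in S, ‖v (F x) - v x‖ₑ ^ 2
      = ∫⁻ x in S, Filter.liminf (fun i => ‖V i (F x) - V i x‖ₑ ^ 2) Filter.atTop := by
        refine lintegral_congr_ae ?_
        filter_upwards [hlim] with x hx using hx.liminf_eq.symm
    _ ≤ Filter.liminf (fun i => ∫⁻ x in S, ‖V i (F x) - V i x‖ₑ ^ 2) Filter.atTop := by
        refine lintegral_liminf_le fun i => ?_
        have := (hVsmooth i).continuous.measurable
        fun_prop
    _ ≤ Filter.liminf (fun _ : ℕ => 3 * (C + 1 + 2 ^ Module.finrank ℝ E) * ENNReal.ofReal ε ^ 2 *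
          ∫⁻ x in Ω, ‖g x‖ₑ ^ 2) Filter.atTop := by
        refine Filter.liminf_le_liminf (Filter.Eventually.of_forall fun i => ?_)
        refine (lintegral_enorm_comp_sub_sq_le (hVsmooth i) hSc hKc.measurableSet hF hε hFε hSK
          hC).trans ?_
        exact mul_le_mul' le_rfl (hgrad i)
    _ = _ := by simp

end SobolevComposition

/-! ### Normals, curvature and closest points of a closed C² hypersurface -/

namespace SurfaceFEM

variable {n : ℕ} {γ : Set (Amb n)} {p : Amb n} {φ φ₁ φ₂ : Amb n → ℝ}

theorem IsLocalDefining.differentiableAt (h : IsLocalDefining γ p φ) : DifferentiableAt ℝ φ p :=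
  h.1.differentiableAt two_ne_zero

theorem IsLocalDefining.hasStrictFDerivAt (h : IsLocalDefining γ p φ) :
    HasStrictFDerivAt φ (fderiv ℝ φ p) p :=
  h.1.hasStrictFDerivAt two_ne_zero

theorem inner_gradient_eq (φ : Amb n → ℝ) (p w : Amb n) : ⟪gradient φ p, w⟫ = fderiv ℝ φ p w := by
  simp [gradient]

theorem IsLocalDefining.fderiv_ne_zero (h : IsLocalDefining γ p φ) : fderiv ℝ φ p ≠ 0 := by
  intro h0
  apply h.2.1
  simp [gradient, h0]

theorem IsLocalDefining.contDiffAt_gradient (h : IsLocalDefining γ p φ) :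
    ContDiffAt ℝ 1 (gradient φ) p := by
  have h1 : ContDiffAt ℝ 1 (fderiv ℝ φ) p := h.1.fderiv_right (by norm_num)
  exact (InnerProductSpace.toDual ℝ (Amb n)).symm.contDiff.contDiffAt.comp p h1

theorem IsLocalDefining.eventually (h : IsLocalDefining γ p φ) :
    ∀ᶠ q in 𝓝 p, IsLocalDefining γ q φ := by
  filter_upwards [h.1.eventually (by simp), h.contDiffAt_gradient.continuousAt.eventually_ne h.2.1,
    h.2.2.eventually_nhds] with q h1 h2 h3
  exact ⟨h1, h2, h3⟩

theorem IsLocalDefining.norm_unitNormal (h : IsLocalDefining γ p φ) : ‖unitNormal φ p‖ = 1 := by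
  rw [unitNormal, norm_smul, norm_inv, norm_norm, inv_mul_cancel₀ (norm_ne_zero_iff.2 h.2.1)]

theorem IsLocalDefining.contDiffAt_unitNormal (h : IsLocalDefining γ p φ) :
    ContDiffAt ℝ 1 (unitNormal φ) p :=
  ((h.contDiffAt_gradient.norm ℝ h.2.1).inv (norm_ne_zero_iff.2 h.2.1)).smul h.contDiffAt_gradient

theorem IsLocalDefining.apply_eq_zero (h : IsLocalDefining γ p φ) (hp : p ∈ γ) : φ p = 0 :=
  h.2.2.self_of_nhds.1 hp

/-- A function with a local extremum on the hypersurface has its gradient along the normal. -/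
theorem IsLocalDefining.exists_smul_of_isLocalExtrOn (h : IsLocalDefining γ p φ) (hp : p ∈ γ)
    {f : Amb n → ℝ} {f' : Amb n →L[ℝ] ℝ} (hf : HasStrictFDerivAt f f' p)
    (hext : IsLocalExtrOn f γ p) : ∃ c : ℝ, f' = c • fderiv ℝ φ p := by
  have hset : 𝓝[{x | φ x = φ p}] p = 𝓝[γ] p := by
    rw [nhdsWithin_eq_iff_eventuallyEq]
    filter_upwards [h.2.2] with x hx
    rw [h.apply_eq_zero hp]
    exact propext hx.symm
  have hext' : IsLocalExtrOn f {x | φ x = φ p} p := by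
    unfold IsLocalExtrOn at hext ⊢
    rwa [hset]
  obtain ⟨a, b, hab, heq⟩ := hext'.exists_multipliers_of_hasStrictFDerivAt_1d
    h.hasStrictFDerivAt hf
  have hb : b ≠ 0 := by
    rintro rfl
    rw [zero_smul, add_zero] at heq
    rcases smul_eq_zero.1 heq with h0 | h0
    · exact hab (by rw [h0]; rfl)
    · exact h.fderiv_ne_zero h0
  refine ⟨-(b⁻¹ * a), ?_⟩
  have h2 : b • f' = -(a • fderiv ℝ φ p) := (neg_eq_of_add_eq_zero_right heq).symm
  calc f' = b⁻¹ • (b • f') := by rw [smul_smul, inv_mul_cancel₀ hb, one_smul]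
    _ = _ := by rw [h2, smul_neg, smul_smul, neg_smul]

/-- `φ₂` is constant on γ, so `p` is an extremum of `φ₂` constrained to the zero set of `φ₁`, and a
Lagrange multiplier exists. -/
theorem IsLocalDefining.gradient_eq_smul (h₁ : IsLocalDefining γ p φ₁)
    (h₂ : IsLocalDefining γ p φ₂) (hp : p ∈ γ) :
    ∃ c : ℝ, gradient φ₂ p = c • gradient φ₁ p := by
  obtain ⟨c, hc⟩ := h₁.exists_smul_of_isLocalExtrOn hp h₂.hasStrictFDerivAt (by
    left
    filter_upwards [self_mem_nhdsWithin, nhdsWithin_le_nhds h₂.2.2] with x hx h3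
    rw [h₂.apply_eq_zero hp, h3.1 hx])
  exact ⟨c, by simp [gradient, hc]⟩

theorem IsLocalDefining.unitNormal_eq_or_neg (h₁ : IsLocalDefining γ p φ₁)
    (h₂ : IsLocalDefining γ p φ₂) (hp : p ∈ γ) :
    unitNormal φ₂ p = unitNormal φ₁ p ∨ unitNormal φ₂ p = -unitNormal φ₁ p := by
  obtain ⟨c, hc⟩ := h₁.gradient_eq_smul h₂ hp
  have hc' : unitNormal φ₂ p = (‖gradient φ₂ p‖⁻¹ * c * ‖gradient φ₁ p‖) • unitNormal φ₁ p := by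
    rw [unitNormal, unitNormal, smul_smul, mul_assoc (_ * c),
      mul_inv_cancel₀ (norm_ne_zero_iff.2 h₁.2.1), mul_one, mul_smul, ← hc]
  have h3 := congrArg norm hc'
  rw [norm_smul, h₁.norm_unitNormal, h₂.norm_unitNormal, mul_one, Real.norm_eq_abs, eq_comm] at h3
  rcases eq_or_eq_neg_of_abs_eq h3 with h4 | h4
  · left; rw [hc', h4, one_smul]
  · right; rw [hc', h4, neg_smul, one_smul]

/-- At each point the two unit normals agree up to sign; their inner product is continuous and of
modulus one on γ, so the sign is constant near `p`. -/
theorem IsLocalDefining.exists_sign (h₁ : IsLocalDefining γ p φ₁)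
    (h₂ : IsLocalDefining γ p φ₂) (hp : p ∈ γ) :
    ∃ σ : ℝ, |σ| = 1 ∧ ∀ᶠ q in 𝓝[γ] p, unitNormal φ₂ q = σ • unitNormal φ₁ q := by
  have hev : ∀ᶠ q in 𝓝[γ] p, unitNormal φ₂ q = unitNormal φ₁ q ∨
      unitNormal φ₂ q = -unitNormal φ₁ q := by
    filter_upwards [self_mem_nhdsWithin, nhdsWithin_le_nhds h₁.eventually,
      nhdsWithin_le_nhds h₂.eventually] with q hq h1 h2
    exact h1.unitNormal_eq_or_neg h2 hq
  have hc1 := h₁.contDiffAt_unitNormal.continuousAt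
  have hc2 := h₂.contDiffAt_unitNormal.continuousAt
  have hn := h₁.norm_unitNormal
  have hn1 : ∀ᶠ q in 𝓝[γ] p, ‖unitNormal φ₁ q‖ = 1 :=
    nhdsWithin_le_nhds (h₁.eventually.mono fun q hq => hq.norm_unitNormal)
  rcases h₁.unitNormal_eq_or_neg h₂ hp with h | h
  · refine ⟨1, by simp, ?_⟩
    have h3 : ∀ᶠ q in 𝓝[γ] p, 0 < ⟪unitNormal φ₂ q, unitNormal φ₁ q⟫ := by
      refine nhdsWithin_le_nhds ((hc2.inner hc1).eventually_const_lt ?_)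
      change 0 < ⟪unitNormal φ₂ p, unitNormal φ₁ p⟫
      rw [h, real_inner_self_eq_norm_sq, hn]
      norm_num
    filter_upwards [hev, h3, hn1] with q h4 h5 h6
    rcases h4 with h4 | h4
    · rw [h4, one_smul]
    · rw [h4, inner_neg_left, real_inner_self_eq_norm_sq, h6] at h5
      norm_num at h5
  · refine ⟨-1, by simp, ?_⟩
    have h3 : ∀ᶠ q in 𝓝[γ] p, ⟪unitNormal φ₂ q, unitNormal φ₁ q⟫ < 0 := by
      refine nhdsWithin_le_nhds ((hc2.inner hc1).eventually_lt_const ?_)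
      change ⟪unitNormal φ₂ p, unitNormal φ₁ p⟫ < 0
      rw [h, inner_neg_left, real_inner_self_eq_norm_sq, hn]
      norm_num
    filter_upwards [hev, h3, hn1] with q h4 h5 h6
    rcases h4 with h4 | h4
    · rw [h4, real_inner_self_eq_norm_sq, h6] at h5
      norm_num at h5
    · rw [h4, neg_smul, one_smul]

/-- Every tangent direction is realized by a curve in the hypersurface. -/
theorem IsLocalDefining.exists_curve (h : IsLocalDefining γ p φ) (hp : p ∈ γ) {τ : Amb n}
    (hτ : ⟪gradient φ p, τ⟫ = 0) :
    ∃ c : ℝ → Amb n, c 0 = p ∧ HasDerivAt c τ 0 ∧ ∀ᶠ s in 𝓝 0, c s ∈ γ := by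
  have hs := h.hasStrictFDerivAt
  have hsurj : (fderiv ℝ φ p).range = ⊤ := by
    rw [LinearMap.range_eq_top]
    refine LinearMap.surjective fun h0 => h.fderiv_ne_zero ?_
    ext w
    exact LinearMap.congr_fun h0 w
  have hτk : τ ∈ (fderiv ℝ φ p).ker := by
    rw [LinearMap.mem_ker]
    simpa [inner_gradient_eq] using hτ
  have hder := hs.to_implicitFunction hsurj
  set k : (fderiv ℝ φ p).ker := ⟨τ, hτk⟩ with hk
  refine ⟨fun s => hs.implicitFunction φ (fderiv ℝ φ p) hsurj (φ p) (s • k), ?_, ?_, ?_⟩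
  · simp
  · have h1 : HasDerivAt (fun s : ℝ => s • k) k 0 := by
      simpa using (hasDerivAt_id (0 : ℝ)).smul_const k
    have h2 : HasFDerivAt (hs.implicitFunction φ (fderiv ℝ φ p) hsurj (φ p))
      ((fderiv ℝ φ p).ker.subtypeL) ((0 : ℝ) • k) := by
      rw [zero_smul]
      exact hder.hasFDerivAt
    exact h2.comp_hasDerivAt 0 h1
  · have htend : Filter.Tendsto (fun s : ℝ => s • k) (𝓝 0) (𝓝 0) := by
      have : Continuous fun s : ℝ => s • k := by fun_prop
      simpa using this.tendsto 0
    have h1 := hs.tendsto_implicitFunction hsurj (tendsto_const_nhds (x := φ p)) htend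
    have h2 : Filter.Tendsto (fun s : ℝ => (φ p, s • k)) (𝓝 0) (𝓝 (φ p, 0)) :=
      tendsto_const_nhds.prodMk_nhds htend
    filter_upwards [h1.eventually h.2.2, h2.eventually (hs.map_implicitFunction_eq hsurj)]
      with s h3 h4
    rw [h3, h4, h.apply_eq_zero hp]

theorem inner_unitNormal_eq_zero_iff (h : IsLocalDefining γ p φ) {τ : Amb n} :
    ⟪unitNormal φ p, τ⟫ = 0 ↔ ⟪gradient φ p, τ⟫ = 0 := by
  rw [unitNormal, real_inner_smul_left]
  simp [h.2.1]

/-- Differentiate both unit normals along a curve in γ with velocity `τ`, where they agree up to a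
fixed sign. Hence the Weingarten map, and with it `maxCurvature`, does not depend on the defining
function. -/
theorem IsLocalDefining.norm_fderiv_unitNormal_eq (h₁ : IsLocalDefining γ p φ₁)
    (h₂ : IsLocalDefining γ p φ₂) (hp : p ∈ γ) {τ : Amb n} (hτ : ⟪gradient φ₁ p, τ⟫ = 0) :
    ‖fderiv ℝ (unitNormal φ₂) p τ‖ = ‖fderiv ℝ (unitNormal φ₁) p τ‖ := by
  obtain ⟨σ, hσ, hev⟩ := h₁.exists_sign h₂ hp
  obtain ⟨c, hc0, hc, hcγ⟩ := h₁.exists_curve hp hτ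
  have hct : Filter.Tendsto c (𝓝 0) (𝓝[γ] p) := by
    refine tendsto_nhdsWithin_iff.2 ⟨?_, hcγ⟩
    have := hc.continuousAt.tendsto
    rwa [hc0] at this
  have hd : ∀ {φ : Amb n → ℝ}, IsLocalDefining γ p φ →
      HasDerivAt (fun s => unitNormal φ (c s)) (fderiv ℝ (unitNormal φ) p τ) 0 := by
    intro φ h
    have h1 := (h.contDiffAt_unitNormal.differentiableAt one_ne_zero).hasFDerivAt
    rw [← hc0] at h1 ⊢
    exact h1.comp_hasDerivAt 0 hc
  have h3 : HasDerivAt (fun s => unitNormal φ₂ (c s)) (σ • fderiv ℝ (unitNormal φ₁) p τ) 0 :=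
    ((hd h₁).const_smul σ).congr_of_eventuallyEq (hct.eventually hev)
  rw [(hd h₂).unique h3, norm_smul, Real.norm_eq_abs, hσ, one_mul]

theorem maxCurvature_nonneg (γ : Set (Amb n)) (p : Amb n) : 0 ≤ maxCurvature γ p := by
  refine Real.sSup_nonneg ?_
  rintro r ⟨φ, -, τ, -, -, rfl⟩
  exact norm_nonneg _

theorem curvatureSup_nonneg (γ S : Set (Amb n)) : 0 ≤ curvatureSup γ S := by
  refine Real.sSup_nonneg ?_
  rintro r ⟨p, -, rfl⟩
  exact maxCurvature_nonneg γ p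

/-- The real `sSup` of an unbounded set is `0` by default, so `maxCurvature` is meaningful only
after its defining set is bounded. One defining function bounds the values of all of them. -/
theorem IsLocalDefining.mem_upperBounds (h : IsLocalDefining γ p φ) (hp : p ∈ γ) :
    ‖fderiv ℝ (unitNormal φ) p‖ ∈ upperBounds {r : ℝ | ∃ φ : Amb n → ℝ, IsLocalDefining γ p φ ∧
      ∃ τ : Amb n, ‖τ‖ = 1 ∧ ⟪gradient φ p, τ⟫ = 0 ∧ r = ‖fderiv ℝ (unitNormal φ) p τ‖} := by
  rintro r ⟨φ', h', τ, hτ1, hτ, rfl⟩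
  rw [← h'.norm_fderiv_unitNormal_eq h hp hτ]
  simpa [hτ1] using (fderiv ℝ (unitNormal φ) p).le_opNorm τ

theorem IsLocalDefining.maxCurvature_le (h : IsLocalDefining γ p φ) (hp : p ∈ γ) :
    maxCurvature γ p ≤ ‖fderiv ℝ (unitNormal φ) p‖ :=
  Real.sSup_le (fun _ hr => h.mem_upperBounds hp hr) (norm_nonneg _)

theorem IsLocalDefining.norm_fderiv_unitNormal_le (h : IsLocalDefining γ p φ) (hp : p ∈ γ)
    {τ : Amb n} (hτ : ⟪gradient φ p, τ⟫ = 0) :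
    ‖fderiv ℝ (unitNormal φ) p τ‖ ≤ maxCurvature γ p * ‖τ‖ := by
  rcases eq_or_ne τ 0 with rfl | h0
  · simp
  have hn : ‖τ‖ ≠ 0 := norm_ne_zero_iff.2 h0
  have h1 : ‖fderiv ℝ (unitNormal φ) p (‖τ‖⁻¹ • τ)‖ ≤ maxCurvature γ p := by
    refine le_csSup ⟨_, h.mem_upperBounds hp⟩ ⟨φ, h, ‖τ‖⁻¹ • τ, ?_, ?_, rfl⟩
    · rw [norm_smul, norm_inv, norm_norm, inv_mul_cancel₀ hn]
    · rw [real_inner_smul_right, hτ, mul_zero]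
  rw [map_smul, norm_smul, norm_inv, norm_norm] at h1
  rw [inv_mul_le_iff₀ (by positivity)] at h1
  linarith

/-- The derivative of the unit normal is continuous near each point and therefore locally bounded;
compactness of γ does the rest. -/
theorem IsClosedC2Hypersurface.bddAbove_maxCurvature (hγ : IsClosedC2Hypersurface γ) :
    BddAbove (maxCurvature γ '' γ) := by
  have key : ∀ S ⊆ γ, IsCompact S → BddAbove (maxCurvature γ '' S) := by
    intro S hS hSc
    refine hSc.induction_on (p := fun S => BddAbove (maxCurvature γ '' (S ∩ γ))) ?_ ?_ ?_ ?_
      |>.mono (image_mono (subset_inter le_rfl hS))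
    · simp
    · exact fun s t hst ht => ht.mono (image_mono (inter_subset_inter_left _ hst))
    · intro s t hs ht
      rw [union_inter_distrib_right, image_union]
      exact hs.union ht
    · intro x hx
      obtain ⟨φ, h⟩ := hγ.2 x (hS hx)
      have hc : ContinuousAt (fun q => ‖fderiv ℝ (unitNormal φ) q‖) x :=
        (h.contDiffAt_unitNormal.fderiv_right (m := 0) (by norm_num)).continuousAt.norm
      refine ⟨{q | IsLocalDefining γ q φ ∧
        ‖fderiv ℝ (unitNormal φ) q‖ < ‖fderiv ℝ (unitNormal φ) x‖ + 1}, ?_, ?_⟩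
      · exact nhdsWithin_le_nhds (h.eventually.and (hc.eventually_lt_const (lt_add_one _)))
      · refine ⟨‖fderiv ℝ (unitNormal φ) x‖ + 1, ?_⟩
        rintro _ ⟨q, ⟨⟨h1, h2⟩, hq⟩, rfl⟩
        exact (h1.maxCurvature_le hq).trans h2.le
  exact key γ le_rfl hγ.1

theorem IsClosedC2Hypersurface.maxCurvature_le_curvatureSup (hγ : IsClosedC2Hypersurface γ)
    {S : Set (Amb n)} (hS : S ⊆ γ) (hp : p ∈ S) : maxCurvature γ p ≤ curvatureSup γ S :=
  le_csSup (hγ.bddAbove_maxCurvature.mono (image_mono hS)) (mem_image_of_mem _ hp)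

open Classical in
/-- A unit normal field of a hypersurface, with no continuous choice of the sign. -/
noncomputable def normalField (γ : Set (Amb n)) (p : Amb n) : Amb n :=
  if h : ∃ φ : Amb n → ℝ, IsLocalDefining γ p φ then unitNormal h.choose p else 0

theorem IsClosedC2Hypersurface.exists_normalField_eq (hγ : IsClosedC2Hypersurface γ) (hp : p ∈ γ) :
    ∃ φ : Amb n → ℝ, IsLocalDefining γ p φ ∧ normalField γ p = unitNormal φ p := by
  have h := hγ.2 p hp
  exact ⟨h.choose, h.choose_spec, by rw [normalField, dif_pos h]⟩

theorem IsClosedC2Hypersurface.norm_normalField (hγ : IsClosedC2Hypersurface γ) (hp : p ∈ γ) :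
    ‖normalField γ p‖ = 1 := by
  obtain ⟨φ, h, hN⟩ := hγ.exists_normalField_eq hp
  rw [hN, h.norm_unitNormal]

theorem IsLocalDefining.normalField_eq_or_neg (h : IsLocalDefining γ p φ)
    (hγ : IsClosedC2Hypersurface γ) (hp : p ∈ γ) :
    ∃ σ : ℝ, |σ| = 1 ∧ unitNormal φ p = σ • normalField γ p := by
  obtain ⟨φ', h', hN⟩ := hγ.exists_normalField_eq hp
  rw [hN]
  rcases h'.unitNormal_eq_or_neg h hp with h1 | h1
  · exact ⟨1, by simp, by rw [h1, one_smul]⟩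
  · exact ⟨-1, by simp, by rw [h1, neg_smul, one_smul]⟩

/-- A defining function vanishes at both ends of the secant, so its first order expansion at `p`
leaves only the remainder. -/
theorem IsClosedC2Hypersurface.eventually_abs_inner_normalField_le (hγ : IsClosedC2Hypersurface γ)
    (hp : p ∈ γ) {ε : ℝ} (hε : 0 < ε) :
    ∀ᶠ q in 𝓝[γ] p, |⟪normalField γ p, q - p⟫| ≤ ε * ‖q - p‖ := by
  obtain ⟨φ, h, hN⟩ := hγ.exists_normalField_eq hp
  have hg : 0 < ‖gradient φ p‖ := norm_pos_iff.2 h.2.1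
  have h1 := h.differentiableAt.hasFDerivAt.isLittleO.bound (mul_pos hε hg)
  filter_upwards [self_mem_nhdsWithin, nhdsWithin_le_nhds h1, nhdsWithin_le_nhds h.2.2]
    with q hq h2 h3
  rw [h.apply_eq_zero hp, h3.1 hq, sub_zero, zero_sub, norm_neg, Real.norm_eq_abs] at h2
  rw [hN, unitNormal, real_inner_smul_left, inner_gradient_eq, abs_mul,
    abs_of_nonneg (by positivity), inv_mul_le_iff₀ hg]
  linarith

/-- Split `q - p` into tangential and normal parts. On the first the derivative of the normal is
bounded by the curvature; the second is of higher order. The factor `σ` is needed because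
`normalField` chooses its sign at each point separately. -/
theorem IsClosedC2Hypersurface.eventually_norm_normalField_sub_le
    (hγ : IsClosedC2Hypersurface γ) (hp : p ∈ γ) {ε : ℝ} (hε : 0 < ε) :
    ∀ᶠ q in 𝓝[γ] p, ∃ σ : ℝ, |σ| = 1 ∧
      ‖σ • normalField γ q - normalField γ p‖ ≤ (maxCurvature γ p + ε) * ‖q - p‖ := by
  obtain ⟨φ, h, hN⟩ := hγ.exists_normalField_eq hp
  set A := fderiv ℝ (unitNormal φ) p with hA
  have h1 := (h.contDiffAt_unitNormal.differentiableAt one_ne_zero).hasFDerivAt.isLittleO.bound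
    (half_pos hε)
  -- The tolerance is chosen so that the normal part of `q - p`, after applying `A`, costs `ε / 2`;
  -- the differentiability remainder costs the other half.
  have h2 := hγ.eventually_abs_inner_normalField_le hp
    (show 0 < ε / 2 / (‖A‖ + 1) by positivity)
  filter_upwards [self_mem_nhdsWithin, nhdsWithin_le_nhds h1, h2, nhdsWithin_le_nhds h.eventually]
    with q hq h1 h2 h3
  obtain ⟨σ, hσ, hνq⟩ := h3.normalField_eq_or_neg hγ hq
  refine ⟨σ, hσ, ?_⟩
  rw [← hνq, hN]
  set ν := unitNormal φ p with hν
  rw [hN] at h2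
  set τ := (q - p) - ⟪ν, q - p⟫ • ν with hτ
  have hν1 : ‖ν‖ = 1 := h.norm_unitNormal
  have hinner : ⟪ν, τ⟫ = 0 := by
    rw [hτ, inner_sub_right, real_inner_smul_right, real_inner_self_eq_norm_sq, hν1]
    ring
  have hτn : ‖τ‖ ≤ ‖q - p‖ := by
    have h4 : ‖q - p‖ ^ 2 = ‖τ‖ ^ 2 + ⟪ν, q - p⟫ ^ 2 := by
      have h5 : q - p = τ + ⟪ν, q - p⟫ • ν := by rw [hτ]; abel
      conv_lhs => rw [h5]
      rw [norm_add_sq_real, real_inner_smul_right, real_inner_comm ν τ, hinner, norm_smul, hν1,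
        Real.norm_eq_abs, mul_one, sq_abs]
      ring
    exact (sq_le_sq₀ (norm_nonneg _) (norm_nonneg _)).1 (by nlinarith [sq_nonneg ⟪ν, q - p⟫])
  have hAτ := h.norm_fderiv_unitNormal_le hp ((inner_unitNormal_eq_zero_iff h).1 hinner)
  have hsplit : A (q - p) = A τ + ⟪ν, q - p⟫ • A ν := by
    rw [← map_smul, ← map_add, hτ]
    congr 1
    abel
  have hAn : ‖⟪ν, q - p⟫ • A ν‖ ≤ ε / 2 * ‖q - p‖ := by
    rw [norm_smul, Real.norm_eq_abs]
    have h6 : ‖A ν‖ ≤ ‖A‖ + 1 := by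
      have := A.le_opNorm ν
      rw [hν1, mul_one] at this
      linarith
    calc |⟪ν, q - p⟫| * ‖A ν‖ ≤ (ε / 2 / (‖A‖ + 1) * ‖q - p‖) * (‖A‖ + 1) := by gcongr
      _ = ε / 2 * ‖q - p‖ := by field_simp
  have hfin : unitNormal φ q - ν = (unitNormal φ q - ν - A (q - p)) + (A τ + ⟪ν, q - p⟫ • A ν) := by
    rw [← hsplit]
    abel
  rw [hfin]
  refine (norm_add_le _ _).trans ?_
  refine (add_le_add h1 ((norm_add_le _ _).trans (add_le_add hAτ hAn))).trans ?_
  have := mul_le_mul_of_nonneg_left hτn (maxCurvature_nonneg γ p)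
  linarith

theorem IsClosedC2Hypersurface.exists_curve (hγ : IsClosedC2Hypersurface γ) (hp : p ∈ γ)
    {τ : Amb n} (hτ : ⟪normalField γ p, τ⟫ = 0) :
    ∃ c : ℝ → Amb n, c 0 = p ∧ HasDerivAt c τ 0 ∧ ∀ᶠ s in 𝓝 0, c s ∈ γ := by
  obtain ⟨φ, h, hN⟩ := hγ.exists_normalField_eq hp
  rw [hN] at hτ
  exact h.exists_curve hp ((inner_unitNormal_eq_zero_iff h).1 hτ)

/-- The squared distance to `x` has a constrained minimum at `p`, so its gradient there is a
multiple of the gradient of a defining function. -/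
theorem IsClosedC2Hypersurface.sub_eq_smul_normalField (hγ : IsClosedC2Hypersurface γ)
    {x : Amb n} (hx : IsClosestPoint γ x p) :
    x - p = ⟪normalField γ p, x - p⟫ • normalField γ p := by
  obtain ⟨φ, h, hN⟩ := hγ.exists_normalField_eq hx.1
  have hf : HasStrictFDerivAt (fun y : Amb n => ‖y - x‖ ^ 2)
      ((2 : ℕ) • (innerSL ℝ (p - x)).comp (ContinuousLinearMap.id ℝ (Amb n))) p :=
    (hasStrictFDerivAt_norm_sq (p - x)).comp p ((hasStrictFDerivAt_id p).sub_const x)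
  obtain ⟨c, hc⟩ := h.exists_smul_of_isLocalExtrOn hx.1 hf (by
    left
    filter_upwards [self_mem_nhdsWithin] with y hy
    have h1 : dist x p ≤ dist x y := hx.2.trans_le (Metric.infDist_le_dist_of_mem hy)
    rw [dist_comm, dist_eq_norm, dist_comm, dist_eq_norm] at h1
    gcongr)
  have h2 : ∀ w, 2 * ⟪p - x, w⟫ = c * ⟪gradient φ p, w⟫ := by
    intro w
    rw [inner_gradient_eq]
    have h5 := DFunLike.congr_fun hc w
    rw [inner_sub_left]
    simpa using h5
  have h3 : x - p = (-(c / 2) * ‖gradient φ p‖) • unitNormal φ p := by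
    rw [unitNormal, smul_smul, mul_assoc, mul_inv_cancel₀ (norm_ne_zero_iff.2 h.2.1), mul_one]
    refine ext_inner_right ℝ fun w => ?_
    rw [real_inner_smul_left, ← neg_sub, inner_neg_left]
    linarith [h2 w]
  rw [hN, h3, real_inner_smul_right, real_inner_self_eq_norm_sq, h.norm_unitNormal]
  simp

/-- The derivative of a map with values in the hypersurface is tangential. -/
theorem IsClosedC2Hypersurface.inner_normalField_fderiv (hγ : IsClosedC2Hypersurface γ)
    {E : Type*} [NormedAddCommGroup E] [NormedSpace ℝ E] {Y : E → Amb n} {x : E}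
    {Y' : E →L[ℝ] Amb n} (hY : HasFDerivAt Y Y' x) (hYγ : ∀ᶠ z in 𝓝 x, Y z ∈ γ) (w : E) :
    ⟪normalField γ (Y x), Y' w⟫ = 0 := by
  obtain ⟨φ, h, hN⟩ := hγ.exists_normalField_eq hYγ.self_of_nhds
  rw [hN, inner_unitNormal_eq_zero_iff h, inner_gradient_eq]
  have h1 := h.differentiableAt.hasFDerivAt.comp x hY
  have h2 : φ ∘ Y =ᶠ[𝓝 x] fun _ => 0 := by
    filter_upwards [hYγ, hY.continuousAt.eventually h.2.2] with z hz h3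
    exact h3.1 hz
  have h3 := h1.unique ((hasFDerivAt_const (0 : ℝ) x).congr_of_eventuallyEq h2)
  simpa using DFunLike.congr_fun h3 w

/-! ### The closest point projection -/

theorem isClosestPoint_closestPoint (hγ : IsCompact γ) (hne : γ.Nonempty) (x : Amb n) :
    IsClosestPoint γ x (closestPoint γ x) := by
  obtain ⟨p, hp, hd⟩ := hγ.exists_infDist_eq_dist hne x
  have h : ∃ p, IsClosestPoint γ x p := ⟨p, hp, hd.symm⟩
  rw [closestPoint, dif_pos h]
  exact h.choose_spec

/-- The values stay in the compact set γ, every cluster value is a closest point to `x`, and there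
is only one such point. -/
theorem ProjectionWellDefined.continuousAt (hproj : ProjectionWellDefined γ) (hγ : IsCompact γ)
    {x : Amb n} (hx : x ∈ tube γ) : ContinuousAt (closestPoint γ) x := by
  obtain ⟨p, hp, huniq⟩ := hproj x hx
  have hne : γ.Nonempty := ⟨p, hp.1⟩
  have hcp := isClosestPoint_closestPoint hγ hne
  refine hγ.tendsto_nhds_of_unique_mapClusterPt (Filter.Eventually.of_forall fun z => (hcp z).1) ?_
  intro q hq hcl
  have hqc : IsClosestPoint γ x q := by
    refine ⟨hq, le_antisymm ?_ (Metric.infDist_le_dist_of_mem hq)⟩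
    refine le_of_forall_pos_le_add fun ε hε => ?_
    have h1 : ∃ᶠ z in 𝓝 x, closestPoint γ z ∈ Metric.ball q (ε / 3) :=
      mapClusterPt_iff_frequently.1 hcl _ (Metric.ball_mem_nhds _ (by positivity))
    obtain ⟨z, hz1, hz2⟩ := (h1.and_eventually (Metric.ball_mem_nhds x
      (by positivity : 0 < ε / 3))).exists
    rw [Metric.mem_ball] at hz1
    have hz3 : dist z x < ε / 3 := hz2
    have h2 := Metric.infDist_le_infDist_add_dist (s := γ) (x := z) (y := x)
    have h3 := (hcp z).2
    have h4 := dist_triangle4 x z (closestPoint γ z) q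
    rw [dist_comm x z] at h4
    linarith
  rw [huniq q hqc, huniq _ (hcp x)]

end SurfaceFEM

/-! ### Area elements through singular values -/

/-- A unit eigenvector of `f* f` attains the singular value. Two-sided bounds on `‖f w‖` therefore
bound every factor of `normDet`, the product of the singular values. -/
theorem LinearMap.exists_norm_eq_singularValues {U V : Type*} [NormedAddCommGroup U]
    [InnerProductSpace ℝ U] [FiniteDimensional ℝ U] [NormedAddCommGroup V] [InnerProductSpace ℝ V]
    [FiniteDimensional ℝ V] (f : U →ₗ[ℝ] V) (i : Fin (Module.finrank ℝ U)) :
    ∃ v, ‖v‖ = 1 ∧ ‖f v‖ = f.singularValues i := by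
  have hs := f.isSymmetric_adjoint_comp_self
  set v := hs.eigenvectorBasis rfl i with hv
  have hv1 : ‖v‖ = 1 := (hs.eigenvectorBasis rfl).orthonormal.1 i
  refine ⟨v, hv1, ?_⟩
  have h1 : ‖f v‖ ^ 2 = f.singularValues i ^ 2 := by
    rw [f.sq_singularValues_fin rfl i, ← real_inner_self_eq_norm_sq, ← LinearMap.adjoint_inner_left]
    have h2 := hs.apply_eigenvectorBasis rfl i
    rw [LinearMap.comp_apply, ← hv] at h2
    rw [h2, real_inner_smul_left, real_inner_self_eq_norm_sq, hv1]
    simp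
  exact (sq_eq_sq₀ (norm_nonneg _) (f.singularValues_nonneg i)).1 h1

theorem LinearMap.le_normDet_of_bound {U V : Type*} [NormedAddCommGroup U] [InnerProductSpace ℝ U]
    [FiniteDimensional ℝ U] [NormedAddCommGroup V] [InnerProductSpace ℝ V] [FiniteDimensional ℝ V]
    (f : U →ₗ[ℝ] V) {m : ℝ} (hm : 0 ≤ m) (h : ∀ w, m * ‖w‖ ≤ ‖f w‖) :
    m ^ Module.finrank ℝ U ≤ f.normDet := by
  rw [f.normDet_eq_prod_singularValues, ← Fin.prod_univ_eq_prod_range]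
  calc m ^ Module.finrank ℝ U = ∏ _i : Fin (Module.finrank ℝ U), m := by simp
    _ ≤ _ := by
      refine Finset.prod_le_prod (fun _ _ => hm) fun i _ => ?_
      obtain ⟨v, hv, hfv⟩ := f.exists_norm_eq_singularValues i
      rw [← hfv]
      simpa [hv] using h v

theorem LinearMap.normDet_le_of_bound {U V : Type*} [NormedAddCommGroup U] [InnerProductSpace ℝ U]
    [FiniteDimensional ℝ U] [NormedAddCommGroup V] [InnerProductSpace ℝ V] [FiniteDimensional ℝ V]
    (f : U →ₗ[ℝ] V) {m : ℝ} (h : ∀ w, ‖f w‖ ≤ m * ‖w‖) :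
    f.normDet ≤ m ^ Module.finrank ℝ U := by
  rw [f.normDet_eq_prod_singularValues, ← Fin.prod_univ_eq_prod_range]
  calc _ ≤ ∏ _i : Fin (Module.finrank ℝ U), m := by
        refine Finset.prod_le_prod (fun _ _ => f.singularValues_nonneg _) fun i _ => ?_
        obtain ⟨v, hv, hfv⟩ := f.exists_norm_eq_singularValues i
        rw [← hfv]
        simpa [hv] using h v
    _ = _ := by simp

namespace SurfaceFEM

variable {n : ℕ} {γ : Set (Amb n)} {p : Amb n}

theorem sqrt_det_eq_normDet (A : Par n →L[ℝ] Amb n) :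
    Real.sqrt (Matrix.det (Matrix.of fun i j : Fin n =>
      ⟪A (EuclideanSpace.single i 1), A (EuclideanSpace.single j 1)⟫)) =
      A.toLinearMap.normDet := by
  have h := A.toLinearMap.normDet_sq_eq_det_gram (EuclideanSpace.basisFun (Fin n) ℝ)
  have h2 : (Matrix.of fun i j : Fin n =>
      ⟪A (EuclideanSpace.single i 1), A (EuclideanSpace.single j 1)⟫) =
      Matrix.gram ℝ fun i => A.toLinearMap (EuclideanSpace.basisFun (Fin n) ℝ i) := by
    ext i j
    simp [Matrix.gram]
  rw [h2, ← h]
  simpa using Real.sqrt_sq (LinearMap.normDet_nonneg _)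

theorem areaElement_eq_normDet (F : Par n → Amb n) (x : Par n) :
    areaElement F x = (fderiv ℝ F x).toLinearMap.normDet :=
  sqrt_det_eq_normDet _

theorem areaElement_nonneg (F : Par n → Amb n) (x : Par n) : 0 ≤ areaElement F x :=
  Real.sqrt_nonneg _

theorem measurable_normDet :
    Measurable fun A : Par n →L[ℝ] Amb n => A.toLinearMap.normDet := by
  simp_rw [← sqrt_det_eq_normDet]
  apply Continuous.measurable
  fun_prop

theorem measurable_areaElement (F : Par n → Amb n) : Measurable (areaElement F) := by
  have h : areaElement F = fun x => (fderiv ℝ F x).toLinearMap.normDet :=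
    funext (areaElement_eq_normDet F)
  rw [h]
  exact measurable_normDet.comp (measurable_fderiv ℝ F)

/-- The isometric parametrization of the orthogonal complement of a unit vector. -/
theorem exists_linearIsometry_orthogonal {e : Amb n} (he : ‖e‖ = 1) :
    ∃ ι : Par n →ₗᵢ[ℝ] Amb n, ∃ π : Amb n →L[ℝ] Par n,
      (∀ u, π (ι u) = u) ∧ π e = 0 ∧ ∀ x, x = ι (π x) + ⟪e, x⟫ • e := by
  have he0 : e ≠ 0 := by
    rintro rfl
    simp at he
  have hf : Fact (Module.finrank ℝ (Amb n) = n + 1) := ⟨by simp⟩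
  set b := OrthonormalBasis.fromOrthogonalSpanSingleton (𝕜 := ℝ) n he0 with hb
  refine ⟨(Submodule.subtypeₗᵢ _).comp b.repr.symm.toLinearIsometry,
    (b.repr.toContinuousLinearEquiv : _ →L[ℝ] Par n).comp ((ℝ ∙ e)ᗮ.orthogonalProjectionOnto), ?_, ?_, ?_⟩
  · intro u
    simp
  · simp
  · intro x
    have h1 := (ℝ ∙ e).starProjection_add_starProjection_orthogonal x
    rw [Submodule.starProjection_unit_singleton ℝ he] at h1
    conv_lhs => rw [← h1, add_comm]
    simp

end SurfaceFEM

/-! ### A surface measure satisfying the area formula -/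

namespace SurfaceFEM

variable {n : ℕ} {γ : Set (Amb n)} {p : Amb n}

/-- `ν` satisfies the area formula for parametrizations of the part of `γ` in `V`, and Lipschitz
images of null sets are `ν`-null. -/
structure IsSurfaceMeasureOn (γ V : Set (Amb n)) (ν : Measure (Amb n)) : Prop where
  setLIntegral_image : ∀ (S : Set (Par n)) (Y : Par n → Amb n), MeasurableSet S → InjOn Y S →
    (∀ x ∈ S, DifferentiableAt ℝ Y x ∧ ∀ᶠ z in 𝓝 x, Y z ∈ γ) → MapsTo Y S V →
    ∀ g : Amb n → ℝ≥0∞, Measurable g →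
      ∫⁻ y in Y '' S, g y ∂ν = ∫⁻ x in S, g (Y x) * ENNReal.ofReal (areaElement Y x)
  image_null : ∀ (S : Set (Par n)) (Y : Par n → Amb n) (K : NNReal), volume S = 0 →
    LipschitzOnWith K Y S → MapsTo Y S (γ ∩ V) → ν (Y '' S) = 0

/-- Lebesgue measure is a multiple of `n`-dimensional Hausdorff measure, which a Lipschitz map
enlarges at most by a factor. -/
theorem volume_image_eq_zero_of_lipschitzOnWith {S : Set (Par n)} {f : Par n → Par n} {K : NNReal}
    (hf : LipschitzOnWith K f S) (hS : volume S = 0) : volume (f '' S) = 0 := by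
  have h1 := hf.hausdorffMeasure_image_le (d := n) (Nat.cast_nonneg n)
  have h0 := EuclideanSpace.euclideanHausdorffMeasure_eq_volume n
  rw [← h0, Measure.euclideanHausdorffMeasure_def] at hS ⊢
  simp only [Measure.smul_apply, Measure.nnreal_smul_coe_apply, mul_eq_zero, ENNReal.coe_eq_zero] at hS ⊢
  rcases hS with hS | hS
  · exact Or.inl hS
  · right
    rw [hS, mul_zero] at h1
    exact le_antisymm h1 bot_le

/-- Near `p` the hypersurface is a graph over its tangent hyperplane. Lebesgue measure on the
projection, lifted to the graph and weighted with the Jacobian of the lift, obeys the area formula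
by the change of variables in `ℝⁿ`. The hypersurface is only C², so the lift is used merely as a
Lipschitz inverse of the projection, and its Jacobian is read off from the defining function. -/
theorem IsClosedC2Hypersurface.exists_isSurfaceMeasureOn_nhds (hγ : IsClosedC2Hypersurface γ)
    (hp : p ∈ γ) : ∃ U : Set (Amb n), IsOpen U ∧ p ∈ U ∧ ∃ ν, IsSurfaceMeasureOn γ U ν := by
  obtain ⟨φ, hφ⟩ := hγ.2 p hp
  set e := unitNormal φ p with he
  have he1 : ‖e‖ = 1 := hφ.norm_unitNormal
  obtain ⟨ι, π, hπι, hπe, hdec⟩ := exists_linearIsometry_orthogonal he1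
  have hge : ⟪gradient φ p, e⟫ ≠ 0 := by
    rw [he, unitNormal, real_inner_smul_right, real_inner_self_eq_norm_sq]
    have := norm_ne_zero_iff.2 hφ.2.1
    positivity
  have hcge : ContinuousAt (fun q => ⟪gradient φ q, e⟫) p :=
    hφ.contDiffAt_gradient.continuousAt.inner continuousAt_const
  have hg0 : 0 < ‖gradient φ p‖ := norm_pos_iff.2 hφ.2.1
  -- the chart domain
  obtain ⟨U, hU, hUo, hpU⟩ : ∃ U : Set (Amb n), (∀ q ∈ U, IsLocalDefining γ q φ ∧
      ⟪gradient φ q, e⟫ ≠ 0 ∧ ∀ q' ∈ U, |φ q - φ q' - fderiv ℝ φ p (q - q')| ≤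
        (‖gradient φ p‖ / 2) * ‖q - q'‖) ∧ IsOpen U ∧ p ∈ U := by
    have h1 := hφ.hasStrictFDerivAt.isLittleO.bound (half_pos hg0)
    rw [nhds_prod_eq] at h1
    obtain ⟨t, ht, h2⟩ := (Filter.eventually_prod_self_iff (r := fun x y : Amb n =>
      ‖φ x - φ y - fderiv ℝ φ p (x - y)‖ ≤ ‖gradient φ p‖ / 2 * ‖x - y‖)).1 h1
    obtain ⟨U, hU, hUo, hpU⟩ := eventually_nhds_iff.1
      ((hφ.eventually.and (hcge.eventually_ne hge)).and ht)
    refine ⟨U, fun q hq => ⟨(hU q hq).1.1, (hU q hq).1.2, fun q' hq' => ?_⟩, hUo, hpU⟩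
    exact h2 q (hU q hq).2 q' (hU q' hq').2
  -- By the choice of `U`, the `e`-component of a secant of γ is at most half its length, so the
  -- projection is injective with a 2-Lipschitz inverse.
  have hanti : ∀ x ∈ γ ∩ U, ∀ y ∈ γ ∩ U, ‖x - y‖ ≤ 2 * ‖π (x - y)‖ := by
    intro x hx y hy
    have h1 := (hU x hx.2).2.2 y hy.2
    rw [(hU x hx.2).1.apply_eq_zero hx.1, (hU y hy.2).1.apply_eq_zero hy.1, sub_zero, zero_sub,
      abs_neg, ← inner_gradient_eq] at h1
    have h2 : |⟪e, x - y⟫| ≤ ‖x - y‖ / 2 := by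
      rw [he, unitNormal, real_inner_smul_left, abs_mul, abs_of_nonneg (by positivity),
        inv_mul_le_iff₀ hg0]
      linarith
    have h3 : ‖x - y‖ ≤ ‖π (x - y)‖ + |⟪e, x - y⟫| := by
      conv_lhs => rw [hdec (x - y)]
      refine (norm_add_le _ _).trans ?_
      rw [ι.norm_map, norm_smul, he1, mul_one, Real.norm_eq_abs]
    linarith
  set B := γ ∩ U with hB
  have hBm : MeasurableSet B := hγ.1.measurableSet.inter hUo.measurableSet
  have hinj : InjOn π B := by
    intro x hx y hy hxy
    have := hanti x hx y hy
    rw [map_sub, hxy, sub_self, norm_zero, mul_zero] at this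
    exact sub_eq_zero.1 (norm_le_zero_iff.1 this)
  set T := π '' B with hT
  have hTm : MeasurableSet T := hBm.image_of_continuousOn_injOn π.continuous.continuousOn hinj
  set s := Function.invFunOn π B with hs
  have hsπ : ∀ x ∈ B, s (π x) = x := fun x hx => hinj.leftInvOn_invFunOn hx
  have hsc : ContinuousOn s T := by
    refine LipschitzOnWith.continuousOn (K := 2) (LipschitzOnWith.of_dist_le_mul ?_)
    rintro _ ⟨x, hx, rfl⟩ _ ⟨y, hy, rfl⟩
    rw [hsπ x hx, hsπ y hy, dist_eq_norm, dist_eq_norm, ← map_sub]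
    simpa using hanti x hx y hy
  have hsm : AEMeasurable s (volume.restrict T) := hsc.aemeasurable hTm
  -- The inverse of `π` on the tangent space at `q`: the `e`-component of a tangent vector is
  -- recovered from the equation that `fderiv ℝ φ q` annihilates it.
  set σ : Amb n → Par n →L[ℝ] Amb n := fun q => ι.toContinuousLinearMap -
    ((fderiv ℝ φ q e)⁻¹ • (fderiv ℝ φ q).comp ι.toContinuousLinearMap).smulRight e with hσ
  have hσm : Measurable σ := by
    have h1 : Continuous fun l : Amb n →L[ℝ] ℝ => (l.comp ι.toContinuousLinearMap).smulRight e := by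
      fun_prop
    have h2 := h1.measurable.comp (measurable_fderiv ℝ φ)
    have h3 : Measurable fun q => (fderiv ℝ φ q e)⁻¹ := (measurable_fderiv_apply_const ℝ φ e).inv
    have h4 : σ = fun q => ι.toContinuousLinearMap - (fderiv ℝ φ q e)⁻¹ •
        ((fderiv ℝ φ q).comp ι.toContinuousLinearMap).smulRight e := by
      funext q
      ext w
      simp [hσ, mul_smul]
    rw [h4]
    exact measurable_const.sub (h3.smul h2)
  set ρ : Amb n → ℝ≥0∞ := fun q => ENNReal.ofReal (σ q).toLinearMap.normDet with hρ
  have hρm : Measurable ρ := (measurable_normDet.comp hσm).ennreal_ofReal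
  refine ⟨U, hUo, hpU, ((volume.restrict T).map s).withDensity ρ, ?_, ?_⟩
  · intro S Y hS hY hYd hYU g hg
    have hYB : MapsTo Y S B := fun x hx => ⟨(hYd x hx).2.self_of_nhds, hYU hx⟩
    have hA : MeasurableSet (Y '' S) := hS.image_of_continuousOn_injOn
      (fun x hx => (hYd x hx).1.continuousAt.continuousWithinAt) hY
    have hπY : ∀ x ∈ S, HasFDerivWithinAt (fun x => π (Y x)) (π.comp (fderiv ℝ Y x)) S x := fun x hx =>
      (π.hasFDerivAt.comp x (hYd x hx).1.hasFDerivAt).hasFDerivWithinAt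
    have hπYi : InjOn (fun x => π (Y x)) S := fun x hx y hy hxy =>
      hY hx hy (hinj (hYB hx) (hYB hy) hxy)
    -- Derivatives of `Y` are tangential, so `DY = σ ∘ (π DY)`; the second factor is square and has
    -- Jacobian `|det|`.
    have hJ : ∀ x ∈ S, ENNReal.ofReal (areaElement Y x) =
        ENNReal.ofReal |(π.comp (fderiv ℝ Y x)).det| * ρ (Y x) := by
      intro x hx
      have hfac : (fderiv ℝ Y x).toLinearMap =
          (σ (Y x)).toLinearMap ∘ₗ (π.comp (fderiv ℝ Y x)).toLinearMap := by
        ext1 w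
        have htan : fderiv ℝ φ (Y x) (fderiv ℝ Y x w) = 0 := by
          have h1 := hγ.inner_normalField_fderiv (hYd x hx).1.hasFDerivAt (hYd x hx).2 w
          obtain ⟨τ, hτ, hν⟩ := (hU _ (hYU hx)).1.normalField_eq_or_neg hγ (hYB hx).1
          rw [← inner_gradient_eq, ← inner_unitNormal_eq_zero_iff (hU _ (hYU hx)).1, hν,
            real_inner_smul_left, h1, mul_zero]
        have hd := hdec (fderiv ℝ Y x w)
        have hne : fderiv ℝ φ (Y x) e ≠ 0 := by
          rw [← inner_gradient_eq]
          exact (hU _ (hYU hx)).2.1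
        have h2 := htan
        rw [hd, map_add, map_smul, smul_eq_mul] at h2
        have h3 : ⟪e, fderiv ℝ Y x w⟫ = -((fderiv ℝ φ (Y x) e)⁻¹ *
            fderiv ℝ φ (Y x) (ι (π (fderiv ℝ Y x w)))) := by
          field_simp
          linarith
        change fderiv ℝ Y x w = σ (Y x) (π (fderiv ℝ Y x w))
        conv_lhs => rw [hd, h3]
        simp [hσ, sub_eq_add_neg]
      rw [areaElement_eq_normDet, hfac, LinearMap.normDet_comp_of_finrank_eq _ _ rfl,
        LinearMap.normDet_eq_abs_det, mul_comm, ENNReal.ofReal_mul (abs_nonneg _)]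
    have hset : T ∩ s ⁻¹' (Y '' S) = (fun x => π (Y x)) '' S := by
      ext u
      constructor
      · rintro ⟨⟨b, hb, rfl⟩, x, hx, hxb⟩
        rw [hsπ b hb] at hxb
        exact ⟨x, hx, by rw [← hxb]⟩
      · rintro ⟨x, hx, rfl⟩
        exact ⟨⟨Y x, hYB hx, rfl⟩, x, hx, (hsπ _ (hYB hx)).symm⟩
    have hsTm : MeasurableSet ((fun x => π (Y x)) '' S) :=
      hS.image_of_continuousOn_injOn (fun x hx => (hπY x hx).continuousWithinAt) hπYi
    calc ∫⁻ y in Y '' S, g y ∂(((volume.restrict T).map s).withDensity ρ)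
        = ∫⁻ y, (Y '' S).indicator (ρ * g) y ∂((volume.restrict T).map s) := by
          rw [setLIntegral_withDensity_eq_setLIntegral_mul _ hρm hg hA, lintegral_indicator hA]
      _ = ∫⁻ u in T, (Y '' S).indicator (ρ * g) (s u) := by
          rw [lintegral_map' ((hρm.mul hg).indicator hA).aemeasurable hsm]
      _ = ∫⁻ u in (fun x => π (Y x)) '' S, (ρ * g) (s u) := by
          rw [← lintegral_indicator hTm, ← lintegral_indicator hsTm, ← hset]
          congr 1
          funext u
          by_cases hu : u ∈ T
          · by_cases hu' : s u ∈ Y '' S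
            · rw [indicator_of_mem hu, indicator_of_mem hu', indicator_of_mem (show u ∈ T ∩ s ⁻¹' (Y '' S) from ⟨hu, hu'⟩)]
            · rw [indicator_of_mem hu, indicator_of_notMem hu', indicator_of_notMem fun h => hu' h.2]
          · rw [indicator_of_notMem hu, indicator_of_notMem fun h => hu h.1]
      _ = ∫⁻ x in S, ENNReal.ofReal |(π.comp (fderiv ℝ Y x)).det| * (ρ * g) (s (π (Y x))) :=
          lintegral_image_eq_lintegral_abs_det_fderiv_mul volume hS hπY hπYi _
      _ = _ := by
          refine setLIntegral_congr_fun hS fun x hx => ?_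
          simp only [hsπ _ (hYB hx), Pi.mul_apply]
          rw [hJ x hx]
          ring
  · intro S Y K hS hY hYB
    have h0 : volume ((fun x => π (Y x)) '' S) = 0 :=
      volume_image_eq_zero_of_lipschitzOnWith (π.lipschitz.comp_lipschitzOnWith hY) hS
    obtain ⟨N, hN, hNm, hN0⟩ := exists_measurable_superset_of_null h0
    refine withDensity_absolutelyContinuous _ _ ?_
    refine measure_mono_null (t := π ⁻¹' N) ?_ ?_
    · rintro _ ⟨x, hx, rfl⟩
      exact hN ⟨x, hx, rfl⟩
    · rw [Measure.map_apply_of_aemeasurable hsm (hNm.preimage π.continuous.measurable),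
        Measure.restrict_apply' hTm]
      refine measure_mono_null ?_ hN0
      rintro _ ⟨h1, b, hb, rfl⟩
      simpa [hsπ b hb] using h1

/-- Local measures are glued by compactness. On `V ∪ V'` use the first one in `V` and the second one
in `V' \ V`; a parameter domain is cut along the preimage of `V`, so no compatibility on the overlap
has to be proved. -/
theorem IsClosedC2Hypersurface.exists_isSurfaceMeasureOn (hγ : IsClosedC2Hypersurface γ) :
    ∃ ν : Measure (Amb n), IsSurfaceMeasureOn γ univ ν := by
  have key : ∃ V : Set (Amb n), IsOpen V ∧ γ ⊆ V ∧ ∃ ν, IsSurfaceMeasureOn γ V ν := by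
    refine hγ.1.induction_on
      (p := fun S => ∃ V : Set (Amb n), IsOpen V ∧ S ⊆ V ∧ ∃ ν, IsSurfaceMeasureOn γ V ν) ?_ ?_ ?_ ?_
    · refine ⟨∅, isOpen_empty, le_rfl, 0, ?_, ?_⟩
      · intro S Y _ _ _ hY g _
        have : S = ∅ := by
          by_contra h
          obtain ⟨x, hx⟩ := nonempty_iff_ne_empty.2 h
          exact hY hx
        simp [this]
      · simp
    · rintro s t hst ⟨V, hV, htV, h⟩
      exact ⟨V, hV, hst.trans htV, h⟩
    · rintro s t ⟨V, hV, hsV, ν, hν⟩ ⟨V', hV', htV', ν', hν'⟩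
      refine ⟨V ∪ V', hV.union hV', union_subset_union hsV htV',
        ν.restrict V + ν'.restrict (V' \ V), ?_, ?_⟩
      · intro S Y hS hY hYd hYV g hg
        have hYc : ContinuousOn Y S := fun x hx => (hYd x hx).1.continuousAt.continuousWithinAt
        have hA : MeasurableSet (Y '' S) := hS.image_of_continuousOn_injOn hYc hY
        obtain ⟨O, hO, hOV⟩ := continuousOn_iff'.1 hYc V hV
        set S₁ := Y ⁻¹' V ∩ S with hS₁
        have hS₁m : MeasurableSet S₁ := by
          rw [hOV]
          exact hO.measurableSet.inter hS
        have hVm := hV.measurableSet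
        have hV'm := hV'.measurableSet
        have e1 : Y '' S ∩ V = Y '' S₁ := by
          rw [hS₁, inter_comm (Y ⁻¹' V), image_inter_preimage]
        have e2 : Y '' S ∩ (V' \ V) = Y '' (S \ S₁) := by
          ext y
          constructor
          · rintro ⟨⟨x, hx, rfl⟩, h1, h2⟩
            exact ⟨x, ⟨hx, fun h => h2 h.1⟩, rfl⟩
          · rintro ⟨x, ⟨hx, h1⟩, rfl⟩
            have h2 : Y x ∉ V := fun h => h1 ⟨h, hx⟩
            exact ⟨⟨x, hx, rfl⟩, (hYV hx).resolve_left h2, h2⟩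
        rw [Measure.restrict_add, lintegral_add_measure, Measure.restrict_restrict hA,
          Measure.restrict_restrict hA, e1, e2,
          hν.1 S₁ Y hS₁m (hY.mono inter_subset_right) (fun x hx => hYd x hx.2) (fun x hx => hx.1) g hg,
          hν'.1 (S \ S₁) Y (hS.diff hS₁m) (hY.mono sdiff_subset) (fun x hx => hYd x hx.1)
            (fun x hx => (hYV hx.1).resolve_left fun h => hx.2 ⟨h, hx.1⟩) g hg]
        have e3 : S ∩ S₁ = S₁ := inter_eq_right.2 inter_subset_right
        rw [← lintegral_inter_add_sdiff (μ := volume) _ S hS₁m, e3]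
      · intro S Y K hS hY hYV
        rw [Measure.add_apply, Measure.restrict_apply' hV.measurableSet,
          Measure.restrict_apply' (hV'.measurableSet.diff hV.measurableSet)]
        have h1 : ν (Y '' S ∩ V) = 0 := by
          have := hν.2 (S ∩ Y ⁻¹' V) Y K (measure_mono_null inter_subset_left hS)
            (hY.mono inter_subset_left) (fun x hx => ⟨(hYV hx.1).1, hx.2⟩)
          rwa [image_inter_preimage] at this
        have h2 : ν' (Y '' S ∩ (V' \ V)) = 0 := by
          have := hν'.2 (S ∩ Y ⁻¹' (V' \ V)) Y K (measure_mono_null inter_subset_left hS)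
            (hY.mono inter_subset_left) (fun x hx => ⟨(hYV hx.1).1, hx.2.1⟩)
          rwa [image_inter_preimage] at this
        rw [h1, h2, add_zero]
    · intro x hx
      obtain ⟨U, hU, hxU, h⟩ := hγ.exists_isSurfaceMeasureOn_nhds hx
      exact ⟨U, nhdsWithin_le_nhds (hU.mem_nhds hxU), U, hU, le_rfl, h⟩
  obtain ⟨V, -, hγV, ν, hν⟩ := key
  refine ⟨ν, ?_, ?_⟩
  · intro S Y hS hY hYd _ g hg
    exact hν.1 S Y hS hY hYd (fun x hx => hγV (hYd x hx).2.self_of_nhds) g hg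
  · intro S Y K hS hY hYV
    exact hν.2 S Y K hS hY fun x hx => ⟨(hYV hx).1, hγV (hYV hx).1⟩

end SurfaceFEM

/-! ### Barycentric coordinates and Lagrange interpolation -/

/-- Weights on the full index set that vanish off `s` allow points of a face to be compared with
points of the whole simplex by uniqueness of barycentric coordinates. -/
theorem exists_weights_of_mem_convexHull_image {E : Type*} [AddCommGroup E] [Module ℝ E]
    {m : ℕ} {v : Fin m → E} {s : Set (Fin m)} {b : E} (hb : b ∈ convexHull ℝ (v '' s)) :
    ∃ w : Fin m → ℝ, (∀ i, 0 ≤ w i) ∧ (∀ i, i ∉ s → w i = 0) ∧ ∑ i, w i = 1 ∧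
      ∑ i, w i • v i = b := by
  set C : Set E := {b | ∃ w : Fin m → ℝ, (∀ i, 0 ≤ w i) ∧ (∀ i, i ∉ s → w i = 0) ∧ ∑ i, w i = 1 ∧
      ∑ i, w i • v i = b} with hC
  have hconv : Convex ℝ C := by
    rintro x ⟨w, h1, h2, h3, rfl⟩ y ⟨w', h1', h2', h3', rfl⟩ a c ha hc hac
    refine ⟨fun i => a * w i + c * w' i, fun i => ?_, fun i hi => ?_, ?_, ?_⟩
    · have := h1 i
      have := h1' i
      positivity
    · simp [h2 i hi, h2' i hi]
    · rw [Finset.sum_add_distrib, ← Finset.mul_sum, ← Finset.mul_sum, h3, h3', mul_one, mul_one, hac]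
    · rw [Finset.smul_sum, Finset.smul_sum, ← Finset.sum_add_distrib]
      refine Finset.sum_congr rfl fun i _ => ?_
      rw [add_smul, mul_smul, mul_smul]
  refine convexHull_min ?_ hconv hb
  rintro _ ⟨i, hi, rfl⟩
  classical
  refine ⟨Pi.single i 1, fun j => ?_, fun j hj => ?_, ?_, ?_⟩
  · by_cases h : j = i
    · subst h; simp
    · simp [h]
  · have : j ≠ i := by rintro rfl; exact hj hi
    simp [this]
  · simp
  · simp [Pi.single_apply]

theorem sum_smul_mem_convexHull_image {E : Type*} [AddCommGroup E] [Module ℝ E]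
    {m : ℕ} {v : Fin m → E} {w : Fin m → ℝ} (h0 : ∀ i, 0 ≤ w i) (h1 : ∑ i, w i = 1) :
    ∑ i, w i • v i ∈ convexHull ℝ (range v) := by
  refine (convex_convexHull ℝ _).sum_mem (fun i _ => h0 i) h1 fun i _ => subset_convexHull ℝ _ ⟨i, rfl⟩

theorem AffineIndependent.eq_weights {E : Type*} [AddCommGroup E] [Module ℝ E]
    {m : ℕ} {v : Fin m → E} (hv : AffineIndependent ℝ v) {w w' : Fin m → ℝ}
    (h1 : ∑ i, w i = 1) (h1' : ∑ i, w' i = 1) (h : ∑ i, w i • v i = ∑ i, w' i • v i) : w = w' := by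
  funext i
  have := affineIndependent_iff.1 hv Finset.univ (fun i => w i - w' i)
    (by rw [Finset.sum_sub_distrib, h1, h1', sub_self])
    (by simp_rw [sub_smul]; rw [Finset.sum_sub_distrib, h, sub_self]) i (Finset.mem_univ i)
  exact sub_eq_zero.1 this

namespace SurfaceFEM

variable {n : ℕ}

theorem sum_bary (x : Par n) : ∑ i, bary x i = 1 := by
  simp [bary, Fin.sum_univ_succ]

theorem bary_nonneg {x : Par n} (hx : x ∈ refSimplex n) (i : Fin (n + 1)) : 0 ≤ bary x i := by
  refine Fin.cases ?_ (fun i => ?_) i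
  · simpa [bary] using hx.2
  · simpa [bary] using hx.1 i

theorem bary_toLp {w : Fin (n + 1) → ℝ} (h1 : ∑ i, w i = 1) :
    bary (WithLp.toLp 2 (fun i : Fin n => w i.succ)) = w := by
  funext i
  refine Fin.cases ?_ (fun i => ?_) i
  · rw [Fin.sum_univ_succ] at h1
    simp only [bary, Fin.cons_zero]
    linarith
  · simp [bary]

theorem toLp_mem_refSimplex {w : Fin (n + 1) → ℝ} (h0 : ∀ i, 0 ≤ w i) (h1 : ∑ i, w i = 1) :
    WithLp.toLp 2 (fun i : Fin n => w i.succ) ∈ refSimplex n := by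
  refine ⟨fun i => h0 _, ?_⟩
  rw [Fin.sum_univ_succ] at h1
  have := h0 0
  change ∑ i : Fin n, w i.succ ≤ 1
  linarith

theorem contDiff_bary (i : Fin (n + 1)) : ContDiff ℝ ∞ fun x : Par n => bary x i := by
  refine Fin.cases ?_ (fun i => ?_) i
  · simp only [bary, Fin.cons_zero]
    fun_prop
  · simp only [bary, Fin.cons_succ]
    fun_prop

theorem convex_refSimplex : Convex ℝ (refSimplex n) := by
  intro x hx y hy a b ha hb hab
  refine ⟨fun i => ?_, ?_⟩
  · have := hx.1 i
    have := hy.1 i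
    simp only [PiLp.add_apply, PiLp.smul_apply, smul_eq_mul]
    positivity
  · simp only [PiLp.add_apply, PiLp.smul_apply, smul_eq_mul, Finset.sum_add_distrib,
      ← Finset.mul_sum]
    nlinarith [hx.2, hy.2]

theorem isClosed_refSimplex : IsClosed (refSimplex n) := by
  have : refSimplex n = (⋂ i, {x : Par n | 0 ≤ x i}) ∩ {x | ∑ i, x i ≤ 1} := by
    ext x
    simp [refSimplex]
  rw [this]
  refine (isClosed_iInter fun i => isClosed_le ?_ ?_).inter (isClosed_le ?_ ?_) <;> fun_prop

theorem norm_le_one_of_mem_refSimplex {x : Par n} (hx : x ∈ refSimplex n) : ‖x‖ ≤ 1 := by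
  rw [EuclideanSpace.norm_eq]
  refine Real.sqrt_le_one.2 ?_
  calc ∑ i, ‖x i‖ ^ 2 ≤ ∑ i, x i := by
        refine Finset.sum_le_sum fun i _ => ?_
        have h0 := hx.1 i
        have h1 : x i ≤ 1 := (Finset.single_le_sum (fun j _ => hx.1 j) (Finset.mem_univ i)).trans hx.2
        rw [Real.norm_of_nonneg h0]
        nlinarith
    _ ≤ 1 := hx.2

theorem isCompact_refSimplex : IsCompact (refSimplex n) :=
  (isCompact_closedBall (0 : Par n) 1).of_isClosed_subset isClosed_refSimplex fun _ hx =>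
    mem_closedBall_zero_iff.2 (norm_le_one_of_mem_refSimplex hx)

theorem zero_mem_refSimplex : (0 : Par n) ∈ refSimplex n := by
  simp [refSimplex]

theorem interior_refSimplex_nonempty : (interior (refSimplex n)).Nonempty := by
  set c : ℝ := 1 / ((n : ℝ) + 1) with hc
  have hc0 : 0 < c := by positivity
  refine ⟨WithLp.toLp 2 fun _ => c, ?_⟩
  have hopen : IsOpen ((⋂ i, {x : Par n | 0 < x i}) ∩ {x | ∑ i, x i < 1}) := by
    refine (isOpen_iInter_of_finite fun i => isOpen_lt ?_ ?_).inter (isOpen_lt ?_ ?_) <;> fun_prop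
  refine mem_interior.2 ⟨_, ?_, hopen, ?_⟩
  · rintro x ⟨h1, h2⟩
    simp only [mem_iInter, mem_ofPred_eq] at h1 h2
    exact ⟨fun i => (h1 i).le, h2.le⟩
  · refine ⟨by simpa using fun _ => hc0, ?_⟩
    simp only [mem_ofPred_eq, Finset.sum_const, Finset.card_univ, Fintype.card_fin, nsmul_eq_mul]
    rw [hc, mul_one_div, div_lt_one (by positivity)]
    linarith

theorem volume_frontier_refSimplex : volume (frontier (refSimplex n)) = 0 :=
  convex_refSimplex.addHaar_frontier _

theorem image_affineParam (a : Fin (n + 1) → Amb n) :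
    affineParam a '' refSimplex n = convexHull ℝ (range a) := by
  ext b
  constructor
  · rintro ⟨x, hx, rfl⟩
    exact sum_smul_mem_convexHull_image (bary_nonneg hx) (sum_bary x)
  · intro hb
    rw [← image_univ] at hb
    obtain ⟨w, h0, -, h1, rfl⟩ := exists_weights_of_mem_convexHull_image hb
    refine ⟨_, toLp_mem_refSimplex h0 h1, ?_⟩
    rw [affineParam, bary_toLp h1]

theorem volume_bary_eq_zero (hn : 1 ≤ n) (i : Fin (n + 1)) :
    volume {x : Par n | bary x i = 0} = 0 := by
  obtain ⟨ℓ, c, hℓ, hb⟩ : ∃ (ℓ : Par n →ₗ[ℝ] ℝ) (c : ℝ), ℓ ≠ 0 ∧ ∀ x, bary x i = ℓ x + c := by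
    have hne : ∀ j : Fin n, (EuclideanSpace.proj j : Par n →L[ℝ] ℝ) (EuclideanSpace.single j 1) = 1 :=
      fun j => by simp
    refine Fin.cases ?_ (fun j => ?_) i
    · refine ⟨-∑ j, (EuclideanSpace.proj j : Par n →L[ℝ] ℝ).toLinearMap, 1, fun h => ?_, fun x => ?_⟩
      · have := LinearMap.congr_fun h (EuclideanSpace.single ⟨0, hn⟩ 1)
        simp [LinearMap.sum_apply] at this
      · simp only [bary, Fin.cons_zero, LinearMap.neg_apply, LinearMap.sum_apply]
        change _ = -∑ j, x j + 1
        ring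
    · refine ⟨(EuclideanSpace.proj j : Par n →L[ℝ] ℝ).toLinearMap, 0, fun h => ?_, fun x => ?_⟩
      · have := LinearMap.congr_fun h (EuclideanSpace.single j 1)
        simp at this
      · simp [bary]
  rcases eq_empty_or_nonempty {x : Par n | bary x i = 0} with h | ⟨x₀, hx₀⟩
  · rw [h, measure_empty]
  · have h0 : volume (LinearMap.ker ℓ : Set (Par n)) = 0 := by
      refine Measure.addHaar_submodule _ _ fun h => hℓ ?_
      exact LinearMap.ker_eq_top.1 h
    rw [← measure_preimage_add_right volume (-x₀)] at h0
    convert h0 using 2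
    ext x
    have h1 : bary x₀ i = 0 := hx₀
    rw [hb] at h1
    simp only [mem_ofPred_eq, mem_preimage, SetLike.mem_coe, LinearMap.mem_ker, map_add, map_neg, hb]
    constructor <;> intro h <;> linarith

theorem latticeNode_mem_refSimplex {k : ℕ} (hk : 1 ≤ k) {α : Fin (n + 1) → ℕ} (hα : ∑ i, α i = k) :
    latticeNode k α ∈ refSimplex n ∧ bary (latticeNode k α) = fun i => (α i : ℝ) / k := by
  have hk0 : (k : ℝ) ≠ 0 := by positivity
  have h1 : ∑ i, (α i : ℝ) / k = 1 := by
    rw [← Finset.sum_div, ← Nat.cast_sum, hα, div_self hk0]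
  exact ⟨toLp_mem_refSimplex (w := fun i => (α i : ℝ) / k) (fun i => by positivity) h1,
    bary_toLp (w := fun i => (α i : ℝ) / k) h1⟩

/-- The factor `j = 0` is a multiple of the `i`-th barycentric coordinate. On a face only the nodes
of that face count, which makes interpolation conforming. -/
theorem lagrangeBasis_eq_zero {k : ℕ} {α : Fin (n + 1) → ℕ} {x : Par n} {i : Fin (n + 1)}
    (hα : α i ≠ 0) (hx : bary x i = 0) : lagrangeBasis k α x = 0 := by
  refine Finset.prod_eq_zero (Finset.mem_univ i) ?_
  refine Finset.prod_eq_zero (Finset.mem_range.2 (Nat.pos_of_ne_zero hα)) ?_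
  simp [hx]

theorem contDiff_lagrangeBasis (k : ℕ) (α : Fin (n + 1) → ℕ) :
    ContDiff ℝ ∞ (lagrangeBasis (n := n) k α) := by
  unfold lagrangeBasis
  refine contDiff_prod fun i _ => contDiff_prod fun j _ => ?_
  exact ((contDiff_const.mul (contDiff_bary i)).sub contDiff_const).div_const _

theorem contDiff_lagrangeInterp (k : ℕ) (g : Par n → Amb n) :
    ContDiff ℝ ∞ (lagrangeInterp k g) := by
  unfold lagrangeInterp
  exact ContDiff.sum fun α _ => (contDiff_lagrangeBasis k α).smul contDiff_const

/-- Lagrange interpolation reproduces the value at the vertex `0` of the reference simplex. -/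
theorem lagrangeInterp_zero {k : ℕ} (hk : 1 ≤ k) (g : Par n → Amb n) :
    lagrangeInterp k g 0 = g 0 := by
  have hb : ∀ i : Fin n, bary (0 : Par n) i.succ = 0 := by simp [bary]
  have hb0 : bary (0 : Par n) 0 = 1 := by simp [bary]
  set α₀ : Fin (n + 1) → ℕ := Pi.single 0 k with hα₀
  have hmem : α₀ ∈ Finset.piAntidiag (Finset.univ : Finset (Fin (n + 1))) k := by
    rw [Finset.mem_piAntidiag]
    simp [hα₀]
  unfold lagrangeInterp
  rw [Finset.sum_eq_single_of_mem α₀ hmem]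
  · have h1 : latticeNode k α₀ = (0 : Par n) := by
      ext i
      simp [latticeNode, hα₀]
    have h2 : lagrangeBasis k α₀ (0 : Par n) = 1 := by
      rw [lagrangeBasis, Fin.prod_univ_succ]
      have h3 : ∀ i : Fin n, α₀ i.succ = 0 := by simp [hα₀]
      simp only [h3, Finset.range_zero, Finset.prod_empty, Finset.prod_const_one, mul_one]
      rw [hb0, show α₀ 0 = k by simp [hα₀], Finset.prod_div_distrib, div_eq_one_iff_eq]
      -- The numerators `k - j` are the denominators `j + 1` in reverse order.
      · rw [← Finset.prod_range_reflect]
        refine Finset.prod_congr rfl fun j hj => ?_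
        have := Finset.mem_range.1 hj
        have h4 : ((k - 1 - j : ℕ) : ℝ) = k - 1 - j := by
          rw [Nat.cast_sub (by omega), Nat.cast_sub hk]
          simp
        rw [h4]
        ring
      · refine (Finset.prod_pos fun j _ => ?_).ne'
        positivity
    rw [h1, h2, one_smul]
  · intro α hα hne
    have : ∃ i : Fin n, α i.succ ≠ 0 := by
      by_contra! h
      apply hne
      rw [Finset.mem_piAntidiag, Fin.sum_univ_succ] at hα
      funext i
      refine Fin.cases ?_ (fun i => ?_) i
      · have := hα.1
        simp [h] at this
        simp [hα₀, this]
      · simp [hα₀, h i]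
    obtain ⟨i, hi⟩ := this
    rw [lagrangeBasis_eq_zero hi (hb i), zero_smul]

end SurfaceFEM

/-! ### Elements, conformity and consistency of the interpolants -/

namespace SurfaceFEM

namespace ParamSurface

variable {n k : ℕ} {γ : Set (Amb n)} {W : Finset (RefPatch n)} (M : ParamSurface n γ W)

theorem elemBar_eq (T : Fin M.card) : M.elemBar T = affineParam (M.vert T) '' refSimplex n :=
  (image_affineParam _).symm

theorem Xbar_mem_elemBar (T : Fin M.card) {x : Par n} (hx : x ∈ refSimplex n) :
    M.Xbar T x ∈ M.elemBar T := by
  rw [elemBar_eq, M.Xbar_elem T hx]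
  exact mem_image_of_mem _ hx

theorem refSimplex_subset_carrier (w : RefPatch n) : refSimplex n ⊆ w.carrier :=
  subset_union_left

theorem convexHull_subset_carrier (w : RefPatch n) {s : Fin (n + 1) → Par n}
    (hs : s ∈ w.simplices) : convexHull ℝ (range s) ⊆ w.carrier := by
  intro x hx
  exact Or.inr (mem_iUnion₂.2 ⟨s, hs, hx⟩)

theorem isCompact_carrier (w : RefPatch n) : IsCompact w.carrier := by
  refine isCompact_refSimplex.union ?_
  exact w.simplices.isCompact_biUnion fun s _ => (finite_range s).isCompact_convexHull ℝ

theorem convex_carrier (w : RefPatch n) : Convex ℝ w.carrier := w.convex_union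

theorem refSimplex_subset_interior (w : RefPatch n) : refSimplex n ⊆ interior w.carrier := w.inside

theorem elem_eq (T : Fin M.card) : M.elem T = M.chi T '' refSimplex n := by
  rw [elem, elemBar_eq, ← (M.Xbar_elem T).image_eq, image_image]
  rfl

theorem omega_eq (T : Fin M.card) : M.omega T = M.chi T '' (M.patch T).carrier := by
  have h := M.Xbar_image T
  unfold omega elemBar
  rw [← h, image_image]
  rfl

theorem iUnion_elem : ⋃ T, M.elem T = γ := by
  have h := M.P_image
  rw [image_iUnion] at h
  exact h

theorem elem_subset (T : Fin M.card) : M.elem T ⊆ γ :=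
  (subset_iUnion _ T).trans M.iUnion_elem.subset

theorem mem_omega_iff {T : Fin M.card} {y : Amb n} :
    y ∈ M.omega T ↔ ∃ T', (M.elemBar T' ∩ M.elemBar T).Nonempty ∧ y ∈ M.elem T' := by
  simp only [omega, image_iUnion, mem_iUnion, exists_prop]
  rfl

theorem elemBar_nonempty (T : Fin M.card) : (M.elemBar T).Nonempty :=
  ⟨_, M.Xbar_mem_elemBar T zero_mem_refSimplex⟩

theorem elem_subset_omega {T T' : Fin M.card} (h : (M.elemBar T' ∩ M.elemBar T).Nonempty) :
    M.elem T' ⊆ M.omega T := fun _ hy => M.mem_omega_iff.2 ⟨T', h, hy⟩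

theorem elem_subset_omega_self (T : Fin M.card) : M.elem T ⊆ M.omega T :=
  M.elem_subset_omega (by rw [inter_self]; exact M.elemBar_nonempty T)

theorem omega_subset (T : Fin M.card) : M.omega T ⊆ γ := by
  intro y hy
  obtain ⟨T', -, h⟩ := M.mem_omega_iff.1 hy
  exact M.elem_subset T' h

theorem chi_mem (T : Fin M.card) {x : Par n} (hx : x ∈ (M.patch T).carrier) : M.chi T x ∈ γ :=
  M.omega_subset T (by rw [omega_eq]; exact mem_image_of_mem _ hx)

theorem P_injOn : InjOn M.P (⋃ T, M.elemBar T) := by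
  obtain ⟨L, hL, h⟩ := M.biLipschitz
  intro x hx y hy hxy
  have h1 := (h x hx y hy).1
  rw [hxy, sub_self, norm_zero] at h1
  have h2 : ‖x - y‖ ≤ 0 := by
    by_contra! h3
    have := mul_pos (inv_pos.2 hL) h3
    linarith
  exact sub_eq_zero.1 (norm_le_zero_iff.1 h2)

theorem P_mem_elem_iff {T : Fin M.card} {b : Amb n} (hb : b ∈ ⋃ T, M.elemBar T) :
    M.P b ∈ M.elem T ↔ b ∈ M.elemBar T := by
  constructor
  · rintro ⟨b', hb', h⟩
    rw [← M.P_injOn (mem_iUnion.2 ⟨T, hb'⟩) hb h]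
    exact hb'
  · exact mem_image_of_mem _

theorem Xbar_mem (T : Fin M.card) {x : Par n} (hx : x ∈ (M.patch T).carrier) :
    M.Xbar T x ∈ ⋃ T, M.elemBar T := by
  have h : M.Xbar T x ∈ M.Xbar T '' (M.patch T).carrier := mem_image_of_mem _ hx
  rw [M.Xbar_image T] at h
  simp only [mem_iUnion] at h ⊢
  obtain ⟨T', -, h⟩ := h
  exact ⟨T', h⟩

theorem elem_inter_nonempty_iff {T T' : Fin M.card} :
    (M.elem T ∩ M.elem T').Nonempty ↔ (M.elemBar T ∩ M.elemBar T').Nonempty := by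
  constructor
  · rintro ⟨_, ⟨b, hb, rfl⟩, h⟩
    exact ⟨b, hb, (M.P_mem_elem_iff (mem_iUnion.2 ⟨T, hb⟩)).1 h⟩
  · rintro ⟨b, hb, hb'⟩
    exact ⟨M.P b, mem_image_of_mem _ hb, mem_image_of_mem _ hb'⟩

theorem chi_mem_elem {T : Fin M.card} {x : Par n} (hx : x ∈ refSimplex n) :
    M.chi T x ∈ M.elem T := by
  rw [elem_eq]
  exact mem_image_of_mem _ hx

theorem isCompact_elemBar (T : Fin M.card) : IsCompact (M.elemBar T) :=
  (finite_range _).isCompact_convexHull ℝ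

theorem continuousOn_P : ContinuousOn M.P (⋃ T, M.elemBar T) := by
  obtain ⟨L, hL, h⟩ := M.biLipschitz
  refine LipschitzOnWith.continuousOn (K := L.toNNReal) (LipschitzOnWith.of_dist_le_mul ?_)
  intro x hx y hy
  rw [dist_eq_norm, dist_eq_norm, Real.coe_toNNReal _ hL.le]
  exact (h x hx y hy).2

theorem isCompact_elem (T : Fin M.card) : IsCompact (M.elem T) :=
  (M.isCompact_elemBar T).image_of_continuousOn (M.continuousOn_P.mono (subset_iUnion _ T))

theorem isCompact_omega (T : Fin M.card) : IsCompact (M.omega T) := by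
  have h : M.omega T = ⋃ T' ∈ {T' | (M.elemBar T' ∩ M.elemBar T).Nonempty}, M.elem T' := by
    ext y
    rw [mem_omega_iff]
    simp
  rw [h]
  exact (toFinite _).isCompact_biUnion fun T' _ => M.isCompact_elem T'

/-- Points of two elements have the same barycentric coordinates with respect to common vertices. -/
theorem exists_bary_eq {T T' : Fin M.card} {x x' : Par n} (hx : x ∈ refSimplex n)
    (hx' : x' ∈ refSimplex n) (h : affineParam (M.vert T) x = affineParam (M.vert T') x')
    {i : Fin (n + 1)} (hi : bary x i ≠ 0) :
    ∃ j, M.vert T' j = M.vert T i ∧ bary x' j = bary x i := by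
  have hb : affineParam (M.vert T) x ∈
      convexHull ℝ (range (M.vert T) ∩ range (M.vert T')) := by
    refine M.conforming T T' ⟨?_, ?_⟩
    · rw [← image_affineParam]; exact mem_image_of_mem _ hx
    · rw [h, ← image_affineParam]; exact mem_image_of_mem _ hx'
  set s : Set (Fin (n + 1)) := {i | M.vert T i ∈ range (M.vert T')} with hs
  have hset : range (M.vert T) ∩ range (M.vert T') = M.vert T '' s := by
    ext b
    constructor
    · rintro ⟨⟨i, rfl⟩, h⟩
      exact ⟨i, h, rfl⟩
    · rintro ⟨i, hi, rfl⟩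
      exact ⟨⟨i, rfl⟩, hi⟩
  rw [hset] at hb
  obtain ⟨w, h0, hsw, h1, hw⟩ := exists_weights_of_mem_convexHull_image hb
  have hwx : w = bary x := (M.nondegenerate T).eq_weights h1 (sum_bary x) hw
  have hsx : ∀ i, bary x i ≠ 0 → M.vert T i ∈ range (M.vert T') := by
    intro i hi
    by_contra hcon
    exact hi (hwx ▸ hsw i hcon)
  classical
  -- The weights of `x` carried over to the vertices of `T'`. They represent the same point as `bary
  -- x'`, hence coincide with it.
  set w' : Fin (n + 1) → ℝ := fun j => ∑ i, if M.vert T i = M.vert T' j then bary x i else 0 with hw'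
  have hinj' : Function.Injective (M.vert T') := (M.nondegenerate T').injective
  have hinj : Function.Injective (M.vert T) := (M.nondegenerate T).injective
  have hcol : ∀ i, ∀ g : Fin (n + 1) → Amb n, (∀ j, M.vert T i = M.vert T' j → g j = M.vert T i) →
      ∑ j, (if M.vert T i = M.vert T' j then bary x i else 0) • g j = bary x i • M.vert T i := by
    intro i g hg
    by_cases hi : bary x i = 0
    · simp [hi]
    · obtain ⟨j, hj⟩ := hsx i hi
      rw [Finset.sum_eq_single j]
      · rw [if_pos hj.symm, hg j hj.symm]
      · intro j' _ hne
        rw [if_neg, zero_smul]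
        intro h'
        exact hne (hinj' (by rw [← h', hj]))
      · simp
  have hcol1 : ∀ i, ∑ j, (if M.vert T i = M.vert T' j then bary x i else 0) = bary x i := by
    intro i
    by_cases hi : bary x i = 0
    · simp [hi]
    · obtain ⟨j, hj⟩ := hsx i hi
      rw [Finset.sum_eq_single j]
      · rw [if_pos hj.symm]
      · intro j' _ hne
        rw [if_neg]
        intro h'
        exact hne (hinj' (by rw [← h', hj]))
      · simp
  have hw'x : w' = bary x' := by
    refine (M.nondegenerate T').eq_weights ?_ (sum_bary x') ?_
    · rw [hw', Finset.sum_comm]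
      simp_rw [hcol1]
      exact sum_bary x
    · change _ = affineParam (M.vert T') x'
      rw [← h, affineParam, hw']
      simp_rw [Finset.sum_smul]
      rw [Finset.sum_comm]
      exact Finset.sum_congr rfl fun i _ => hcol i _ fun j hj => hj.symm
  obtain ⟨j, hj⟩ := hsx i hi
  refine ⟨j, hj, ?_⟩
  rw [← hw'x, hw']
  simp only
  rw [Finset.sum_eq_single i]
  · rw [if_pos hj.symm]
  · intro i' _ hne
    rw [if_neg]
    intro h'
    exact hne (hinj (by rw [h', hj]))
  · simp

/-- The interpolants on two elements agree at common points. -/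
theorem X_eq_of_affineParam_eq (hk : 1 ≤ k) {T T' : Fin M.card} {x x' : Par n}
    (hx : x ∈ refSimplex n) (hx' : x' ∈ refSimplex n)
    (h : affineParam (M.vert T) x = affineParam (M.vert T') x') : M.X k T x = M.X k T' x' := by
  classical
  choose f hf hfb using fun i : {i // bary x i ≠ 0} => M.exists_bary_eq hx hx' h i.2
  have hinj : Function.Injective (M.vert T) := (M.nondegenerate T).injective
  have hinj' : Function.Injective (M.vert T') := (M.nondegenerate T').injective
  -- Matching common vertices gives a bijection between the supports of the two coordinate vectors.
  -- Any extension to a permutation of all indices will do, because the remaining coordinates vanish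
  -- on both sides.
  let e : {i // bary x i ≠ 0} ≃ {j // bary x' j ≠ 0} :=
    Equiv.ofBijective (fun i => ⟨f i, by rw [hfb]; exact i.2⟩) (by
      constructor
      · intro i i' hii
        have h1 : f i = f i' := congrArg Subtype.val hii
        apply Subtype.ext
        apply hinj
        rw [← hf i, ← hf i', h1]
      · rintro ⟨j, hj⟩
        obtain ⟨i, hi, hib⟩ := M.exists_bary_eq hx' hx h.symm hj
        refine ⟨⟨i, by rw [hib]; exact hj⟩, Subtype.ext (hinj' ?_)⟩
        rw [hf, hi])
  set σ : Equiv.Perm (Fin (n + 1)) := e.extendSubtype with hσ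
  have hσ1 : ∀ i, bary x i ≠ 0 → M.vert T' (σ i) = M.vert T i := by
    intro i hi
    rw [hσ, e.extendSubtype_apply_of_mem i hi]
    exact hf ⟨i, hi⟩
  have hσ2 : ∀ i, bary x' (σ i) = bary x i := by
    intro i
    by_cases hi : bary x i = 0
    · have h1 : ¬ (bary x i ≠ 0) := fun h => h hi
      have := e.extendSubtype_not_mem i h1
      rw [hi]
      exact not_not.1 this
    · rw [hσ, e.extendSubtype_apply_of_mem i hi]
      exact hfb ⟨i, hi⟩
  have hchi : ∀ (T : Fin M.card) (α : Fin (n + 1) → ℕ), ∑ i, α i = k →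
      M.chi T (latticeNode k α) = M.P (∑ i, ((α i : ℝ) / k) • M.vert T i) := by
    intro T α hα
    obtain ⟨h1, h2⟩ := latticeNode_mem_refSimplex hk hα
    rw [chi, M.Xbar_elem T h1, affineParam, h2]
  unfold X lagrangeInterp
  refine Finset.sum_equiv (Equiv.arrowCongr σ (Equiv.refl ℕ)) ?_ ?_
  · intro α
    simp only [Finset.mem_piAntidiag]
    have : ∑ i, (Equiv.arrowCongr σ (Equiv.refl ℕ)) α i = ∑ i, α i := by
      rw [← Equiv.sum_comp σ]
      simp [Equiv.arrowCongr]
    simp [this]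
  · intro α hα
    have hαk : ∑ i, α i = k := (Finset.mem_piAntidiag.1 hα).1
    set α' := (Equiv.arrowCongr σ (Equiv.refl ℕ)) α with hα'
    have hα'σ : ∀ i, α' (σ i) = α i := by
      intro i
      simp [hα', Equiv.arrowCongr]
    have hα'k : ∑ i, α' i = k := by
      rw [← Equiv.sum_comp σ, ← hαk]
      exact Finset.sum_congr rfl fun i _ => hα'σ i
    have hB : lagrangeBasis k α' x' = lagrangeBasis k α x := by
      unfold lagrangeBasis
      rw [← Equiv.prod_comp σ]
      refine Finset.prod_congr rfl fun i _ => ?_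
      rw [hα'σ, hσ2]
    rw [hB]
    -- Nodes on the common face are the same point for both elements; for any other node the basis
    -- function vanishes.
    by_cases hsup : ∀ i, α i ≠ 0 → bary x i ≠ 0
    · congr 1
      rw [hchi T α hαk, hchi T' α' hα'k]
      congr 1
      rw [← Equiv.sum_comp σ fun j => ((α' j : ℝ) / k) • M.vert T' j]
      refine Finset.sum_congr rfl fun i _ => ?_
      rw [hα'σ]
      by_cases hi : α i = 0
      · simp [hi]
      · rw [hσ1 i (hsup i hi)]
    · push Not at hsup
      obtain ⟨i, hi, hi0⟩ := hsup
      rw [lagrangeBasis_eq_zero hi hi0, zero_smul, zero_smul]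

/-- Conformity together with injectivity of the piecewise parametrization: `P⁻¹` is single valued on
γ, so `P_d ∘ P⁻¹` can be defined through any element. -/
theorem X_eq_of_chi_eq (hk : 1 ≤ k) {T T' : Fin M.card} {x x' : Par n}
    (hx : x ∈ refSimplex n) (hx' : x' ∈ refSimplex n)
    (h : M.chi T x = M.chi T' x') : M.X k T x = M.X k T' x' := by
  refine M.X_eq_of_affineParam_eq hk hx hx' ?_
  rw [← M.Xbar_elem T hx, ← M.Xbar_elem T' hx']
  exact M.P_injOn (mem_iUnion.2 ⟨T, M.Xbar_mem_elemBar T hx⟩)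
    (mem_iUnion.2 ⟨T', M.Xbar_mem_elemBar T' hx'⟩) h

end ParamSurface

end SurfaceFEM

/-! ### Macro patches: neighbourhoods and overlap -/

/-- The vertices of a simplex belong to every point set with the same convex hull. -/
theorem AffineIndependent.range_subset_of_convexHull_eq {E : Type*} [AddCommGroup E] [Module ℝ E]
    {m m' : ℕ} {v : Fin m → E} {u : Fin m' → E} (hv : AffineIndependent ℝ v)
    (h : convexHull ℝ (range u) = convexHull ℝ (range v)) : range v ⊆ range u := by
  rintro _ ⟨i, rfl⟩
  have hi : v i ∈ convexHull ℝ (u '' univ) := by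
    rw [image_univ, h]
    exact subset_convexHull ℝ _ ⟨i, rfl⟩
  obtain ⟨w, w0, -, w1, hw⟩ := exists_weights_of_mem_convexHull_image hi
  have hu : ∀ j, u j ∈ convexHull ℝ (v '' univ) := by
    intro j
    rw [image_univ, ← h]
    exact subset_convexHull ℝ _ ⟨j, rfl⟩
  choose c c0 _ c1 hc using fun j => exists_weights_of_mem_convexHull_image (hu j)
  classical
  -- Expanding every `u j` in the `v k` and using uniqueness, the weighted average of the coordinate
  -- vectors is the `i`-th unit vector. Nonnegativity forces each `u j` of positive weight to be `v
  -- i` itself.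
  have key : (fun k => ∑ j, w j * c j k) = fun k => if k = i then (1 : ℝ) else 0 := by
    refine hv.eq_weights ?_ (by simp) ?_
    · rw [Finset.sum_comm]
      simp_rw [← Finset.mul_sum, c1, mul_one]
      exact w1
    · simp_rw [Finset.sum_smul, ite_smul, one_smul, zero_smul]
      rw [Finset.sum_comm, Finset.sum_ite_eq' Finset.univ i, if_pos (Finset.mem_univ i), ← hw]
      refine Finset.sum_congr rfl fun j _ => ?_
      rw [← hc j, Finset.smul_sum]
      simp_rw [mul_smul]
  obtain ⟨j, hj⟩ : ∃ j, w j ≠ 0 := by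
    by_contra! hcon
    simp [hcon] at w1
  have hcj : ∀ k, k ≠ i → c j k = 0 := by
    intro k hk
    have h1 := congrFun key k
    simp only [if_neg hk] at h1
    have h2 := (Finset.sum_eq_zero_iff_of_nonneg fun j _ => mul_nonneg (w0 j) (c0 j k)).1 h1 j
      (Finset.mem_univ j)
    exact (mul_eq_zero.1 h2).resolve_left hj
  refine ⟨j, ?_⟩
  have h1 := c1 j
  rw [Finset.sum_eq_single i (fun k _ hk => hcj k hk) (by simp)] at h1
  rw [← hc j, Finset.sum_eq_single i (fun k _ hk => by rw [hcj k hk, zero_smul]) (by simp), h1,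
    one_smul]

namespace SurfaceFEM

variable {n : ℕ}

theorem exists_forall_le_dist_of_disjoint {E : Type*} [MetricSpace E] {K S : Set E}
    (hK : IsCompact K) (hS : IsCompact S) (h : Disjoint K S) :
    ∃ r : ℝ, 0 < r ∧ ∀ a ∈ K, ∀ x ∈ S, r ≤ dist a x := by
  obtain ⟨r, hr, hd⟩ := h.exists_thickenings hK hS.isClosed
  refine ⟨r, hr, fun a ha x hx => ?_⟩
  by_contra! hcon
  have h1 : x ∈ Metric.thickening r K := Metric.mem_thickening_iff.2 ⟨a, ha, by rwa [dist_comm]⟩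
  exact Set.disjoint_left.1 hd h1 (Metric.self_subset_thickening hr S hx)

/-- A common lower bound for the distances of the reference simplex from the boundaries of the
patches and from the faces of the patches that do not meet it. -/
theorem exists_patch_radius (W : Finset (RefPatch n)) : ∃ r : ℝ, 0 < r ∧ ∀ w ∈ W,
    Metric.cthickening r (refSimplex n) ⊆ interior w.carrier ∧
    ∀ s ∈ w.simplices, ∀ J : Set (Fin (n + 1)), Disjoint (convexHull ℝ (s '' J)) (refSimplex n) →
      ∀ a ∈ convexHull ℝ (s '' J), ∀ x ∈ refSimplex n, r ≤ dist a x := by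
  have h : ∀ᶠ r in 𝓝[>] (0 : ℝ), ∀ w ∈ W,
      Metric.cthickening r (refSimplex n) ⊆ interior w.carrier ∧
      ∀ s ∈ w.simplices, ∀ J : Set (Fin (n + 1)), Disjoint (convexHull ℝ (s '' J)) (refSimplex n) →
        ∀ a ∈ convexHull ℝ (s '' J), ∀ x ∈ refSimplex n, r ≤ dist a x := by
    rw [Filter.eventually_all_finset]
    intro w _
    refine Filter.Eventually.and ?_ ?_
    · obtain ⟨r, hr, h⟩ := isCompact_refSimplex.exists_cthickening_subset_open isOpen_interior w.inside
      filter_upwards [Ioo_mem_nhdsGT hr] with r' hr'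
      exact (Metric.cthickening_mono hr'.2.le _).trans h
    · rw [Filter.eventually_all_finset]
      intro s _
      rw [Filter.eventually_all]
      intro J
      by_cases hJ : Disjoint (convexHull ℝ (s '' J)) (refSimplex n)
      · obtain ⟨r, hr, h⟩ := exists_forall_le_dist_of_disjoint
          ((toFinite (s '' J)).isCompact_convexHull ℝ) isCompact_refSimplex hJ
        filter_upwards [Ioo_mem_nhdsGT hr] with r' hr' _ a ha x hx
        exact hr'.2.le.trans (h a ha x hx)
      · exact Filter.Eventually.of_forall fun _ h => absurd h hJ
  obtain ⟨r, h1, h2⟩ := (h.and self_mem_nhdsWithin).exists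
  exact ⟨r, h2, h1⟩

namespace ParamSurface

variable {γ : Set (Amb n)} {W : Finset (RefPatch n)} (M : ParamSurface n γ W)

/-- Every element that touches the image of a small neighbourhood of the reference simplex meets
the central element of the patch. -/
theorem elemBar_inter_nonempty_of_dist_lt {r : ℝ} {T T'' : Fin M.card}
    (hr : ∀ s ∈ (M.patch T).simplices, ∀ J : Set (Fin (n + 1)),
      Disjoint (convexHull ℝ (s '' J)) (refSimplex n) →
      ∀ a ∈ convexHull ℝ (s '' J), ∀ x ∈ refSimplex n, r ≤ dist a x)
    {a x : Par n} (ha : a ∈ (M.patch T).carrier) (hx : x ∈ refSimplex n) (hax : dist a x < r)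
    (haT : M.Xbar T a ∈ M.elemBar T'') : (M.elemBar T'' ∩ M.elemBar T).Nonempty := by
  rcases ha with ha' | ha'
  · exact ⟨_, haT, M.Xbar_mem_elemBar T ha'⟩
  obtain ⟨s, hs, has⟩ := mem_iUnion₂.1 ha'
  obtain ⟨A, hA, T', hT'⟩ := M.Xbar_affine T s hs
  have hAs : ∀ J : Set (Fin (n + 1)), A '' convexHull ℝ (s '' J) = convexHull ℝ ((A ∘ s) '' J) := by
    intro J
    rw [A.image_convexHull, image_comp]
  have hsub : ∀ J : Set (Fin (n + 1)), convexHull ℝ (s '' J) ⊆ convexHull ℝ (range s) :=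
    fun J => convexHull_mono (image_subset_range _ _)
  have hrange : range (M.vert T') ⊆ range (A ∘ s) := by
    refine (M.nondegenerate T').range_subset_of_convexHull_eq ?_
    rw [← hT', ← image_univ, ← image_univ (f := s), ← hAs univ]
  -- The vertices of `s` whose images are shared with `T''`. Conformity puts `Xbar T a` on the image
  -- of this face, and injectivity puts `a` on the face. If the face missed the reference simplex it
  -- would be at distance at least `r`; otherwise a common point shows that `T''` meets `T`.
  set J : Set (Fin (n + 1)) := {i | A (s i) ∈ range (M.vert T'')} with hJ
  have h1 : M.Xbar T a ∈ convexHull ℝ ((A ∘ s) '' J) := by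
    have h2 : M.Xbar T a ∈ convexHull ℝ (range (M.vert T')) := by
      rw [← hT', hA has]
      exact mem_image_of_mem _ has
    refine convexHull_mono ?_ (M.conforming T' T'' ⟨h2, haT⟩)
    rintro b ⟨hb, hb'⟩
    obtain ⟨i, rfl⟩ := hrange hb
    exact ⟨i, hb', rfl⟩
  rw [← hAs] at h1
  obtain ⟨b, hb, hba⟩ := h1
  have hab : b = a := by
    refine M.Xbar_inj T (convexHull_subset_carrier _ hs (hsub J hb)) (Or.inr ha') ?_
    rw [hA (hsub J hb), hba]
  subst hab
  by_cases hd : Disjoint (convexHull ℝ (s '' J)) (refSimplex n)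
  · exact absurd hax (not_lt.2 (hr s hs J hd b hb x hx))
  · obtain ⟨c, hc, hcT⟩ := Set.not_disjoint_iff.1 hd
    refine ⟨M.Xbar T c, ?_, M.Xbar_mem_elemBar T hcT⟩
    rw [hA (hsub J hc)]
    have h3 : A c ∈ convexHull ℝ ((A ∘ s) '' J) := by
      rw [← hAs]
      exact mem_image_of_mem _ hc
    refine convexHull_mono ?_ h3
    rintro _ ⟨i, hi, rfl⟩
    exact hi

theorem isClosed_elem (T : Fin M.card) : IsClosed (M.elem T) := (M.isCompact_elem T).isClosed

/-- Near a point of `γ` there are only points of elements containing it. -/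
theorem eventually_exists_mem_elem (y : Amb n) :
    ∀ᶠ z in 𝓝[γ] y, ∃ T, z ∈ M.elem T ∧ y ∈ M.elem T := by
  have h : ∀ᶠ z in 𝓝 y, ∀ T, z ∈ M.elem T → y ∈ M.elem T := by
    rw [Filter.eventually_all]
    intro T
    by_cases hy : y ∈ M.elem T
    · exact Filter.Eventually.of_forall fun _ _ => hy
    · filter_upwards [(M.isClosed_elem T).isOpen_compl.mem_nhds hy] with z hz hz'
      exact absurd hz' hz
  filter_upwards [nhdsWithin_le_nhds h, self_mem_nhdsWithin] with z hz hzγ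
  rw [← M.iUnion_elem, mem_iUnion] at hzγ
  obtain ⟨T, hT⟩ := hzγ
  exact ⟨T, hT, hz T hT⟩

/-- Points of γ close to `χ_T(a)` lie in elements containing `χ_T(a)`, and all of these meet the
central element. This gives relative openness of a patch slightly beyond its central element. -/
theorem omega_mem_nhdsWithin {r : ℝ} {T : Fin M.card}
    (hr : ∀ s ∈ (M.patch T).simplices, ∀ J : Set (Fin (n + 1)),
      Disjoint (convexHull ℝ (s '' J)) (refSimplex n) →
      ∀ a ∈ convexHull ℝ (s '' J), ∀ x ∈ refSimplex n, r ≤ dist a x)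
    {a x : Par n} (ha : a ∈ (M.patch T).carrier) (hx : x ∈ refSimplex n) (hax : dist a x < r) :
    M.omega T ∈ 𝓝[γ] (M.chi T a) := by
  filter_upwards [M.eventually_exists_mem_elem (M.chi T a)] with z hz
  obtain ⟨T', hz', ha'⟩ := hz
  refine M.elem_subset_omega ?_ hz'
  exact M.elemBar_inter_nonempty_of_dist_lt hr ha hx hax
    ((M.P_mem_elem_iff (M.Xbar_mem T ha)).1 ha')

theorem omega_mem_nhdsWithin_of_mem_elem {T : Fin M.card} {y : Amb n} (hy : y ∈ M.elem T) :
    M.omega T ∈ 𝓝[γ] y := by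
  filter_upwards [M.eventually_exists_mem_elem y] with z hz
  obtain ⟨T', hz', hy'⟩ := hz
  exact M.elem_subset_omega (M.elem_inter_nonempty_iff.1 ⟨y, hy', hy⟩) hz'

/-- Two elements agree if an interior point of the first belongs to the second. -/
theorem eq_of_affineParam_mem {T T' : Fin M.card} {x : Par n} (hx : x ∈ refSimplex n)
    (hx0 : ∀ i, bary x i ≠ 0) (h : affineParam (M.vert T) x ∈ M.elemBar T') : T = T' := by
  rw [elemBar_eq] at h
  obtain ⟨x', hx', hxx⟩ := h
  choose f hf _ using fun i => M.exists_bary_eq hx hx' hxx.symm (hx0 i)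
  have hinj : Function.Injective f := fun i j hij =>
    (M.nondegenerate T).injective (by rw [← hf i, ← hf j, hij])
  have hsurj : Function.Surjective f := Finite.surjective_of_injective hinj
  refine M.distinct (Subset.antisymm ?_ ?_)
  · rintro _ ⟨i, rfl⟩
    exact ⟨f i, hf i⟩
  · rintro _ ⟨j, rfl⟩
    obtain ⟨i, rfl⟩ := hsurj j
    exact ⟨i, (hf i).symm⟩

theorem exists_bary_ne_zero : ∃ x ∈ refSimplex n, ∀ i, bary x i ≠ 0 := by
  set c : ℝ := 1 / ((n : ℝ) + 1) with hc
  have hc0 : 0 < c := by positivity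
  have h1 : ∑ _i : Fin (n + 1), c = 1 := by
    simp [hc]
    field_simp
  refine ⟨_, toLp_mem_refSimplex (w := fun _ => c) (fun _ => hc0.le) h1, fun i => ?_⟩
  rw [bary_toLp h1]
  exact hc0.ne'

open Classical in
/-- The number of elements meeting a given one is at most the number of simplices of its patch. -/
theorem card_neighbors_le (T : Fin M.card) :
    (Finset.univ.filter fun T' => (M.elemBar T' ∩ M.elemBar T).Nonempty).card ≤
      (M.patch T).simplices.card + 1 := by
  have : Nonempty (Fin M.card) := ⟨T⟩
  choose! A hA g hg using M.Xbar_affine T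
  -- A point of `T'` with no vanishing barycentric coordinate is hit by the reference simplex or by
  -- some `s` of the patch. The image of that simplex is a whole element, which must then be `T'`.
  have hsub : (Finset.univ.filter fun T' => (M.elemBar T' ∩ M.elemBar T).Nonempty) ⊆
      insert T ((M.patch T).simplices.image g) := by
    intro T' hT'
    rw [Finset.mem_filter] at hT'
    obtain ⟨x, hx, hx0⟩ := exists_bary_ne_zero (n := n)
    have h1 : affineParam (M.vert T') x ∈ M.elemBar T' := by
      rw [elemBar_eq]
      exact mem_image_of_mem _ hx
    have h2 : affineParam (M.vert T') x ∈ M.Xbar T '' (M.patch T).carrier := by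
      rw [M.Xbar_image]
      exact mem_iUnion₂.2 ⟨T', hT'.2, h1⟩
    obtain ⟨a, ha, hax⟩ := h2
    rcases ha with ha | ha
    · have := M.eq_of_affineParam_mem hx hx0 (T' := T) (by
        rw [← hax]
        exact M.Xbar_mem_elemBar T ha)
      simp [this]
    · obtain ⟨s, hs, has⟩ := mem_iUnion₂.1 ha
      have := M.eq_of_affineParam_mem hx hx0 (T' := g s) (by
        rw [← hax, hA s hs has, elemBar, ← hg s hs]
        exact mem_image_of_mem _ has)
      rw [this]
      exact Finset.mem_insert_of_mem (Finset.mem_image_of_mem _ hs)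
  refine (Finset.card_le_card hsub).trans ((Finset.card_insert_le _ _).trans ?_)
  gcongr
  exact Finset.card_image_le

/-- The largest number of simplices in a patch. -/
def _root_.SurfaceFEM.patchCard (W : Finset (RefPatch n)) : ℕ :=
  W.sup (fun w => w.simplices.card) + 1

open Classical in
theorem card_neighbors_le_patchCard (T : Fin M.card) :
    (Finset.univ.filter fun T' => (M.elemBar T' ∩ M.elemBar T).Nonempty).card ≤ patchCard W := by
  refine (M.card_neighbors_le T).trans ?_
  unfold patchCard
  gcongr
  exact Finset.le_sup (f := fun w : RefPatch n => w.simplices.card) (M.patch_mem T)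

open Classical in
theorem card_elem_le (y : Amb n) :
    (Finset.univ.filter fun T => y ∈ M.elem T).card ≤ patchCard W := by
  rcases Finset.eq_empty_or_nonempty (Finset.univ.filter fun T => y ∈ M.elem T) with h | ⟨T, hT⟩
  · rw [h]; simp
  · refine (Finset.card_le_card ?_).trans (M.card_neighbors_le_patchCard T)
    intro T' hT'
    simp only [Finset.mem_filter, Finset.mem_univ, true_and] at hT hT' ⊢
    exact M.elem_inter_nonempty_iff.1 ⟨y, hT', hT⟩

open Classical in
-- Two steps of counting: `y` lies in few elements, and each of these has few neighbours.
theorem card_omega_le (y : Amb n) :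
    (Finset.univ.filter fun T => y ∈ M.omega T).card ≤ patchCard W * patchCard W := by
  have hsub : (Finset.univ.filter fun T => y ∈ M.omega T) ⊆
      (Finset.univ.filter fun T' => y ∈ M.elem T').biUnion fun T' =>
        Finset.univ.filter fun T => (M.elemBar T ∩ M.elemBar T').Nonempty := by
    intro T hT
    obtain ⟨T', h1, h2⟩ := M.mem_omega_iff.1 (Finset.mem_filter.1 hT).2
    simp only [Finset.mem_biUnion, Finset.mem_filter, Finset.mem_univ, true_and]
    exact ⟨T', h2, by rwa [inter_comm]⟩
  refine (Finset.card_le_card hsub).trans (Finset.card_biUnion_le.trans ?_)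
  refine (Finset.sum_le_sum fun T' _ => M.card_neighbors_le_patchCard T').trans ?_
  rw [Finset.sum_const, smul_eq_mul]
  exact Nat.mul_le_mul_right _ (M.card_elem_le y)

end ParamSurface

end SurfaceFEM

/-! ### Element scaling and interpolation error -/

namespace SurfaceFEM

variable {n : ℕ}

theorem volume_refSimplex_ne_top : volume (refSimplex n) ≠ ⊤ := isCompact_refSimplex.measure_ne_top

theorem measureReal_refSimplex_pos : 0 < volume.real (refSimplex n) := by
  refine ENNReal.toReal_pos ?_ volume_refSimplex_ne_top
  exact (Measure.measure_pos_of_nonempty_interior _ interior_refSimplex_nonempty).ne'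

/-- The length scale `|T̂|^{1/n}`. -/
noncomputable def refScale (n : ℕ) : ℝ := volume.real (refSimplex n) ^ (1 / (n : ℝ))

theorem refScale_pos : 0 < refScale n := Real.rpow_pos_of_pos measureReal_refSimplex_pos _

theorem closure_interior_refSimplex : closure (interior (refSimplex n)) = refSimplex n := by
  rw [convex_refSimplex.closure_interior_eq_closure_of_nonempty_interior interior_refSimplex_nonempty,
    isClosed_refSimplex.closure_eq]

namespace ParamSurface

variable {k : ℕ} {γ : Set (Amb n)} {W : Finset (RefPatch n)} (M : ParamSurface n γ W)

theorem diam_pos (hn : 1 ≤ n) (T : Fin M.card) : 0 < Metric.diam (M.elemBar T) := by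
  have h0 : (0 : Fin (n + 1)) ≠ Fin.last n := by
    intro h
    have := congrArg Fin.val h
    simp at this
    omega
  have h1 : M.vert T 0 ≠ M.vert T (Fin.last n) := fun h => h0 ((M.nondegenerate T).injective h)
  have hmem : ∀ i, M.vert T i ∈ M.elemBar T := fun i => subset_convexHull ℝ _ ⟨i, rfl⟩
  exact (dist_pos.2 h1).trans_le
    (Metric.dist_le_diam_of_mem (M.isCompact_elemBar T).isBounded (hmem _) (hmem _))

namespace Admissible

variable {M} {cbar c L C₁ C₂ δ : ℝ}

theorem areaElement_affineParam (A : M.Admissible k cbar c L C₁ C₂ δ) (hcbar : 0 < cbar)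
    (T : Fin M.card) {x : Par n} (hx : x ∈ refSimplex n) :
    (cbar⁻¹ * Metric.diam (M.elemBar T)) ^ n ≤ areaElement (affineParam (M.vert T)) x ∧
      areaElement (affineParam (M.vert T)) x ≤ (cbar * Metric.diam (M.elemBar T)) ^ n := by
  have hd : 0 ≤ Metric.diam (M.elemBar T) := Metric.diam_nonneg
  rw [areaElement_eq_normDet]
  have hfr : Module.finrank ℝ (Par n) = n := by simp
  constructor
  · have := LinearMap.le_normDet_of_bound (fderiv ℝ (affineParam (M.vert T)) x).toLinearMap
      (m := cbar⁻¹ * Metric.diam (M.elemBar T)) (by positivity) fun w => (A.shape_init T x hx w).1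
    rwa [hfr] at this
  · have := LinearMap.normDet_le_of_bound (fderiv ℝ (affineParam (M.vert T)) x).toLinearMap
      (m := cbar * Metric.diam (M.elemBar T)) fun w => (A.shape_init T x hx w).2
    rwa [hfr] at this

/-- By shape regularity the area element lies between the `n`-th powers of multiples of the
diameter; integrate over the reference simplex and take the `n`-th root. -/
theorem h_bounds (A : M.Admissible k cbar c L C₁ C₂ δ) (hn : 1 ≤ n) (hcbar : 0 < cbar)
    (T : Fin M.card) :
    refScale n * (cbar⁻¹ * Metric.diam (M.elemBar T)) ≤ M.h T ∧
      M.h T ≤ refScale n * (cbar * Metric.diam (M.elemBar T)) := by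
  have hd : 0 ≤ Metric.diam (M.elemBar T) := Metric.diam_nonneg
  have hn0 : (n : ℝ) ≠ 0 := by positivity
  have hV := measureReal_refSimplex_pos (n := n)
  have hroot : ∀ a : ℝ, 0 ≤ a →
      (a ^ n * volume.real (refSimplex n)) ^ (1 / (n : ℝ)) = refScale n * a := by
    intro a ha
    rw [Real.mul_rpow (by positivity) hV.le, ← Real.rpow_natCast, ← Real.rpow_mul ha,
      mul_one_div_cancel hn0, Real.rpow_one, mul_comm, refScale]
  have hint : IntegrableOn (areaElement (affineParam (M.vert T))) (refSimplex n) := by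
    refine Measure.integrableOn_of_bounded (M := (cbar * Metric.diam (M.elemBar T)) ^ n)
      volume_refSimplex_ne_top
      (measurable_areaElement _).aestronglyMeasurable ?_
    filter_upwards [ae_restrict_mem isClosed_refSimplex.measurableSet] with x hx
    rw [Real.norm_of_nonneg (areaElement_nonneg _ _)]
    exact (A.areaElement_affineParam hcbar T hx).2
  have hconst : ∀ a : ℝ, ∫ _x in refSimplex n, a = a * volume.real (refSimplex n) := by
    intro a
    rw [setIntegral_const, smul_eq_mul, mul_comm]
  constructor
  · rw [← hroot _ (by positivity), ParamSurface.h]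
    refine Real.rpow_le_rpow (by positivity) ?_ (by positivity)
    rw [← hconst]
    exact setIntegral_mono_on (integrableOn_const volume_refSimplex_ne_top) hint
      isClosed_refSimplex.measurableSet fun x hx => (A.areaElement_affineParam hcbar T hx).1
  · rw [← hroot _ (by positivity), ParamSurface.h]
    refine Real.rpow_le_rpow ?_ ?_ (by positivity)
    · exact setIntegral_nonneg isClosed_refSimplex.measurableSet fun x _ => areaElement_nonneg _ _
    rw [← hconst]
    exact setIntegral_mono_on hint (integrableOn_const volume_refSimplex_ne_top)
      isClosed_refSimplex.measurableSet fun x hx => (A.areaElement_affineParam hcbar T hx).2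

theorem h_pos (A : M.Admissible k cbar c L C₁ C₂ δ) (hn : 1 ≤ n) (hcbar : 0 < cbar)
    (T : Fin M.card) : 0 < M.h T := by
  have := M.diam_pos hn T
  have := refScale_pos (n := n)
  exact lt_of_lt_of_le (by positivity) (A.h_bounds hn hcbar T).1

theorem diam_le (A : M.Admissible k cbar c L C₁ C₂ δ) (hn : 1 ≤ n) (hcbar : 0 < cbar)
    (T : Fin M.card) : Metric.diam (M.elemBar T) ≤ cbar / refScale n * M.h T := by
  have h1 := (A.h_bounds hn hcbar T).1
  have := refScale_pos (n := n)
  calc Metric.diam (M.elemBar T)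
      = cbar / refScale n * (refScale n * (cbar⁻¹ * Metric.diam (M.elemBar T))) := by
        field_simp
    _ ≤ _ := by gcongr

theorem norm_chi_sub_le (A : M.Admissible k cbar c L C₁ C₂ δ) {T : Fin M.card} {x y : Par n}
    (hx : x ∈ (M.patch T).carrier) (hy : y ∈ (M.patch T).carrier) :
    ‖M.chi T x - M.chi T y‖ ≤ L * M.h T * ‖x - y‖ :=
  (A.biLipschitz_patch T x hx y hy).2

theorem norm_sub_le_chi (A : M.Admissible k cbar c L C₁ C₂ δ) (hL : 1 ≤ L) {T : Fin M.card}
    (hT : 0 < M.h T) {x y : Par n}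
    (hx : x ∈ (M.patch T).carrier) (hy : y ∈ (M.patch T).carrier) :
    ‖x - y‖ ≤ L / M.h T * ‖M.chi T x - M.chi T y‖ := by
  have h1 := (A.biLipschitz_patch T x hx y hy).1
  have hL0 : 0 < L := by linarith
  calc ‖x - y‖ = L / M.h T * (M.h T * L⁻¹ * ‖x - y‖) := by field_simp
    _ ≤ _ := by gcongr

theorem lipschitzOnWith_chi (A : M.Admissible k cbar c L C₁ C₂ δ) (hL : 1 ≤ L) {T : Fin M.card}
    (hT : 0 < M.h T) : LipschitzOnWith (L * M.h T).toNNReal (M.chi T) (M.patch T).carrier := by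
  refine LipschitzOnWith.of_dist_le_mul fun x hx y hy => ?_
  rw [dist_eq_norm, dist_eq_norm, Real.coe_toNNReal _ (by positivity)]
  exact A.norm_chi_sub_le hx hy

theorem injOn_chi (A : M.Admissible k cbar c L C₁ C₂ δ) (hL : 1 ≤ L) {T : Fin M.card}
    (hT : 0 < M.h T) : InjOn (M.chi T) (M.patch T).carrier := by
  intro x hx y hy hxy
  have h1 := A.norm_sub_le_chi hL hT hx hy
  rw [hxy, sub_self, norm_zero, mul_zero] at h1
  exact sub_eq_zero.1 (norm_le_zero_iff.1 h1)

end Admissible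

theorem contDiff_X (k : ℕ) (T : Fin M.card) : ContDiff ℝ ∞ (M.X k T) := contDiff_lagrangeInterp k _

theorem continuousOn_chi (T : Fin M.card) : ContinuousOn (M.chi T) (M.patch T).carrier :=
  M.continuousOn_P.comp (M.Xbar_cont T) fun _ hx => M.Xbar_mem T hx

theorem continuousOn_chi_sub_X (k : ℕ) (T : Fin M.card) :
    ContinuousOn (fun x => M.chi T x - M.X k T x) (refSimplex n) :=
  ((M.continuousOn_chi T).mono (refSimplex_subset_carrier _)).sub
    (M.contDiff_X k T).continuous.continuousOn

theorem norm_chi_sub_X_le_beta (k : ℕ) {T : Fin M.card} {x : Par n} (hx : x ∈ refSimplex n) :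
    ‖M.chi T x - M.X k T x‖ ≤ M.beta k T :=
  le_csSup (isCompact_refSimplex.image_of_continuousOn (M.continuousOn_chi_sub_X k T).norm).bddAbove
    (mem_image_of_mem _ hx)

theorem beta_nonneg (k : ℕ) (T : Fin M.card) : 0 ≤ M.beta k T :=
  (norm_nonneg _).trans (M.norm_chi_sub_X_le_beta k zero_mem_refSimplex)

theorem beta_le {T : Fin M.card} {b : ℝ} (h : ∀ x ∈ refSimplex n, ‖M.chi T x - M.X k T x‖ ≤ b) :
    M.beta k T ≤ b := by
  refine csSup_le ⟨_, mem_image_of_mem _ zero_mem_refSimplex⟩ ?_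
  rintro _ ⟨x, hx, rfl⟩
  exact h x hx

theorem beta_le_betaMax (k : ℕ) (T : Fin M.card) : M.beta k T ≤ M.betaMax k :=
  le_ciSup (finite_range _).bddAbove T

theorem betaMax_nonneg (k : ℕ) : 0 ≤ M.betaMax k := Real.iSup_nonneg fun T => M.beta_nonneg k T

theorem chi_zero_eq (hk : 1 ≤ k) (T : Fin M.card) : M.X k T 0 = M.chi T 0 := lagrangeInterp_zero hk _

namespace Admissible

variable {M} {cbar c L C₁ C₂ δ : ℝ}

/-- `lam` measures derivatives on the flat element; shape regularity converts them to reference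
coordinates at the cost of `cbar` times the diameter. -/
theorem ae_norm_fderiv_chi_sub_X_le (A : M.Admissible k cbar c L C₁ C₂ δ) (hn : 1 ≤ n)
    (hcbar : 0 < cbar) (hL : 1 ≤ L) (T : Fin M.card) :
    ∀ᵐ x ∂volume.restrict (interior (refSimplex n)),
      ‖fderiv ℝ (fun y => M.chi T y - M.X k T y) x‖ ≤
        M.lam k T * (cbar * Metric.diam (M.elemBar T)) := by
  set d := Metric.diam (M.elemBar T) with hd
  have hd0 : 0 < d := M.diam_pos hn T
  have hT := A.h_pos hn hcbar T
  set E : Par n → Amb n := fun y => M.chi T y - M.X k T y with hE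
  have hset : ∀ x ∈ refSimplex n, ∀ w : Par n,
      ‖fderiv ℝ (affineParam (M.vert T)) x w‖ ≤ 1 → ‖w‖ ≤ cbar / d := by
    intro x hx w hw
    have h1 := (A.shape_init T x hx w).1
    calc ‖w‖ = cbar / d * (cbar⁻¹ * d * ‖w‖) := by field_simp
      _ ≤ cbar / d * 1 := by gcongr; exact h1.trans hw
      _ = _ := mul_one _
  have hbdd : ∀ x ∈ refSimplex n, BddAbove {r : ℝ | ∃ w : Par n,
      ‖fderiv ℝ (affineParam (M.vert T)) x w‖ ≤ 1 ∧ r = ‖fderiv ℝ E x w‖} := by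
    intro x hx
    refine ⟨‖fderiv ℝ E x‖ * (cbar / d), ?_⟩
    rintro r ⟨w, hw, rfl⟩
    exact ((fderiv ℝ E x).le_opNorm w).trans (by gcongr; exact hset x hx w hw)
  have hgrad : ∀ x ∈ refSimplex n, ‖fderiv ℝ E x‖ ≤ M.gradError k T x * (cbar * d) := by
    intro x hx
    have hg0 : 0 ≤ M.gradError k T x := Real.sSup_nonneg (by
      rintro r ⟨w, -, rfl⟩
      exact norm_nonneg _)
    refine ContinuousLinearMap.opNorm_le_bound _ (by positivity) fun w => ?_
    rcases eq_or_ne w 0 with rfl | hw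
    · simp
    have hw0 : 0 < ‖w‖ := norm_pos_iff.2 hw
    set s : ℝ := (cbar * d * ‖w‖)⁻¹ with hs
    have hs0 : 0 < s := by positivity
    have h1 : ‖fderiv ℝ E x (s • w)‖ ≤ M.gradError k T x := by
      refine le_csSup (hbdd x hx) ⟨s • w, ?_, rfl⟩
      rw [map_smul, norm_smul, Real.norm_of_nonneg hs0.le]
      calc s * ‖fderiv ℝ (affineParam (M.vert T)) x w‖ ≤ s * (cbar * d * ‖w‖) := by
            gcongr; exact (A.shape_init T x hx w).2
        _ = 1 := by rw [hs]; field_simp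
    rw [map_smul, norm_smul, Real.norm_of_nonneg hs0.le] at h1
    calc ‖fderiv ℝ E x w‖ = (cbar * d * ‖w‖) * (s * ‖fderiv ℝ E x w‖) := by
          rw [hs]; field_simp
      _ ≤ (cbar * d * ‖w‖) * M.gradError k T x := by gcongr
      _ = _ := by ring
  obtain ⟨B, hB⟩ := isCompact_refSimplex.exists_bound_of_continuousOn
    ((M.contDiff_X k T).continuous_fderiv (by simp)).norm.continuousOn
  have hB' : ∀ x ∈ refSimplex n, ‖fderiv ℝ (M.X k T) x‖ ≤ B := fun x hx => by
    simpa using hB x hx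
  have hB0 : 0 ≤ B := (norm_nonneg _).trans (hB' 0 zero_mem_refSimplex)
  have hsub : interior (refSimplex n) ⊆ refSimplex n := interior_subset
  have hbound : ∀ x ∈ interior (refSimplex n), ‖fderiv ℝ E x‖ ≤ L * M.h T + B := by
    intro x hx
    by_cases hdiff : DifferentiableAt ℝ (M.chi T) x
    · have h1 : fderiv ℝ E x = fderiv ℝ (M.chi T) x - fderiv ℝ (M.X k T) x :=
        fderiv_sub hdiff ((M.contDiff_X k T).differentiable (by simp) x)
      rw [h1]
      refine (norm_sub_le _ _).trans (add_le_add ?_ (hB' x (hsub hx)))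
      have h2 := norm_fderiv_le_of_lipschitzOn ℝ
        (Filter.mem_of_superset (isOpen_interior.mem_nhds hx)
          (hsub.trans (refSimplex_subset_carrier (M.patch T))))
        (A.lipschitzOnWith_chi hL hT)
      rwa [Real.coe_toNNReal _ (by positivity)] at h2
    -- The interpolant is smooth, so `E` is not differentiable either and its `fderiv` has the
    -- default value `0`.
    · have h1 : ¬ DifferentiableAt ℝ E x := by
        intro h
        apply hdiff
        have := h.add ((M.contDiff_X k T).differentiable (by simp) x)
        refine this.congr_of_eventuallyEq (Filter.Eventually.of_forall fun y => ?_)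
        simp [hE]
      rw [fderiv_zero_of_not_differentiableAt h1, norm_zero]
      positivity
  have hae : volume.restrict (interior (refSimplex n)) = volume.restrict (refSimplex n) := by
    refine Measure.restrict_congr_set ?_
    exact interior_ae_eq_of_null_frontier volume_frontier_refSimplex
  -- `lam` is a `toReal`, which would be `0` for an infinite norm. Finiteness comes from the
  -- Lipschitz bound on `χ_T` and the boundedness of the derivative of the interpolant.
  have hfin : eLpNorm (M.gradError k T) ⊤ (volume.restrict (refSimplex n)) ≠ ⊤ := by
    rw [← hae]
    refine ne_top_of_le_ne_top (b := ENNReal.ofReal ((L * M.h T + B) * (cbar / d)))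
      ENNReal.ofReal_ne_top ?_
    rw [eLpNorm_exponent_top]
    refine eLpNormEssSup_le_of_ae_bound ?_
    filter_upwards [ae_restrict_mem isOpen_interior.measurableSet] with x hx
    have hg0 : 0 ≤ M.gradError k T x := Real.sSup_nonneg (by
      rintro r ⟨w, -, rfl⟩
      exact norm_nonneg _)
    rw [Real.norm_of_nonneg hg0]
    refine Real.sSup_le ?_ (by positivity)
    rintro r ⟨w, hw, rfl⟩
    refine ((fderiv ℝ E x).le_opNorm w).trans ?_
    gcongr
    · exact hbound x hx
    · exact hset x (hsub hx) w hw
  rw [hae]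
  have hess : ∀ᵐ x ∂volume.restrict (refSimplex n), ‖M.gradError k T x‖ₑ ≤
      eLpNorm (M.gradError k T) ⊤ (volume.restrict (refSimplex n)) := by
    rw [eLpNorm_exponent_top]
    exact enorm_ae_le_eLpNormEssSup _ _
  filter_upwards [hess, ae_restrict_mem isClosed_refSimplex.measurableSet] with x hx hxT
  refine (hgrad x hxT).trans ?_
  gcongr
  have h1 := ENNReal.toReal_mono hfin hx
  rw [toReal_enorm] at h1
  exact (le_abs_self _).trans h1

/-- The almost everywhere gradient bound becomes a Lipschitz bound on the convex interior and
extends to the closed simplex by continuity. One factor `cbar` comes from the gradient, the other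
with `refScale` from replacing the diameter by `h`. -/
theorem norm_error_sub_le (A : M.Admissible k cbar c L C₁ C₂ δ) (hn : 1 ≤ n)
    (hcbar : 0 < cbar) (hL : 1 ≤ L) {T : Fin M.card} {x y : Par n} (hx : x ∈ refSimplex n)
    (hy : y ∈ refSimplex n) :
    ‖(M.chi T y - M.X k T y) - (M.chi T x - M.X k T x)‖ ≤
      cbar ^ 2 / refScale n * δ * M.h T * ‖y - x‖ := by
  have hT := A.h_pos hn hcbar T
  have hd0 : 0 < Metric.diam (M.elemBar T) := M.diam_pos hn T
  set E : Par n → Amb n := fun y => M.chi T y - M.X k T y with hE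
  set m : ℝ := M.lam k T * (cbar * Metric.diam (M.elemBar T)) with hm
  have hlam : 0 ≤ M.lam k T := ENNReal.toReal_nonneg
  have hm0 : 0 ≤ m := by positivity
  obtain ⟨K, hK⟩ : ∃ K, LipschitzOnWith K E (interior (refSimplex n)) := by
    obtain ⟨B, hB⟩ := isCompact_refSimplex.exists_bound_of_continuousOn
      ((M.contDiff_X k T).continuous_fderiv (by simp)).norm.continuousOn
    have h1 : LipschitzOnWith B.toNNReal (M.X k T) (interior (refSimplex n)) := by
      refine Convex.lipschitzOnWith_of_nnnorm_fderiv_le (𝕜 := ℝ)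
        (fun x _ => (M.contDiff_X k T).differentiable (by simp) x) (fun x hx => ?_)
        convex_refSimplex.interior
      rw [← NNReal.coe_le_coe, coe_nnnorm]
      have := hB x (interior_subset hx)
      simp only [norm_norm] at this
      exact this.trans (Real.le_coe_toNNReal B)
    exact ⟨_, ((A.lipschitzOnWith_chi hL hT).mono
      (interior_subset.trans (refSimplex_subset_carrier _))).sub h1⟩
  have hint : LipschitzOnWith m.toNNReal E (interior (refSimplex n)) := by
    refine LipschitzOnWith.of_dist_le_mul fun x hx y hy => ?_
    rw [dist_eq_norm, dist_eq_norm, Real.coe_toNNReal _ hm0]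
    exact Convex.norm_sub_le_of_ae_norm_fderiv_le convex_refSimplex.interior isOpen_interior hK
      (A.ae_norm_fderiv_chi_sub_X_le hn hcbar hL T) hy hx
  have hcl : LipschitzOnWith m.toNNReal E (refSimplex n) := by
    have := (lipschitzOnWith_closure_iff (K := m.toNNReal) (f := E)
      (s := interior (refSimplex n)) (by
        rw [closure_interior_refSimplex]
        exact M.continuousOn_chi_sub_X k T)).2 hint
    rwa [closure_interior_refSimplex] at this
  have h1 := hcl.dist_le_mul y hy x hx
  rw [dist_eq_norm, dist_eq_norm, Real.coe_toNNReal _ hm0] at h1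
  refine h1.trans ?_
  gcongr
  have hs := refScale_pos (n := n)
  calc m ≤ δ * (cbar * (cbar / refScale n * M.h T)) := by
        rw [hm]
        gcongr
        · exact hlam.trans (A.lam_small T)
        · exact A.lam_small T
        · exact A.diam_le hn hcbar T
    _ = _ := by ring

/-- The interpolation error vanishes at the vertex `0`, and the reference simplex lies in the unit
ball. Hence `β_T / h_T` is of order `δ`, which keeps the displacement in reference coordinates
inside the patch. -/
theorem beta_le_h (A : M.Admissible k cbar c L C₁ C₂ δ) (hn : 1 ≤ n) (hk : 1 ≤ k)
    (hcbar : 0 < cbar) (hL : 1 ≤ L) (hδ : 0 < δ) (T : Fin M.card) :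
    M.beta k T ≤ cbar ^ 2 / refScale n * δ * M.h T := by
  have hT := A.h_pos hn hcbar T
  have hs := refScale_pos (n := n)
  refine M.beta_le fun x hx => ?_
  have h1 := A.norm_error_sub_le hn hcbar hL (T := T) zero_mem_refSimplex hx
  rw [M.chi_zero_eq hk, sub_self, sub_zero, sub_zero] at h1
  refine h1.trans ?_
  have := norm_le_one_of_mem_refSimplex hx
  exact mul_le_of_le_one_right (by positivity) this

theorem X_mem_tube (A : M.Admissible k cbar c L C₁ C₂ δ) {T : Fin M.card} {x : Par n}
    (hx : x ∈ refSimplex n) : M.X k T x ∈ tube γ := by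
  have h0 : Metric.infDist (M.X k T x) γ ≤ M.betaMax k := by
    refine (Metric.infDist_le_dist_of_mem (M.chi_mem T (refSimplex_subset_carrier _ hx))).trans ?_
    rw [dist_comm, dist_eq_norm]
    exact (M.norm_chi_sub_X_le_beta k hx).trans (M.beta_le_betaMax k T)
  have h1 := A.resolution
  have h2 : Metric.infDist (M.X k T x) γ * curvatureSup γ γ ≤ M.betaMax k * curvatureSup γ γ :=
    mul_le_mul_of_nonneg_right h0 (curvatureSup_nonneg γ γ)
  rw [tube, mem_ofPred_eq]
  linarith

end Admissible

theorem isClosestPoint_X (hγ : IsClosedC2Hypersurface γ) (k : ℕ) {T : Fin M.card} {x : Par n} :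
    IsClosestPoint γ (M.X k T x) (closestPoint γ (M.X k T x)) :=
  isClosestPoint_closestPoint hγ.1
    ⟨_, M.chi_mem T (refSimplex_subset_carrier _ zero_mem_refSimplex)⟩ _

theorem norm_X_sub_closestPoint_le (hγ : IsClosedC2Hypersurface γ) (k : ℕ) {T : Fin M.card}
    {x : Par n} (hx : x ∈ refSimplex n) :
    ‖M.X k T x - closestPoint γ (M.X k T x)‖ ≤ M.beta k T := by
  rw [← dist_eq_norm, (M.isClosestPoint_X hγ k).2]
  refine (Metric.infDist_le_dist_of_mem (M.chi_mem T (refSimplex_subset_carrier _ hx))).trans ?_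
  rw [dist_comm, dist_eq_norm]
  exact M.norm_chi_sub_X_le_beta k hx

/-- `χ_T(x)` is a competitor for the closest point, so one `β_T` bounds the distance from `X_T(x)`
to γ and another the distance from `X_T(x)` to `χ_T(x)`. -/
theorem norm_closestPoint_X_sub_chi_le (hγ : IsClosedC2Hypersurface γ) (k : ℕ) {T : Fin M.card}
    {x : Par n} (hx : x ∈ refSimplex n) :
    ‖closestPoint γ (M.X k T x) - M.chi T x‖ ≤ 2 * M.beta k T := by
  have h1 := M.norm_X_sub_closestPoint_le hγ k (T := T) hx
  have h2 := M.norm_chi_sub_X_le_beta k (T := T) hx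
  calc ‖closestPoint γ (M.X k T x) - M.chi T x‖
      = ‖(M.X k T x - closestPoint γ (M.X k T x)) + (M.chi T x - M.X k T x)‖ := by
        rw [← norm_neg]; congr 1; abel
    _ ≤ _ := (norm_add_le _ _).trans (by linarith)

end ParamSurface

end SurfaceFEM

/-! ### Pointwise Lipschitz estimate for `P_d ∘ P⁻¹` minus the identity -/

namespace SurfaceFEM

variable {n : ℕ} {γ : Set (Amb n)}

/-- The orthogonal projection onto the normal line of a hypersurface. -/
noncomputable def normalProj (γ : Set (Amb n)) (p w : Amb n) : Amb n :=
  ⟪normalField γ p, w⟫ • normalField γ p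

theorem IsClosedC2Hypersurface.norm_normalProj (hγ : IsClosedC2Hypersurface γ) {p : Amb n}
    (hp : p ∈ γ) (w : Amb n) : ‖normalProj γ p w‖ = |⟪normalField γ p, w⟫| := by
  rw [normalProj, norm_smul, hγ.norm_normalField hp, mul_one, Real.norm_eq_abs]

theorem IsClosedC2Hypersurface.inner_normalField_sub_normalProj (hγ : IsClosedC2Hypersurface γ)
    {p : Amb n} (hp : p ∈ γ) (w : Amb n) : ⟪normalField γ p, w - normalProj γ p w⟫ = 0 := by
  rw [normalProj, inner_sub_right, real_inner_smul_right, real_inner_self_eq_norm_sq,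
    hγ.norm_normalField hp]
  ring

/-- The projection is quadratic in the normal, so the arbitrary sign of `normalField` disappears and
the field can be followed along paths. -/
theorem IsClosedC2Hypersurface.eventually_normalProj_sub_le (hγ : IsClosedC2Hypersurface γ)
    {p : Amb n} (hp : p ∈ γ) {ε : ℝ} (hε : 0 < ε) :
    ∀ᶠ q in 𝓝[γ] p, ∀ w, ‖normalProj γ q w - normalProj γ p w‖ ≤
      2 * (maxCurvature γ p + ε) * ‖q - p‖ * ‖w‖ := by
  filter_upwards [hγ.eventually_norm_normalField_sub_le hp hε, self_mem_nhdsWithin] with q hq hqγ w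
  obtain ⟨σ, hσ, h⟩ := hq
  set N := normalField γ p with hN
  set N' := σ • normalField γ q with hN'
  have hn : ‖N‖ = 1 := hγ.norm_normalField hp
  have hn' : ‖N'‖ = 1 := by
    rw [hN', norm_smul, Real.norm_eq_abs, hσ, one_mul, hγ.norm_normalField hqγ]
  have hσ2 : σ * σ = 1 := by rw [← abs_mul_abs_self, hσ, one_mul]
  have h1 : normalProj γ q w = ⟪N', w⟫ • N' := by
    rw [hN', real_inner_smul_left, smul_smul, mul_right_comm, hσ2, one_mul]
    rfl
  have h2 : normalProj γ q w - normalProj γ p w = ⟪N' - N, w⟫ • N' + ⟪N, w⟫ • (N' - N) := by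
    rw [h1, normalProj, inner_sub_left, sub_smul, smul_sub]
    abel
  rw [h2]
  calc _ ≤ ‖N' - N‖ * ‖w‖ * ‖N'‖ + ‖N‖ * ‖w‖ * ‖N' - N‖ := by
        refine (norm_add_le _ _).trans ?_
        rw [norm_smul ⟪N' - N, w⟫, norm_smul ⟪N, w⟫]
        exact add_le_add
          (mul_le_mul_of_nonneg_right (abs_real_inner_le_norm (N' - N) w) (norm_nonneg _))
          (mul_le_mul_of_nonneg_right (abs_real_inner_le_norm N w) (norm_nonneg _))
    _ = 2 * ‖N' - N‖ * ‖w‖ := by rw [hn, hn']; ring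
    _ ≤ _ := by rw [mul_assoc 2 (_ + _)]; gcongr

/-- Secants near a point are nearly orthogonal to the normal at this point. -/
theorem IsClosedC2Hypersurface.exists_forall_abs_inner_sub_le (hγ : IsClosedC2Hypersurface γ)
    {p : Amb n} (hp : p ∈ γ) {ε : ℝ} (hε : 0 < ε) :
    ∃ ρ > 0, ∀ x ∈ γ, ∀ y ∈ γ, dist x p < ρ → dist y p < ρ →
      |⟪normalField γ p, x - y⟫| ≤ ε * ‖x - y‖ := by
  obtain ⟨φ, h, hN⟩ := hγ.exists_normalField_eq hp
  have hg : 0 < ‖gradient φ p‖ := norm_pos_iff.2 h.2.1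
  have h1 := h.hasStrictFDerivAt.isLittleO.bound (mul_pos hε hg)
  rw [nhds_prod_eq] at h1
  have h2 := h1.and (h.2.2.prod_mk h.2.2)
  rw [← nhds_prod_eq] at h2
  obtain ⟨ρ, hρ, hball⟩ := Metric.eventually_nhds_iff.1 h2
  refine ⟨ρ, hρ, fun x hx y hy hxp hyp => ?_⟩
  obtain ⟨h3, h4, h5⟩ := hball (y := (x, y)) (by
    rw [Prod.dist_eq]
    exact max_lt hxp hyp)
  simp only at h3 h4 h5
  rw [h4.1 hx, h5.1 hy, sub_self, zero_sub, norm_neg, Real.norm_eq_abs,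
    ← inner_gradient_eq] at h3
  rw [hN, unitNormal, real_inner_smul_left, abs_mul, abs_inv, abs_norm]
  calc ‖gradient φ p‖⁻¹ * |⟪gradient φ p, x - y⟫|
      ≤ ‖gradient φ p‖⁻¹ * (ε * ‖gradient φ p‖ * ‖x - y‖) := by gcongr
    _ = ε * ‖x - y‖ := by field_simp

namespace ParamSurface

variable {k : ℕ} {W : Finset (RefPatch n)} {M : ParamSurface n γ W}

namespace Admissible

variable {cbar c L C₁ C₂ δ : ℝ}

theorem continuousOn_chi_lineMap {T : Fin M.card} {a b : Par n}
    (ha : a ∈ (M.patch T).carrier) (hb : b ∈ (M.patch T).carrier) :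
    ContinuousOn (fun t : ℝ => M.chi T (a + t • (b - a))) (Icc 0 1) :=
  (M.continuousOn_chi T).comp (by fun_prop) fun t ht =>
    (convex_carrier _).add_smul_sub_mem ha hb ht

/-- A map on `γ` whose pointwise Lipschitz constant is at most `m` on a patch is Lipschitz there. -/
theorem norm_sub_le_of_eventually (A : M.Admissible k cbar c L C₁ C₂ δ) (hL : 1 ≤ L)
    {E : Type*} [NormedAddCommGroup E] {T : Fin M.card} (hT : 0 < M.h T) {G : Amb n → E} {m : ℝ}
    (hm : 0 ≤ m)
    (hG : ∀ y ∈ M.omega T, ∀ ε > 0, ∀ᶠ z in 𝓝[γ] y, ‖G z - G y‖ ≤ (m + ε) * ‖z - y‖)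
    {y z : Amb n} (hy : y ∈ M.omega T) (hz : z ∈ M.omega T) :
    ‖G z - G y‖ ≤ m * L ^ 2 * ‖z - y‖ := by
  rw [omega_eq] at hy hz
  obtain ⟨a, ha, rfl⟩ := hy
  obtain ⟨b, hb, rfl⟩ := hz
  set p : ℝ → Amb n := fun t => M.chi T (a + t • (b - a)) with hp
  have hmem : ∀ t ∈ Icc (0 : ℝ) 1, a + t • (b - a) ∈ (M.patch T).carrier := fun t ht =>
    (convex_carrier _).add_smul_sub_mem ha hb ht
  have hpω : ∀ t ∈ Icc (0 : ℝ) 1, p t ∈ M.omega T := fun t ht => by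
    rw [omega_eq]
    exact mem_image_of_mem _ (hmem t ht)
  have hpc : ContinuousOn p (Icc 0 1) := continuousOn_chi_lineMap ha hb
  have hpl : ∀ t ∈ Icc (0 : ℝ) 1, ∀ s ∈ Icc (0 : ℝ) 1,
      ‖p s - p t‖ ≤ L * M.h T * ‖b - a‖ * |s - t| := by
    intro t ht s hs
    refine (A.norm_chi_sub_le (hmem s hs) (hmem t ht)).trans (le_of_eq ?_)
    rw [add_sub_add_left_eq_sub, ← sub_smul, norm_smul, Real.norm_eq_abs]
    ring
  have hGc : ContinuousOn G (M.omega T) := by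
    intro y hy
    rw [ContinuousWithinAt, tendsto_iff_norm_sub_tendsto_zero]
    have h1 : Filter.Tendsto (fun z => (m + 1) * ‖z - y‖) (𝓝[M.omega T] y) (𝓝 0) := by
      have : Continuous fun z : Amb n => (m + 1) * ‖z - y‖ := by fun_prop
      have h2 := this.tendsto y
      simp only [sub_self, norm_zero, mul_zero] at h2
      exact h2.mono_left nhdsWithin_le_nhds
    refine squeeze_zero' (Filter.Eventually.of_forall fun _ => norm_nonneg _) ?_ h1
    exact nhdsWithin_mono y (M.omega_subset T) (hG y hy 1 one_pos)
  have hfc : ContinuousOn (fun t => G (p t)) (Icc 0 1) := hGc.comp hpc hpω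
  -- The curve is the image of the segment from `a` to `b` and has speed at most `L h ‖b - a‖`;
  -- returning to the distance on γ costs `L / h`. This is the factor `L ^ 2`.
  have key := norm_sub_le_of_right_lipschitz (f := fun t => G (p t))
    (m := m * (L * M.h T * ‖b - a‖)) hfc ?_ 1 (right_mem_Icc.2 zero_le_one)
  · have hp0 : p 0 = M.chi T a := by simp [hp]
    have hp1 : p 1 = M.chi T b := by simp [hp]
    simp only [hp0, hp1, mul_one] at key
    refine key.trans ?_
    have h2 := A.norm_sub_le_chi hL hT hb ha
    calc m * (L * M.h T * ‖b - a‖)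
        ≤ m * (L * M.h T * (L / M.h T * ‖M.chi T b - M.chi T a‖)) := by gcongr
      _ = _ := by field_simp
  · intro t ht ε hε
    have htI : t ∈ Icc (0 : ℝ) 1 := Ico_subset_Icc_self ht
    set ℓ : ℝ := L * M.h T * ‖b - a‖ with hℓ
    have hℓ0 : 0 ≤ ℓ := by positivity
    have hε' : 0 < ε / (ℓ + 1) := by positivity
    have htend : Filter.Tendsto p (𝓝[>] t) (𝓝[γ] (p t)) := by
      refine tendsto_nhdsWithin_iff.2 ⟨?_, ?_⟩
      · refine (hpc t htI).mono_left ?_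
        refine nhdsWithin_le_iff.2 ?_
        filter_upwards [Ioo_mem_nhdsGT ht.2] with s hs
        exact ⟨ht.1.trans hs.1.le, hs.2.le⟩
      · filter_upwards [Ioo_mem_nhdsGT ht.2] with s hs
        exact M.omega_subset T (hpω s ⟨ht.1.trans hs.1.le, hs.2.le⟩)
    refine Filter.Eventually.frequently ?_
    filter_upwards [htend.eventually (hG (p t) (hpω t htI) _ hε'), Ioo_mem_nhdsGT ht.2] with s hs hst
    have hsI : s ∈ Icc (0 : ℝ) 1 := ⟨ht.1.trans hst.1.le, hst.2.le⟩
    refine hs.trans ?_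
    have h3 := hpl t htI s hsI
    have hst0 : 0 < s - t := sub_pos.2 hst.1
    rw [abs_of_pos hst0] at h3
    calc (m + ε / (ℓ + 1)) * ‖p s - p t‖ ≤ (m + ε / (ℓ + 1)) * (ℓ * (s - t)) := by gcongr
      _ = (m * ℓ + ε * (ℓ / (ℓ + 1))) * (s - t) := by ring
      _ ≤ (m * ℓ + ε) * (s - t) := by
        gcongr
        refine mul_le_of_le_one_right hε.le ?_
        rw [div_le_one (by positivity)]
        linarith

theorem normalProj_sub_le (A : M.Admissible k cbar c L C₁ C₂ δ) (hL : 1 ≤ L)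
    (hγ : IsClosedC2Hypersurface γ) {T : Fin M.card} (hT : 0 < M.h T) {y z : Amb n}
    (hy : y ∈ M.omega T) (hz : z ∈ M.omega T) (w : Amb n) :
    ‖normalProj γ z w - normalProj γ y w‖ ≤
      2 * curvatureSup γ (M.omega T) * ‖w‖ * L ^ 2 * ‖z - y‖ := by
  refine A.norm_sub_le_of_eventually hL hT (G := fun z => normalProj γ z w)
    (mul_nonneg (mul_nonneg zero_le_two (curvatureSup_nonneg _ _)) (norm_nonneg _)) ?_ hy hz
  intro p hp ε hε
  have hpγ := M.omega_subset T hp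
  have hε' : 0 < ε / (2 * (‖w‖ + 1)) := by positivity
  filter_upwards [hγ.eventually_normalProj_sub_le hpγ hε'] with q hq
  refine (hq w).trans ?_
  have h1 := hγ.maxCurvature_le_curvatureSup (M.omega_subset T) hp
  calc 2 * (maxCurvature γ p + ε / (2 * (‖w‖ + 1))) * ‖q - p‖ * ‖w‖
      = (2 * maxCurvature γ p * ‖w‖ + ε * (‖w‖ / (‖w‖ + 1))) * ‖q - p‖ := by
        field_simp
    _ ≤ _ := by
        gcongr
        refine mul_le_of_le_one_right hε.le ?_
        rw [div_le_one (by positivity)]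
        linarith

theorem curvatureSup_mul_beta_le (A : M.Admissible k cbar c L C₁ C₂ δ) (hL : 1 ≤ L)
    (T : Fin M.card) : curvatureSup γ (M.omega T) * M.beta k T ≤ δ := by
  have h1 := A.curvature_small T
  have : 0 ≤ L ^ (4 * n - 2) * M.lam k T ^ 2 := by positivity
  have : 0 ≤ L ^ 4 * (curvatureSup γ (M.omega T) * M.beta k T) ^ 2 := by positivity
  linarith

end Admissible

end ParamSurface

end SurfaceFEM

namespace SurfaceFEM

variable {n : ℕ}

/-- The constant in the estimate of the closest point projection along the approximate surface. -/
noncomputable def driftConst (n : ℕ) (cbar L : ℝ) : ℝ :=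
  12 + 8 * L ^ 2 + 4 * (cbar ^ 2 / refScale n * L)

theorem driftConst_pos (cbar : ℝ) {L : ℝ} (hL : 1 ≤ L) : 0 < driftConst n cbar L := by
  have := refScale_pos (n := n)
  unfold driftConst
  positivity

namespace ParamSurface

variable {γ : Set (Amb n)} {k : ℕ} {W : Finset (RefPatch n)} {M : ParamSurface n γ W}

namespace Admissible

variable {cbar c L C₁ C₂ δ : ℝ}

theorem tendsto_closestPoint_X (A : M.Admissible k cbar c L C₁ C₂ δ)
    (hγ : IsClosedC2Hypersurface γ) (hproj : ProjectionWellDefined γ) {T : Fin M.card} {x : Par n}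
    (hx : x ∈ refSimplex n) :
    Filter.Tendsto (fun x' => closestPoint γ (M.X k T x')) (𝓝 x)
      (𝓝[γ] (closestPoint γ (M.X k T x))) := by
  refine tendsto_nhdsWithin_iff.2 ⟨?_, Filter.Eventually.of_forall fun x' =>
    (M.isClosestPoint_X hγ k).1⟩
  exact (hproj.continuousAt hγ.1 (A.X_mem_tube hx)).tendsto.comp
    (M.contDiff_X k T).continuous.continuousAt

/-- Along an element, the closest point projection of the interpolated surface differs from the
given parametrization by a map with small pointwise Lipschitz constant. -/
theorem eventually_closestPoint_X_sub_le (A : M.Admissible k cbar c L C₁ C₂ δ) (hn : 1 ≤ n)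
    (hcbar : 0 < cbar) (hL : 1 ≤ L) (hδ : 0 < δ) (hδ' : δ ≤ 1 / 10)
    (hγ : IsClosedC2Hypersurface γ) (hproj : ProjectionWellDefined γ) {T : Fin M.card} {x : Par n}
    (hx : x ∈ refSimplex n) :
    ∀ᶠ x' in 𝓝[refSimplex n] x,
      ‖(closestPoint γ (M.X k T x') - closestPoint γ (M.X k T x)) - (M.chi T x' - M.chi T x)‖ ≤
        driftConst n cbar L * δ * ‖M.chi T x' - M.chi T x‖ := by
  have hT := A.h_pos hn hcbar T
  have hs := refScale_pos (n := n)
  have hβ := M.beta_nonneg k T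
  have hxc := refSimplex_subset_carrier (M.patch T) hx
  set p := closestPoint γ (M.X k T x) with hp
  set y := M.chi T x with hy
  have hpc : IsClosestPoint γ (M.X k T x) p := M.isClosestPoint_X hγ k
  have hpω : p ∈ M.omega T := A.mismatch T x hx
  have hyω : y ∈ M.omega T := by
    rw [omega_eq]
    exact mem_image_of_mem _ hxc
  have hyγ : y ∈ γ := M.omega_subset T hyω
  set ε : ℝ := δ / (M.beta k T + 1) with hε
  have hε0 : 0 < ε := by positivity
  have hβε : M.beta k T * ε ≤ δ := by
    rw [hε, mul_div_left_comm]
    refine mul_le_of_le_one_right hδ.le ?_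
    rw [div_le_one (by positivity)]
    linarith
  have htp := (A.tendsto_closestPoint_X hγ hproj (T := T) hx).mono_left
    (nhdsWithin_le_nhds (s := refSimplex n))
  have hty : Filter.Tendsto (M.chi T) (𝓝[refSimplex n] x) (𝓝[γ] y) := by
    refine tendsto_nhdsWithin_iff.2 ⟨?_, ?_⟩
    · exact (M.continuousOn_chi T x hxc).mono_left
        (nhdsWithin_mono x (refSimplex_subset_carrier _))
    · filter_upwards [self_mem_nhdsWithin] with x' hx'
      exact M.chi_mem T (refSimplex_subset_carrier _ hx')
  filter_upwards [htp.eventually (hγ.eventually_abs_inner_normalField_le hpc.1 hδ),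
    htp.eventually (hγ.eventually_norm_normalField_sub_le hpc.1 hε0),
    hty.eventually (hγ.eventually_abs_inner_normalField_le hyγ hδ), self_mem_nhdsWithin]
    with x' h1 h2 h3 hx'
  have hx'c := refSimplex_subset_carrier (M.patch T) hx'
  set p' := closestPoint γ (M.X k T x') with hp'
  set y' := M.chi T x' with hy'
  obtain ⟨σ, hσ, h2⟩ := h2
  have hpc' : IsClosestPoint γ (M.X k T x') p' := M.isClosestPoint_X hγ k
  set N := normalField γ p with hN
  set N' := σ • normalField γ p' with hN'
  -- The signed distances of the two surface points from γ. The sign `σ` in `N'` and `t'` makes the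
  -- two normals comparable.
  set t := ⟪normalField γ p, M.X k T x - p⟫ with ht
  set t' := σ * ⟪normalField γ p', M.X k T x' - p'⟫ with ht'
  set u := p' - p with hu
  set w := y' - y with hw
  set g := M.X k T x' - M.X k T x with hg
  have hn1 : ‖N‖ = 1 := hγ.norm_normalField hpc.1
  have hσ2 : σ * σ = 1 := by rw [← abs_mul_abs_self, hσ, one_mul]
  have e1 : M.X k T x - p = t • N := hγ.sub_eq_smul_normalField hpc
  have e2 : M.X k T x' - p' = t' • N' := by
    rw [ht', hN', smul_smul, mul_right_comm, hσ2, one_mul]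
    exact hγ.sub_eq_smul_normalField hpc'
  have hn1' : ‖N'‖ = 1 := by
    rw [hN', norm_smul, Real.norm_eq_abs, hσ, one_mul, hγ.norm_normalField hpc'.1]
  have ht'b : |t'| ≤ M.beta k T := by
    have := M.norm_X_sub_closestPoint_le hγ k (T := T) hx'
    rwa [← hp', e2, norm_smul, hn1', mul_one, Real.norm_eq_abs] at this
  -- The turning of the normal is weighted by the offset: curvature times `β_T`, the quantity
  -- assumed small. The auxiliary `ε` is scaled by `β_T + 1` so that it costs at most `δ`.
  have hNN : |t'| * ‖N' - N‖ ≤ 2 * δ * ‖u‖ := by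
    have hK : M.beta k T * maxCurvature γ p ≤ δ := by
      refine le_trans ?_ (A.curvatureSup_mul_beta_le hL T)
      rw [mul_comm]
      gcongr
      exact hγ.maxCurvature_le_curvatureSup (M.omega_subset T) hpω
    calc |t'| * ‖N' - N‖ ≤ M.beta k T * ((maxCurvature γ p + ε) * ‖u‖) := by gcongr
      _ = (M.beta k T * maxCurvature γ p + M.beta k T * ε) * ‖u‖ := by ring
      _ ≤ (δ + δ) * ‖u‖ := by gcongr
      _ = _ := by ring
  -- Subtracting the two normal decompositions: up to the turning of the normal, the increments of
  -- closest point and interpolant differ only in the direction `N`.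
  have hug : u - g = (t - t') • N - t' • (N' - N) := by
    have : u - g = (M.X k T x - p) - (M.X k T x' - p') := by rw [hu, hg]; abel
    rw [this, e1, e2, sub_smul, smul_sub]
    abel
  have htt : |t - t'| ≤ |⟪N, u⟫| + |⟪N, g⟫| + |t'| * ‖N' - N‖ := by
    have h4 : t - t' = ⟪N, u⟫ - ⟪N, g⟫ + t' * ⟪N, N' - N⟫ := by
      have h5 : ⟪N, u - g⟫ = (t - t') - t' * ⟪N, N' - N⟫ := by
        rw [hug, inner_sub_right, real_inner_smul_right, real_inner_smul_right,
          real_inner_self_eq_norm_sq, hn1]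
        ring
      rw [inner_sub_right] at h5
      linarith
    rw [h4]
    refine (abs_add_le _ _).trans (add_le_add (abs_sub _ _) ?_)
    rw [abs_mul]
    gcongr
    have := abs_real_inner_le_norm N (N' - N)
    rwa [hn1, one_mul] at this
  have hwg : ‖w - g‖ ≤ cbar ^ 2 / refScale n * L * δ * ‖w‖ := by
    have h4 := A.norm_error_sub_le hn hcbar hL (T := T) hx hx'
    have h5 := A.norm_sub_le_chi hL hT hx'c hxc
    have h6 : w - g = (M.chi T x' - M.X k T x') - (M.chi T x - M.X k T x) := by
      rw [hw, hg]; abel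
    rw [h6]
    refine h4.trans ?_
    calc cbar ^ 2 / refScale n * δ * M.h T * ‖x' - x‖
        ≤ cbar ^ 2 / refScale n * δ * M.h T * (L / M.h T * ‖w‖) := by gcongr
      _ = _ := by field_simp
  -- `w` is nearly tangent at `y`, whereas `N` is the normal at `p`. The normal projections at the
  -- two points are compared along the patch, using `‖p - y‖ ≤ 2 β_T`.
  have hNw : |⟪N, w⟫| ≤ (δ + 4 * L ^ 2 * δ) * ‖w‖ := by
    have h4 := A.normalProj_sub_le hL hγ hT hyω hpω w
    have h5 : ‖normalProj γ p w‖ ≤ ‖normalProj γ y w‖ + ‖normalProj γ p w - normalProj γ y w‖ := by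
      calc ‖normalProj γ p w‖ = ‖normalProj γ y w + (normalProj γ p w - normalProj γ y w)‖ := by
            congr 1; abel
        _ ≤ _ := norm_add_le _ _
    rw [hγ.norm_normalProj hpc.1, hγ.norm_normalProj hyγ] at h5
    have h6 : ‖p - y‖ ≤ 2 * M.beta k T := M.norm_closestPoint_X_sub_chi_le hγ k hx
    have h7 := A.curvatureSup_mul_beta_le hL T
    have hKs := curvatureSup_nonneg γ (M.omega T)
    have h8 : 2 * curvatureSup γ (M.omega T) * ‖w‖ * L ^ 2 * ‖p - y‖ ≤
        4 * L ^ 2 * δ * ‖w‖ := by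
      calc _ ≤ 2 * curvatureSup γ (M.omega T) * ‖w‖ * L ^ 2 * (2 * M.beta k T) := by gcongr
        _ = 4 * L ^ 2 * (curvatureSup γ (M.omega T) * M.beta k T) * ‖w‖ := by ring
        _ ≤ _ := by gcongr
    have h9 : |⟪normalField γ y, w⟫| ≤ δ * ‖w‖ := h3
    change |⟪N, w⟫| ≤ _ at h5
    linarith
  have hNg : |⟪N, g⟫| ≤ (δ + 4 * L ^ 2 * δ) * ‖w‖ + cbar ^ 2 / refScale n * L * δ * ‖w‖ := by
    have h4 : ⟪N, g⟫ = ⟪N, w⟫ - ⟪N, w - g⟫ := by rw [inner_sub_right N w g]; ring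
    rw [h4]
    refine (abs_sub _ _).trans (add_le_add hNw ?_)
    refine (abs_real_inner_le_norm _ _).trans ?_
    rwa [hn1, one_mul]
  have hugb : ‖u - g‖ ≤ 5 * δ * ‖u‖ + (δ + 4 * L ^ 2 * δ + cbar ^ 2 / refScale n * L * δ) * ‖w‖ := by
    rw [hug]
    refine (norm_sub_le _ _).trans ?_
    rw [norm_smul, norm_smul, hn1, mul_one, Real.norm_eq_abs, Real.norm_eq_abs]
    have h4 : |⟪N, u⟫| ≤ δ * ‖u‖ := h1
    linarith
  have huw : ‖u - w‖ ≤ ‖u - g‖ + ‖w - g‖ := by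
    calc ‖u - w‖ = ‖(u - g) - (w - g)‖ := by congr 1; abel
      _ ≤ _ := norm_sub_le _ _
  have hun : ‖u‖ ≤ ‖u - w‖ + ‖w‖ := by
    calc ‖u‖ = ‖(u - w) + w‖ := by congr 1; abel
      _ ≤ _ := norm_add_le _ _
  -- Since `δ ≤ 1 / 10`, the part with `‖u - w‖` is absorbed on the left. The resulting factor two
  -- turns `6 + 4 L² + 2 L cbar² / refScale` into `driftConst`.
  have h5 : 5 * δ * ‖u‖ ≤ 1 / 2 * ‖u - w‖ + 5 * δ * ‖w‖ := by
    calc 5 * δ * ‖u‖ ≤ 5 * δ * (‖u - w‖ + ‖w‖) := by gcongr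
      _ = 5 * δ * ‖u - w‖ + 5 * δ * ‖w‖ := by ring
      _ ≤ _ := by gcongr; linarith
  unfold driftConst
  linarith

end Admissible

end ParamSurface

end SurfaceFEM

/-! ### The map `P_d ∘ P⁻¹` is a bijection of the hypersurface -/

/-- A preconnected set is contained in every closed set which meets it and whose trace on it is
relatively open. -/
theorem IsPreconnected.subset_of_isClosed_of_mem_nhdsWithin {α : Type*} [TopologicalSpace α]
    {S C : Set α} (hS : IsPreconnected S) (hC : IsClosed C) (hne : (S ∩ C).Nonempty)
    (h : ∀ s ∈ S ∩ C, C ∈ 𝓝[S] s) : S ⊆ C := by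
  choose! U hU hsU hUC using fun s hs => mem_nhdsWithin.1 (h s hs)
  set u := ⋃ s ∈ S ∩ C, U s with hu
  have huo : IsOpen u := isOpen_biUnion fun s hs => hU s hs
  have huC : u ∩ S ⊆ C := by
    rintro x ⟨hx, hxS⟩
    obtain ⟨s, hs, hxs⟩ := mem_iUnion₂.1 hx
    exact hUC s hs ⟨hxs, hxS⟩
  have hCu : S ∩ C ⊆ u := fun x hx => mem_iUnion₂.2 ⟨x, hx, hsU x hx⟩
  rcases isPreconnected_iff_subset_of_disjoint.1 hS u Cᶜ huo hC.isOpen_compl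
    (fun x hx => by
      by_cases hxC : x ∈ C
      · exact Or.inl (hCu ⟨hx, hxC⟩)
      · exact Or.inr hxC)
    (by
      ext x
      simp only [mem_inter_iff, mem_compl_iff, mem_empty_iff_false, iff_false]
      rintro ⟨h1, h2, h3⟩
      exact h3 (huC ⟨h2, h1⟩)) with h1 | h1
  · exact fun x hx => huC ⟨h1 hx, hx⟩
  · obtain ⟨x, hx, hxC⟩ := hne
    exact absurd hxC (h1 hx)

namespace SurfaceFEM

variable {n : ℕ}

/-- The smallness conditions on the threshold `δ`, with a radius `r` adapted to the patches. -/
structure IsSmallThreshold (W : Finset (RefPatch n)) (cbar L r δ : ℝ) : Prop where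
  pos : 0 < δ
  le : δ ≤ 1 / 10
  drift : driftConst n cbar L * δ * L ^ 2 ≤ 1 / 8
  radius : L * (2 * L ^ 2 + 6) * (cbar ^ 2 / refScale n) * δ < r
  thickening : ∀ w ∈ W, Metric.cthickening r (refSimplex n) ⊆ interior w.carrier
  faces : ∀ w ∈ W, ∀ s ∈ w.simplices, ∀ J : Set (Fin (n + 1)),
    Disjoint (convexHull ℝ (s '' J)) (refSimplex n) →
      ∀ a ∈ convexHull ℝ (s '' J), ∀ x ∈ refSimplex n, r ≤ dist a x

/-- `r` depends on the finite collection of patches only, and the remaining conditions are linear in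
`δ`. The threshold is therefore chosen before the surface and its triangulation. -/
theorem exists_isSmallThreshold (W : Finset (RefPatch n)) (cbar : ℝ) {L : ℝ} (hL : 1 ≤ L) :
    ∃ r > 0, ∃ δ, IsSmallThreshold W cbar L r δ := by
  obtain ⟨r, hr, h⟩ := exists_patch_radius W
  have hs := refScale_pos (n := n)
  have hd := driftConst_pos (n := n) cbar hL
  set a := driftConst n cbar L * L ^ 2 with ha
  set b := L * (2 * L ^ 2 + 6) * (cbar ^ 2 / refScale n) with hb
  have ha0 : 0 < a := by positivity
  have hb0 : 0 ≤ b := by positivity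
  have hev : ∀ᶠ δ in 𝓝[>] (0 : ℝ), δ ≤ 1 / 10 ∧ a * δ ≤ 1 / 8 ∧ b * δ < r := by
    have hta : Filter.Tendsto (fun δ : ℝ => a * δ) (𝓝[>] 0) (𝓝 0) := by
      have : Continuous fun δ : ℝ => a * δ := by fun_prop
      simpa using (this.tendsto 0).mono_left nhdsWithin_le_nhds
    have htb : Filter.Tendsto (fun δ : ℝ => b * δ) (𝓝[>] 0) (𝓝 0) := by
      have : Continuous fun δ : ℝ => b * δ := by fun_prop
      simpa using (this.tendsto 0).mono_left nhdsWithin_le_nhds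
    filter_upwards [Ioo_mem_nhdsGT (show (0 : ℝ) < 1 / 10 by norm_num),
      hta.eventually_le_const (show (0 : ℝ) < 1 / 8 by norm_num), htb.eventually_lt_const hr]
      with δ h1 h2 h3
    exact ⟨h1.2.le, h2, h3⟩
  obtain ⟨δ, ⟨h1, h2, h3⟩, h4⟩ := (hev.and self_mem_nhdsWithin).exists
  exact ⟨r, hr, δ, h4, h1, by rw [mul_right_comm]; exact h2, h3, fun w hw => (h w hw).1,
    fun w hw => (h w hw).2⟩

namespace ParamSurface

variable {γ : Set (Amb n)} {k : ℕ} {W : Finset (RefPatch n)} (M : ParamSurface n γ W)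

open Classical in
/-- The map `P_d ∘ P⁻¹ : γ → Γ → γ`. -/
noncomputable def drift (k : ℕ) (y : Amb n) : Amb n :=
  if h : ∃ T, ∃ x ∈ refSimplex n, M.chi T x = y then
    closestPoint γ (M.X k h.choose h.choose_spec.choose) else y

/-- The parameters picked by choice in `drift` give the same point of the approximate surface, by
conformity of the interpolants. -/
theorem drift_chi (hk : 1 ≤ k) {T : Fin M.card} {x : Par n} (hx : x ∈ refSimplex n) :
    M.drift k (M.chi T x) = closestPoint γ (M.X k T x) := by
  have h : ∃ T', ∃ x' ∈ refSimplex n, M.chi T' x' = M.chi T x := ⟨T, x, hx, rfl⟩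
  rw [drift, dif_pos h]
  obtain ⟨h1, h2⟩ := h.choose_spec.choose_spec
  rw [M.X_eq_of_chi_eq hk h1 hx h2]

theorem exists_mem_elem {y : Amb n} (hy : y ∈ γ) : ∃ T, y ∈ M.elem T := by
  rw [← M.iUnion_elem, mem_iUnion] at hy
  exact hy

theorem drift_mem (hγ : IsClosedC2Hypersurface γ) (hk : 1 ≤ k) {y : Amb n} (hy : y ∈ γ) :
    M.drift k y ∈ γ := by
  obtain ⟨T, hT⟩ := M.exists_mem_elem hy
  rw [elem_eq] at hT
  obtain ⟨x, hx, rfl⟩ := hT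
  rw [M.drift_chi hk hx]
  exact (M.isClosestPoint_X hγ k).1

theorem norm_drift_sub_le (hγ : IsClosedC2Hypersurface γ) (hk : 1 ≤ k) {T : Fin M.card}
    {y : Amb n} (hy : y ∈ M.elem T) : ‖M.drift k y - y‖ ≤ 2 * M.beta k T := by
  rw [elem_eq] at hy
  obtain ⟨x, hx, rfl⟩ := hy
  rw [M.drift_chi hk hx]
  exact M.norm_closestPoint_X_sub_chi_le hγ k hx

theorem isPreconnected_omega (T : Fin M.card) : IsPreconnected (M.omega T) := by
  rw [omega_eq]
  exact (convex_carrier _).isPreconnected.image _ (M.continuousOn_chi T)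

namespace Admissible

variable {M} {cbar c L C₁ C₂ δ r : ℝ}

theorem drift_mem_omega (A : M.Admissible k cbar c L C₁ C₂ δ) (hk : 1 ≤ k) {T : Fin M.card}
    {y : Amb n} (hy : y ∈ M.elem T) : M.drift k y ∈ M.omega T := by
  rw [elem_eq] at hy
  obtain ⟨x, hx, rfl⟩ := hy
  rw [M.drift_chi hk hx]
  exact A.mismatch T x hx

/-- A point of γ near `y` shares an element with `y`, so the estimate inside that element applies.
There are finitely many elements, hence a common neighbourhood. -/
theorem eventually_drift_sub_le (A : M.Admissible k cbar c L C₁ C₂ δ) (hn : 1 ≤ n) (hk : 1 ≤ k)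
    (hcbar : 0 < cbar) (hL : 1 ≤ L) (S : IsSmallThreshold W cbar L r δ)
    (hγ : IsClosedC2Hypersurface γ) (hproj : ProjectionWellDefined γ) (y : Amb n) :
    ∀ᶠ z in 𝓝[γ] y,
      ‖(M.drift k z - M.drift k y) - (z - y)‖ ≤ driftConst n cbar L * δ * ‖z - y‖ := by
  have h : ∀ᶠ z in 𝓝 y, ∀ T, z ∈ M.elem T → y ∈ M.elem T →
      ‖(M.drift k z - M.drift k y) - (z - y)‖ ≤ driftConst n cbar L * δ * ‖z - y‖ := by
    rw [Filter.eventually_all]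
    intro T
    by_cases hy : y ∈ M.elem T
    swap
    · exact Filter.Eventually.of_forall fun _ _ h => absurd h hy
    rw [elem_eq] at hy
    obtain ⟨x, hx, rfl⟩ := hy
    have hT := A.h_pos hn hcbar T
    have hL0 : 0 < L := by linarith
    have h1 := A.eventually_closestPoint_X_sub_le hn hcbar hL S.pos S.le hγ hproj (T := T) hx
    rw [eventually_nhdsWithin_iff, Metric.eventually_nhds_iff] at h1
    obtain ⟨ρ, hρ, h1⟩ := h1
    filter_upwards [Metric.ball_mem_nhds (M.chi T x) (show 0 < ρ / (L / M.h T) by positivity)]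
      with z hz hzT _
    rw [elem_eq] at hzT
    obtain ⟨x', hx', rfl⟩ := hzT
    rw [M.drift_chi hk hx, M.drift_chi hk hx']
    refine h1 ?_ hx'
    rw [dist_eq_norm]
    refine (A.norm_sub_le_chi hL hT (refSimplex_subset_carrier _ hx')
      (refSimplex_subset_carrier _ hx)).trans_lt ?_
    rw [mem_ball_iff_norm, lt_div_iff₀' (by positivity)] at hz
    exact hz
  filter_upwards [nhdsWithin_le_nhds h, M.eventually_exists_mem_elem y] with z h1 h2
  obtain ⟨T, hzT, hyT⟩ := h2
  exact h1 T hzT hyT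

/-- The pointwise constant `driftConst * δ` is carried along patch paths at the price `L ^ 2`; `1 /
8` is the bound in `IsSmallThreshold.drift`. -/
theorem norm_drift_sub_sub_le (A : M.Admissible k cbar c L C₁ C₂ δ) (hn : 1 ≤ n) (hk : 1 ≤ k)
    (hcbar : 0 < cbar) (hL : 1 ≤ L) (S : IsSmallThreshold W cbar L r δ)
    (hγ : IsClosedC2Hypersurface γ) (hproj : ProjectionWellDefined γ) {T : Fin M.card} {y z : Amb n}
    (hy : y ∈ M.omega T) (hz : z ∈ M.omega T) :
    ‖(M.drift k z - M.drift k y) - (z - y)‖ ≤ 1 / 8 * ‖z - y‖ := by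
  have hd := driftConst_pos (n := n) cbar hL
  have hδ := S.pos
  have h := A.norm_sub_le_of_eventually hL (A.h_pos hn hcbar T) (G := fun z => M.drift k z - z)
    (m := driftConst n cbar L * δ) (by positivity) (fun y _ ε hε => by
      filter_upwards [A.eventually_drift_sub_le hn hk hcbar hL S hγ hproj y] with z hz
      rw [sub_sub_sub_comm]
      refine hz.trans ?_
      gcongr
      linarith) hy hz
  rw [sub_sub_sub_comm] at h
  exact h.trans (by gcongr; exact S.drift)

theorem continuousOn_drift (A : M.Admissible k cbar c L C₁ C₂ δ) (hn : 1 ≤ n) (hk : 1 ≤ k)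
    (hcbar : 0 < cbar) (hL : 1 ≤ L) (S : IsSmallThreshold W cbar L r δ)
    (hγ : IsClosedC2Hypersurface γ) (hproj : ProjectionWellDefined γ) :
    ContinuousOn (M.drift k) γ := by
  intro y hy
  obtain ⟨T, hT⟩ := M.exists_mem_elem hy
  have hyω := M.elem_subset_omega_self T hT
  rw [ContinuousWithinAt, tendsto_iff_norm_sub_tendsto_zero]
  have h1 : Filter.Tendsto (fun z => 9 / 8 * ‖z - y‖) (𝓝[γ] y) (𝓝 0) := by
    have : Continuous fun z : Amb n => 9 / 8 * ‖z - y‖ := by fun_prop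
    have h2 := this.tendsto y
    simp only [sub_self, norm_zero, mul_zero] at h2
    exact h2.mono_left nhdsWithin_le_nhds
  refine squeeze_zero' (Filter.Eventually.of_forall fun _ => norm_nonneg _) ?_ h1
  filter_upwards [M.omega_mem_nhdsWithin_of_mem_elem hT] with z hz
  have h2 := A.norm_drift_sub_sub_le hn hk hcbar hL S hγ hproj hyω hz
  have h3 := norm_sub_norm_le (M.drift k z - M.drift k y) (z - y)
  linarith

/-- On one macro patch the 1/8-Lipschitz bound excludes two points with equal drift, so it suffices
that `y₂` lies in the patch of `T₁`. Taking for `T₁` the element with larger `β` measures all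
displacements on its scale, and no comparison of `h_{T₁}` with `h_{T₂}` is needed. -/
theorem eq_of_drift_eq (A : M.Admissible k cbar c L C₁ C₂ δ) (hn : 1 ≤ n) (hk : 1 ≤ k)
    (hcbar : 0 < cbar) (hL : 1 ≤ L) (S : IsSmallThreshold W cbar L r δ)
    (hγ : IsClosedC2Hypersurface γ) (hproj : ProjectionWellDefined γ) {T₁ T₂ : Fin M.card}
    {y₁ y₂ : Amb n} (h₁ : y₁ ∈ M.elem T₁) (h₂ : y₂ ∈ M.elem T₂)
    (hβ : M.beta k T₂ ≤ M.beta k T₁) (heq : M.drift k y₁ = M.drift k y₂) : y₁ = y₂ := by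
  have hh₁ := A.h_pos hn hcbar T₁
  have hh₂ := A.h_pos hn hcbar T₂
  set p := M.drift k y₁ with hp
  have hp₁ : p ∈ M.omega T₁ := A.drift_mem_omega hk h₁
  have hp₂ : p ∈ M.omega T₂ := by rw [heq]; exact A.drift_mem_omega hk h₂
  have hd₁ : ‖p - y₁‖ ≤ 2 * M.beta k T₁ := M.norm_drift_sub_le hγ hk h₁
  have hd₂ : ‖p - y₂‖ ≤ 2 * M.beta k T₂ := by rw [heq]; exact M.norm_drift_sub_le hγ hk h₂
  -- A path from `p` to `y₂` in the patch of `T₂` starts in the closed set `omega T₁`. This set is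
  -- relatively open at every path point lying in it, because such points are close to the central
  -- element of `T₁`. The path therefore cannot leave.
  have hy₂ : y₂ ∈ M.omega T₁ := by
    rw [omega_eq] at hp₂
    obtain ⟨b, hb, hbp⟩ := hp₂
    rw [elem_eq] at h₁ h₂
    obtain ⟨x₁, hx₁, rfl⟩ := h₁
    obtain ⟨x₂, hx₂, rfl⟩ := h₂
    have hx₁c := refSimplex_subset_carrier (M.patch T₁) hx₁
    have hx₂c := refSimplex_subset_carrier (M.patch T₂) hx₂
    have hseg : segment ℝ b x₂ ⊆ (M.patch T₂).carrier := (convex_carrier _).segment_subset hb hx₂c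
    have hsub : M.chi T₂ '' segment ℝ b x₂ ⊆ M.omega T₁ := by
      refine IsPreconnected.subset_of_isClosed_of_mem_nhdsWithin
        ((convex_segment b x₂).isPreconnected.image _ ((M.continuousOn_chi T₂).mono hseg))
        (M.isCompact_omega T₁).isClosed ⟨p, ?_, hp₁⟩ ?_
      · rw [← hbp]
        exact mem_image_of_mem _ (left_mem_segment ℝ b x₂)
      · rintro s ⟨hs, hsω⟩
        obtain ⟨e, he, rfl⟩ := hs
        rw [omega_eq] at hsω
        obtain ⟨a, ha, has⟩ := hsω
        have hγs : M.chi T₂ '' segment ℝ b x₂ ⊆ γ := by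
          rintro _ ⟨e, he, rfl⟩
          exact M.chi_mem T₂ (hseg he)
        refine nhdsWithin_mono _ hγs ?_
        rw [← has]
        refine M.omega_mem_nhdsWithin (S.faces _ (M.patch_mem T₁)) ha hx₁ ?_
        -- The whole segment is at most as long as the distance of its ends, whose images `p` and
        -- `y₂` are `2 β_{T₂}` apart; passing through the chart and back costs `L ^ 2`.
        have k1 : ‖M.chi T₂ e - p‖ ≤ L ^ 2 * (2 * M.beta k T₂) := by
          have j1 : ‖e - b‖ ≤ ‖x₂ - b‖ := by
            obtain ⟨t, ht, rfl⟩ := (segment_eq_image' ℝ b x₂ ▸ he)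
            rw [add_sub_cancel_left, norm_smul, Real.norm_of_nonneg ht.1]
            exact mul_le_of_le_one_left (norm_nonneg _) ht.2
          have j2 := A.norm_sub_le_chi hL hh₂ hx₂c hb
          rw [← hbp]
          refine (A.norm_chi_sub_le (hseg he) hb).trans ?_
          rw [← hbp, norm_sub_rev] at hd₂
          calc L * M.h T₂ * ‖e - b‖ ≤ L * M.h T₂ * (L / M.h T₂ * (2 * M.beta k T₂)) := by
                gcongr
                exact j1.trans (j2.trans (by gcongr))
            _ = _ := by field_simp
        have k2 : ‖a - x₁‖ ≤ L / M.h T₁ * ‖M.chi T₁ a - M.chi T₁ x₁‖ :=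
          A.norm_sub_le_chi hL hh₁ ha hx₁c
        have k3 : ‖M.chi T₁ a - M.chi T₁ x₁‖ ≤ (2 * L ^ 2 + 2) * M.beta k T₁ := by
          rw [has]
          calc ‖M.chi T₂ e - M.chi T₁ x₁‖ = ‖(M.chi T₂ e - p) + (p - M.chi T₁ x₁)‖ := by
                congr 1; abel
            _ ≤ L ^ 2 * (2 * M.beta k T₂) + 2 * M.beta k T₁ :=
              (norm_add_le _ _).trans (add_le_add k1 hd₁)
            _ ≤ L ^ 2 * (2 * M.beta k T₁) + 2 * M.beta k T₁ := by gcongr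
            _ = _ := by ring
        have k4 := A.beta_le_h hn hk hcbar hL S.pos T₁
        have hs := refScale_pos (n := n)
        have hδ := S.pos
        rw [dist_eq_norm]
        -- As `β_{T₁} / h_{T₁}` is of order `δ`, the point `a` is within `r` of the reference
        -- simplex; this uses the `2 * L ^ 2 + 2` contained in the `radius` condition.
        refine lt_of_le_of_lt ?_ S.radius
        calc ‖a - x₁‖ ≤ L / M.h T₁ * ((2 * L ^ 2 + 2) *
                (cbar ^ 2 / refScale n * δ * M.h T₁)) := k2.trans (by gcongr; exact k3.trans (by gcongr))
          _ = L * (2 * L ^ 2 + 2) * (cbar ^ 2 / refScale n) * δ := by field_simp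
          _ ≤ _ := by gcongr; norm_num
    exact hsub (mem_image_of_mem _ (right_mem_segment ℝ b x₂))
  have h := A.norm_drift_sub_sub_le hn hk hcbar hL S hγ hproj (M.elem_subset_omega_self T₁ h₁) hy₂
  rw [← heq, ← hp, sub_self, zero_sub, norm_neg] at h
  have h0 : ‖y₂ - y₁‖ ≤ 0 := by linarith [norm_nonneg (y₂ - y₁)]
  exact (sub_eq_zero.1 (norm_le_zero_iff.1 h0)).symm

theorem injOn_drift (A : M.Admissible k cbar c L C₁ C₂ δ) (hn : 1 ≤ n) (hk : 1 ≤ k)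
    (hcbar : 0 < cbar) (hL : 1 ≤ L) (S : IsSmallThreshold W cbar L r δ)
    (hγ : IsClosedC2Hypersurface γ) (hproj : ProjectionWellDefined γ) :
    InjOn (M.drift k) γ := by
  intro y₁ hy₁ y₂ hy₂ h
  obtain ⟨T₁, hT₁⟩ := M.exists_mem_elem hy₁
  obtain ⟨T₂, hT₂⟩ := M.exists_mem_elem hy₂
  rcases le_total (M.beta k T₂) (M.beta k T₁) with hβ | hβ
  · exact A.eq_of_drift_eq hn hk hcbar hL S hγ hproj hT₁ hT₂ hβ h
  · exact (A.eq_of_drift_eq hn hk hcbar hL S hγ hproj hT₂ hT₁ hβ h.symm).symm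

theorem norm_closestPoint_X_sub_le (A : M.Admissible k cbar c L C₁ C₂ δ) (hn : 1 ≤ n) (hk : 1 ≤ k)
    (hcbar : 0 < cbar) (hL : 1 ≤ L) (S : IsSmallThreshold W cbar L r δ)
    (hγ : IsClosedC2Hypersurface γ) (hproj : ProjectionWellDefined γ) {T : Fin M.card} {x y : Par n}
    (hx : x ∈ refSimplex n) (hy : y ∈ refSimplex n) :
    ‖closestPoint γ (M.X k T y) - closestPoint γ (M.X k T x)‖ ≤ 2 * L * M.h T * ‖y - x‖ := by
  have hT := A.h_pos hn hcbar T
  have h := A.norm_drift_sub_sub_le hn hk hcbar hL S hγ hproj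
    (M.elem_subset_omega_self T (M.chi_mem_elem hx)) (M.elem_subset_omega_self T (M.chi_mem_elem hy))
  rw [M.drift_chi hk hx, M.drift_chi hk hy] at h
  have h2 := norm_sub_norm_le (closestPoint γ (M.X k T y) - closestPoint γ (M.X k T x))
    (M.chi T y - M.chi T x)
  have h3 := A.norm_chi_sub_le (refSimplex_subset_carrier (M.patch T) hy)
    (refSimplex_subset_carrier (M.patch T) hx)
  have h4 : 0 ≤ L * M.h T * ‖y - x‖ := by positivity
  linarith

/-- The image of the map `P_d ∘ P⁻¹` is relatively open. -/
theorem image_drift_mem_nhdsWithin (A : M.Admissible k cbar c L C₁ C₂ δ) (hn : 1 ≤ n) (hk : 1 ≤ k)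
    (hcbar : 0 < cbar) (hL : 1 ≤ L) (S : IsSmallThreshold W cbar L r δ)
    (hγ : IsClosedC2Hypersurface γ) (hproj : ProjectionWellDefined γ) {y₀ : Amb n} (hy₀ : y₀ ∈ γ) :
    M.drift k '' γ ∈ 𝓝[γ] (M.drift k y₀) := by
  obtain ⟨T, hT⟩ := M.exists_mem_elem hy₀
  have hy₀ω := M.elem_subset_omega_self T hT
  have hhT := A.h_pos hn hcbar T
  set F := M.drift k with hF
  set p₀ := F y₀ with hp₀
  have hp₀ω : p₀ ∈ M.omega T := A.drift_mem_omega hk hT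
  have hp₀γ := M.omega_subset T hp₀ω
  obtain ⟨ρ₃, hρ₃, hsec⟩ := hγ.exists_forall_abs_inner_sub_le hp₀γ (show (0 : ℝ) < 1 / 8 by norm_num)
  have hev : ∀ᶠ q in 𝓝[γ] y₀, q ∈ M.omega T ∧
      ∀ w, ‖normalProj γ q w - normalProj γ y₀ w‖ ≤ 1 / 8 * ‖w‖ := by
    have hKpos : 0 < 2 * (maxCurvature γ y₀ + 1) := by
      have := maxCurvature_nonneg γ y₀
      positivity
    filter_upwards [M.omega_mem_nhdsWithin_of_mem_elem hT,
      hγ.eventually_normalProj_sub_le hy₀ one_pos,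
      nhdsWithin_le_nhds (Metric.ball_mem_nhds y₀
        (show 0 < 1 / 8 / (2 * (maxCurvature γ y₀ + 1)) by positivity))] with q h1 h2 h3
    refine ⟨h1, fun w => (h2 w).trans ?_⟩
    gcongr
    rw [mem_ball_iff_norm, lt_div_iff₀' hKpos] at h3
    exact h3.le
  rw [eventually_nhdsWithin_iff, Metric.eventually_nhds_iff] at hev
  obtain ⟨ρ₁, hρ₁, hev⟩ := hev
  -- Small enough for the normals on `B` to be close to the one at `y₀`, and for `z` and `F y` to
  -- lie where secants are nearly orthogonal to the normal at `p₀`.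
  set ρ := min ρ₁ ρ₃ / 2 with hρ
  have hρ0 : 0 < ρ := by positivity
  have hρρ₁ : ρ < ρ₁ := by
    have := min_le_left ρ₁ ρ₃
    rw [hρ]; linarith
  have hρρ₃ : 2 * ρ ≤ ρ₃ := by
    have := min_le_right ρ₁ ρ₃
    rw [hρ]; linarith
  set B := γ ∩ Metric.closedBall y₀ ρ with hB
  have hBc : IsCompact B := hγ.1.inter_right Metric.isClosed_closedBall
  have hBω : ∀ y ∈ B, y ∈ M.omega T ∧
      ∀ w, ‖normalProj γ y w - normalProj γ y₀ w‖ ≤ 1 / 8 * ‖w‖ := fun y hy =>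
    hev ((Metric.mem_closedBall.1 hy.2).trans_lt hρρ₁) hy.1
  have hlip : ∀ y ∈ B, ‖(F y - p₀) - (y - y₀)‖ ≤ 1 / 8 * ‖y - y₀‖ := fun y hy =>
    A.norm_drift_sub_sub_le hn hk hcbar hL S hγ hproj hy₀ω (hBω y hy).1
  rw [mem_nhdsWithin_iff_exists_mem_nhds_inter]
  refine ⟨Metric.ball p₀ (ρ / 4), Metric.ball_mem_nhds _ (by positivity), ?_⟩
  rintro z ⟨hz, hzγ⟩
  -- A variational replacement for the inverse function theorem: choose `y` so that `F y` is nearest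
  -- to `z`. If `d = z - F y` were nonzero, moving `y` along γ in the tangential direction closest
  -- to `d` would bring `F y` nearer to `z`.
  obtain ⟨y, hyB, hmin⟩ := hBc.exists_isMinOn ⟨y₀, hy₀, Metric.mem_closedBall_self hρ0.le⟩
    (f := fun y => ‖z - F y‖) ((continuousOn_const.sub
      ((A.continuousOn_drift hn hk hcbar hL S hγ hproj).mono inter_subset_left)).norm)
  have hmin' : ∀ y' ∈ B, ‖z - F y‖ ≤ ‖z - F y'‖ := fun y' hy' => hmin hy'
  refine ⟨y, hyB.1, ?_⟩
  by_contra hne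
  have hzp : ‖z - p₀‖ < ρ / 4 := mem_ball_iff_norm.1 hz
  set d := z - F y with hd
  have hD : 0 < ‖d‖ := norm_pos_iff.2 (sub_ne_zero.2 (Ne.symm hne))
  have hdρ : ‖d‖ < ρ / 4 := (hmin' y₀ ⟨hy₀, Metric.mem_closedBall_self hρ0.le⟩).trans_lt hzp
  have hFp : ‖F y - p₀‖ < ρ / 2 := by
    calc ‖F y - p₀‖ = ‖(z - p₀) - d‖ := by rw [hd]; congr 1; abel
      _ ≤ ‖z - p₀‖ + ‖d‖ := norm_sub_le _ _
      _ < _ := by linarith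
  -- The minimizer is interior to the ball, so short curves through `y` remain admissible.
  have hyy₀ : ‖y - y₀‖ < ρ := by
    have h1 := hlip y hyB
    have h2 := norm_sub_norm_le (y - y₀) (F y - p₀)
    rw [norm_sub_rev (y - y₀) (F y - p₀)] at h2
    linarith
  -- the secant `d` is nearly tangent at `y`
  have hQ : ‖normalProj γ y d‖ ≤ 3 / 8 * ‖d‖ := by
    have h1 : ‖normalProj γ p₀ d‖ ≤ 1 / 8 * ‖d‖ := by
      rw [hγ.norm_normalProj hp₀γ]
      refine hsec z hzγ (F y) (M.drift_mem hγ hk hyB.1) ?_ ?_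
      · rw [dist_eq_norm]; linarith
      · rw [dist_eq_norm]; linarith
    have h2 : ‖normalProj γ p₀ d - normalProj γ y₀ d‖ ≤ 1 / 8 * ‖d‖ := by
      have h3 := A.normalProj_sub_le hL hγ hhT hy₀ω hp₀ω d
      have h4 := A.curvatureSup_mul_beta_le hL T
      have h5 : ‖p₀ - y₀‖ ≤ 2 * M.beta k T := M.norm_drift_sub_le hγ hk hT
      have hKs := curvatureSup_nonneg γ (M.omega T)
      have h6 : 4 * L ^ 2 * δ ≤ 1 / 8 := by
        refine le_trans ?_ S.drift
        have hs := refScale_pos (n := n)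
        have hδ := S.pos
        have : (4 : ℝ) ≤ driftConst n cbar L := by
          unfold driftConst
          have h7 : 0 ≤ 8 * L ^ 2 + 4 * (cbar ^ 2 / refScale n * L) := by positivity
          linarith
        calc 4 * L ^ 2 * δ = 4 * δ * L ^ 2 := by ring
          _ ≤ _ := by gcongr
      calc _ ≤ 2 * curvatureSup γ (M.omega T) * ‖d‖ * L ^ 2 * (2 * M.beta k T) :=
            h3.trans (by gcongr)
        _ = 4 * L ^ 2 * (curvatureSup γ (M.omega T) * M.beta k T) * ‖d‖ := by ring
        _ ≤ 4 * L ^ 2 * δ * ‖d‖ := by gcongr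
        _ ≤ _ := by gcongr
    have h3 := (hBω y hyB).2 d
    calc ‖normalProj γ y d‖ = ‖normalProj γ p₀ d - (normalProj γ p₀ d - normalProj γ y₀ d) +
          (normalProj γ y d - normalProj γ y₀ d)‖ := by congr 1; abel
      _ ≤ ‖normalProj γ p₀ d‖ + ‖normalProj γ p₀ d - normalProj γ y₀ d‖ +
          ‖normalProj γ y d - normalProj γ y₀ d‖ :=
        (norm_add_le _ _).trans (add_le_add (norm_sub_le _ _) le_rfl)
      _ ≤ _ := by linarith
  -- The tangential part of `d` at `y`; it misses at most three eighths of `d`, and `F` nearly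
  -- preserves small displacements.
  set τ := d - normalProj γ y d with hτ
  have hτn : ‖τ‖ ≤ 11 / 8 * ‖d‖ := (norm_sub_le _ _).trans (by linarith)
  obtain ⟨cv, hc0, hcd, hcγ⟩ := hγ.exists_curve hyB.1 (hγ.inner_normalField_sub_normalProj hyB.1 d)
  have hcc : Filter.Tendsto cv (𝓝 0) (𝓝 y) := by
    have := hcd.continuousAt.tendsto
    rwa [hc0] at this
  have hev1 : ∀ᶠ s in 𝓝 (0 : ℝ), ‖cv s - y - s • τ‖ ≤ ‖d‖ / 16 * ‖s‖ := by
    have h1 := (hasDerivAt_iff_isLittleO_nhds_zero.1 hcd).bound (show 0 < ‖d‖ / 16 by positivity)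
    simpa [hc0] using h1
  have hev2 : ∀ᶠ s in 𝓝 (0 : ℝ), ‖(F (cv s) - F y) - (cv s - y)‖ ≤
      driftConst n cbar L * δ * ‖cv s - y‖ :=
    (tendsto_nhdsWithin_iff.2 ⟨hcc, hcγ⟩).eventually
      (A.eventually_drift_sub_le hn hk hcbar hL S hγ hproj y)
  have hev3 : ∀ᶠ s in 𝓝 (0 : ℝ), cv s ∈ Metric.closedBall y₀ ρ := by
    refine hcc.eventually (Metric.closedBall_mem_nhds_of_mem ?_)
    rwa [mem_ball_iff_norm]
  obtain ⟨s, ⟨⟨h1, h2⟩, h3⟩, h4, h5⟩ := ((((hev1.and hev2).and (hev3.and hcγ)).filter_mono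
    nhdsWithin_le_nhds).and (Ioo_mem_nhdsGT (zero_lt_one (α := ℝ)))).exists
  have hδ8 : driftConst n cbar L * δ ≤ 1 / 8 := by
    refine le_trans ?_ S.drift
    have := driftConst_pos (n := n) cbar hL
    have hδ := S.pos
    exact le_mul_of_one_le_right (by positivity) (one_le_pow₀ hL)
  have hs0 : 0 < s := h4
  rw [Real.norm_of_nonneg hs0.le] at h1
  have hcs : ‖cv s - y‖ ≤ 23 / 16 * (s * ‖d‖) := by
    calc ‖cv s - y‖ = ‖(cv s - y - s • τ) + s • τ‖ := by congr 1; abel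
      _ ≤ ‖d‖ / 16 * s + s * (11 / 8 * ‖d‖) := by
        refine (norm_add_le _ _).trans (add_le_add h1 ?_)
        rw [norm_smul, Real.norm_of_nonneg hs0.le]
        gcongr
      _ = _ := by ring
  have hdev : ‖(F (cv s) - F y) - s • τ‖ ≤ 1 / 4 * (s * ‖d‖) := by
    calc ‖(F (cv s) - F y) - s • τ‖
        = ‖((F (cv s) - F y) - (cv s - y)) + (cv s - y - s • τ)‖ := by congr 1; abel
      _ ≤ 1 / 8 * (23 / 16 * (s * ‖d‖)) + ‖d‖ / 16 * s := by
        refine (norm_add_le _ _).trans (add_le_add (h2.trans ?_) h1)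
        gcongr
      _ ≤ _ := by
        have : 0 < s * ‖d‖ := by positivity
        linarith
  have hdτ : ‖d - s • τ‖ ≤ (1 - s) * ‖d‖ + s * (3 / 8 * ‖d‖) := by
    have h6 : d - s • τ = (1 - s) • d + s • normalProj γ y d := by
      rw [hτ, smul_sub, sub_smul, one_smul]
      abel
    rw [h6]
    refine (norm_add_le _ _).trans ?_
    rw [norm_smul, norm_smul, Real.norm_of_nonneg hs0.le, Real.norm_of_nonneg (by linarith [h5])]
    gcongr
  -- Minimality at the competitor `cv s` gives `1 ≤ (1 - s) + 3 s / 8 + s / 4` after division by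
  -- `‖d‖`, which is false for `s > 0`.
  have hfin : ‖d‖ ≤ ‖d - s • τ‖ + ‖(F (cv s) - F y) - s • τ‖ := by
    refine (hmin' (cv s) ⟨h3.2, h3.1⟩).trans ?_
    calc ‖z - F (cv s)‖ = ‖(d - s • τ) - ((F (cv s) - F y) - s • τ)‖ := by
          rw [hd]; congr 1; abel
      _ ≤ _ := norm_sub_le _ _
  have : 0 < s * ‖d‖ := by positivity
  linarith

/-- The image is compact and relatively open. It meets the connected patch of any element containing
`z`, namely in the drift of `z`, hence contains that patch. -/
theorem image_drift (A : M.Admissible k cbar c L C₁ C₂ δ) (hn : 1 ≤ n) (hk : 1 ≤ k)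
    (hcbar : 0 < cbar) (hL : 1 ≤ L) (S : IsSmallThreshold W cbar L r δ)
    (hγ : IsClosedC2Hypersurface γ) (hproj : ProjectionWellDefined γ) :
    M.drift k '' γ = γ := by
  refine Subset.antisymm ?_ ?_
  · rintro _ ⟨y, hy, rfl⟩
    exact M.drift_mem hγ hk hy
  · intro z hz
    obtain ⟨T, hT⟩ := M.exists_mem_elem hz
    have hcl : IsClosed (M.drift k '' γ) := (hγ.1.image_of_continuousOn
      (A.continuousOn_drift hn hk hcbar hL S hγ hproj)).isClosed
    refine (M.isPreconnected_omega T).subset_of_isClosed_of_mem_nhdsWithin hcl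
      ⟨M.drift k z, A.drift_mem_omega hk hT, mem_image_of_mem _ hz⟩ ?_
      (M.elem_subset_omega_self T hT)
    rintro _ ⟨-, y, hy, rfl⟩
    exact nhdsWithin_mono _ (M.omega_subset T)
      (A.image_drift_mem_nhdsWithin hn hk hcbar hL S hγ hproj hy)

end Admissible

end ParamSurface

end SurfaceFEM

/-! ### Two parametrizations of the surface measure -/

namespace SurfaceFEM

variable {n : ℕ} {γ : Set (Amb n)}

/-- The surface measure on a parametrized piece is the push-forward of the area element. -/
theorem IsSurfaceMeasureOn.map_withDensity_areaElement {ν : Measure (Amb n)}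
    (hν : IsSurfaceMeasureOn γ univ ν) {S : Set (Par n)} (hS : MeasurableSet S)
    {Y : Par n → Amb n} {K : NNReal} (hY : LipschitzOnWith K Y S) (hinj : InjOn Y S)
    (hYγ : MapsTo Y S γ)
    (hae : ∀ᵐ x ∂volume.restrict S, DifferentiableAt ℝ Y x ∧ ∀ᶠ z in 𝓝 x, Y z ∈ γ) :
    Measure.map Y ((volume.restrict S).withDensity fun x => ENNReal.ofReal (areaElement Y x)) =
      ν.restrict (Y '' S) := by
  -- The area formula is available on this set only; its complement in `S` is null by hypothesis and
  -- has a null image by `image_null`.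
  set G : Set (Par n) := {x | DifferentiableAt ℝ Y x} ∩ {x | ∀ᶠ z in 𝓝 x, Y z ∈ γ} with hG
  have hGm : MeasurableSet G :=
    (measurableSet_of_differentiableAt ℝ Y).inter isOpen_setOfPred_eventually_nhds.measurableSet
  have hnull : volume (S \ G) = 0 := by
    rw [ae_restrict_iff' hS, ae_iff] at hae
    refine measure_mono_null ?_ hae
    rintro x ⟨hxS, hxG⟩
    rw [mem_ofPred_eq, Classical.not_imp]
    exact ⟨hxS, hxG⟩
  have haeY : AEMeasurable Y (volume.restrict S) := hY.continuousOn.aemeasurable hS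
  have hdm : Measurable fun x => ENNReal.ofReal (areaElement Y x) :=
    (measurable_areaElement Y).ennreal_ofReal
  refine Measure.ext_of_lintegral _ fun f hf => ?_
  rw [lintegral_map' hf.aemeasurable (haeY.mono_ac (withDensity_absolutelyContinuous _ _)),
    lintegral_withDensity_eq_lintegral_mul₀ hdm.aemeasurable
      (g := fun x => f (Y x)) (hf.comp_aemeasurable haeY)]
  have h1 : (S ∩ G : Set (Par n)) =ᵐ[volume] S := by
    refine Filter.EventuallyLE.antisymm (inter_subset_left.eventuallyLE) ?_
    rw [ae_le_set, sdiff_self_inter]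
    exact hnull
  have h2 : (Y '' (S ∩ G) : Set (Amb n)) =ᵐ[ν] Y '' S := by
    refine Filter.EventuallyLE.antisymm ((image_mono inter_subset_left).eventuallyLE) ?_
    rw [ae_le_set]
    refine measure_mono_null ?_ (hν.image_null (S \ G) Y K hnull (hY.mono sdiff_subset)
      fun x hx => ⟨hYγ hx.1, mem_univ _⟩)
    rintro _ ⟨⟨x, hx, rfl⟩, hx'⟩
    exact ⟨x, ⟨hx, fun hxG => hx' ⟨x, ⟨hx, hxG⟩, rfl⟩⟩, rfl⟩
  rw [← setLIntegral_congr h1, ← setLIntegral_congr h2,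
    hν.setLIntegral_image (S ∩ G) Y (hS.inter hGm) (hinj.mono inter_subset_left)
      (fun x hx => hx.2) (fun _ _ => mem_univ _) f hf]
  refine lintegral_congr fun x => ?_
  simp only [Pi.mul_apply]
  rw [mul_comm]

namespace ParamSurface

variable {k : ℕ} {W : Finset (RefPatch n)} {M : ParamSurface n γ W}

namespace Admissible

variable {cbar c L C₁ C₂ δ r : ℝ}

theorem ae_differentiableAt_chi (A : M.Admissible k cbar c L C₁ C₂ δ) (hL : 1 ≤ L)
    {T : Fin M.card} (hT : 0 < M.h T) :
    ∀ᵐ x ∂volume.restrict (interior (M.patch T).carrier), DifferentiableAt ℝ (M.chi T) x := by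
  have h := ((A.lipschitzOnWith_chi hL hT).mono interior_subset).ae_differentiableWithinAt
    (μ := volume) isOpen_interior.measurableSet
  filter_upwards [h, ae_restrict_mem isOpen_interior.measurableSet] with x hx hxi
  exact hx.differentiableAt (isOpen_interior.mem_nhds hxi)

theorem eventually_chi_mem {T : Fin M.card} {x : Par n} (hx : x ∈ interior (M.patch T).carrier) :
    ∀ᶠ z in 𝓝 x, M.chi T z ∈ γ := by
  filter_upwards [isOpen_interior.mem_nhds hx] with z hz
  exact M.chi_mem T (interior_subset hz)

theorem map_chi_withDensity (A : M.Admissible k cbar c L C₁ C₂ δ) (hL : 1 ≤ L)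
    {ν : Measure (Amb n)} (hν : IsSurfaceMeasureOn γ univ ν) {T : Fin M.card} (hT : 0 < M.h T)
    {S : Set (Par n)} (hS : MeasurableSet S) (hSi : S ⊆ interior (M.patch T).carrier) :
    Measure.map (M.chi T) ((volume.restrict S).withDensity fun x => ENNReal.ofReal (M.q T x)) =
      ν.restrict (M.chi T '' S) := by
  have hSc := hSi.trans interior_subset
  refine hν.map_withDensity_areaElement hS ((A.lipschitzOnWith_chi hL hT).mono hSc)
    ((A.injOn_chi hL hT).mono hSc) (fun x hx => M.chi_mem T (hSc hx)) ?_
  filter_upwards [ae_restrict_of_ae_restrict_of_subset hSi (A.ae_differentiableAt_chi hL hT),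
    ae_restrict_mem hS] with x hx hxS
  exact ⟨hx, eventually_chi_mem (hSi hxS)⟩

theorem norm_fderiv_chi_le (A : M.Admissible k cbar c L C₁ C₂ δ) (hL : 1 ≤ L) {T : Fin M.card}
    (hT : 0 < M.h T) {x : Par n} (hxi : x ∈ interior (M.patch T).carrier) :
    ‖fderiv ℝ (M.chi T) x‖ ≤ L * M.h T := by
  have h2 := norm_fderiv_le_of_lipschitzOn ℝ (mem_interior_iff_mem_nhds.1 hxi)
    (A.lipschitzOnWith_chi hL hT)
  rwa [Real.coe_toNNReal _ (by positivity)] at h2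

/-- The area element of `γ` is comparable to the element scale. -/
theorem ae_q_bounds (A : M.Admissible k cbar c L C₁ C₂ δ) (hL : 1 ≤ L) {T : Fin M.card}
    (hT : 0 < M.h T) :
    ∀ᵐ x ∂volume.restrict (interior (M.patch T).carrier),
      (M.h T / L) ^ n ≤ M.q T x ∧ M.q T x ≤ (L * M.h T) ^ n := by
  filter_upwards [A.ae_differentiableAt_chi hL hT, ae_restrict_mem isOpen_interior.measurableSet]
    with x hx hxi
  have hL0 : 0 < L := by linarith
  have hfr : Module.finrank ℝ (Par n) = n := by simp
  -- The lower bi-Lipschitz bound passes to one-sided difference quotients and survives in the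
  -- derivative.
  have hlow : ∀ w, M.h T / L * ‖w‖ ≤ ‖fderiv ℝ (M.chi T) x w‖ := by
    intro w
    have hd := hx.hasFDerivAt.hasLineDerivAt w
    have h1 := hd.tendsto_slope_zero_right
    have h2 := h1.norm
    refine ge_of_tendsto h2 ?_
    have hev : ∀ᶠ t in 𝓝[>] (0 : ℝ), x + t • w ∈ (M.patch T).carrier := by
      have : Filter.Tendsto (fun t : ℝ => x + t • w) (𝓝 0) (𝓝 x) := by
        have h3 : Continuous fun t : ℝ => x + t • w := by fun_prop
        simpa using h3.tendsto 0
      exact nhdsWithin_le_nhds (this.eventually (mem_interior_iff_mem_nhds.1 hxi))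
    filter_upwards [hev, self_mem_nhdsWithin] with t ht ht0
    have ht0' : (0 : ℝ) < t := ht0
    have h3 := (A.biLipschitz_patch T _ ht x (interior_subset hxi)).1
    rw [add_sub_cancel_left, norm_smul, Real.norm_of_nonneg ht0'.le] at h3
    rw [norm_smul, norm_inv, Real.norm_of_nonneg ht0'.le]
    calc M.h T / L * ‖w‖ = t⁻¹ * (M.h T * L⁻¹ * (t * ‖w‖)) := by field_simp
      _ ≤ _ := by gcongr
  have hup := A.norm_fderiv_chi_le hL hT hxi
  rw [q, areaElement_eq_normDet]
  constructor
  · have := LinearMap.le_normDet_of_bound (fderiv ℝ (M.chi T) x).toLinearMap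
      (m := M.h T / L) (by positivity) hlow
    rwa [hfr] at this
  · have := LinearMap.normDet_le_of_bound (fderiv ℝ (M.chi T) x).toLinearMap
      (m := L * M.h T) fun w => ((fderiv ℝ (M.chi T) x).le_opNorm w).trans (by gcongr)
    rwa [hfr] at this

theorem injOn_closestPoint_X (A : M.Admissible k cbar c L C₁ C₂ δ) (hn : 1 ≤ n) (hk : 1 ≤ k)
    (hcbar : 0 < cbar) (hL : 1 ≤ L) (S : IsSmallThreshold W cbar L r δ)
    (hγ : IsClosedC2Hypersurface γ) (hproj : ProjectionWellDefined γ) (T : Fin M.card) :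
    InjOn (fun x => closestPoint γ (M.X k T x)) (refSimplex n) := by
  intro x hx y hy hxy
  have hx' := refSimplex_subset_carrier (M.patch T) hx
  have hy' := refSimplex_subset_carrier (M.patch T) hy
  simp only [← M.drift_chi hk hx, ← M.drift_chi hk hy] at hxy
  exact A.injOn_chi hL (A.h_pos hn hcbar T) hx' hy'
    (A.injOn_drift hn hk hcbar hL S hγ hproj (M.chi_mem T hx') (M.chi_mem T hy') hxy)

theorem lipschitzOnWith_closestPoint_X (A : M.Admissible k cbar c L C₁ C₂ δ) (hn : 1 ≤ n)
    (hk : 1 ≤ k) (hcbar : 0 < cbar) (hL : 1 ≤ L) (S : IsSmallThreshold W cbar L r δ)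
    (hγ : IsClosedC2Hypersurface γ) (hproj : ProjectionWellDefined γ) (T : Fin M.card) :
    LipschitzOnWith (2 * L * M.h T).toNNReal (fun x => closestPoint γ (M.X k T x))
      (refSimplex n) := by
  have hT := A.h_pos hn hcbar T
  refine LipschitzOnWith.of_dist_le_mul fun x hx y hy => ?_
  rw [dist_eq_norm, dist_eq_norm, Real.coe_toNNReal _ (by positivity)]
  exact A.norm_closestPoint_X_sub_le hn hk hcbar hL S hγ hproj hy hx

theorem restrict_interior_refSimplex :
    (volume : Measure (Par n)).restrict (interior (refSimplex n)) = volume.restrict (refSimplex n) :=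
  Measure.restrict_congr_set (interior_ae_eq_of_null_frontier volume_frontier_refSimplex)

theorem map_closestPoint_X_withDensity (A : M.Admissible k cbar c L C₁ C₂ δ) (hn : 1 ≤ n)
    (hk : 1 ≤ k) (hcbar : 0 < cbar) (hL : 1 ≤ L) (Sm : IsSmallThreshold W cbar L r δ)
    (hγ : IsClosedC2Hypersurface γ) (hproj : ProjectionWellDefined γ)
    {ν : Measure (Amb n)} (hν : IsSurfaceMeasureOn γ univ ν) (T : Fin M.card)
    {S : Set (Par n)} (hS : MeasurableSet S) (hST : S ⊆ refSimplex n) :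
    Measure.map (fun x => closestPoint γ (M.X k T x))
      ((volume.restrict S).withDensity fun x => ENNReal.ofReal (M.qd k T x)) =
      ν.restrict ((fun x => closestPoint γ (M.X k T x)) '' S) := by
  have hlip := A.lipschitzOnWith_closestPoint_X hn hk hcbar hL Sm hγ hproj T
  refine hν.map_withDensity_areaElement hS (hlip.mono hST)
    ((A.injOn_closestPoint_X hn hk hcbar hL Sm hγ hproj T).mono hST)
    (fun x _ => (M.isClosestPoint_X hγ k).1) ?_
  have h := (hlip.mono interior_subset).ae_differentiableWithinAt
    (μ := volume) isOpen_interior.measurableSet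
  have h2 : ∀ᵐ x ∂volume.restrict (refSimplex n),
      DifferentiableAt ℝ (fun x => closestPoint γ (M.X k T x)) x := by
    rw [← restrict_interior_refSimplex]
    filter_upwards [h, ae_restrict_mem isOpen_interior.measurableSet] with x hx hxi
    exact hx.differentiableAt (isOpen_interior.mem_nhds hxi)
  filter_upwards [ae_restrict_of_ae_restrict_of_subset hST h2] with x hx
  exact ⟨hx, Filter.Eventually.of_forall fun z => (M.isClosestPoint_X hγ k).1⟩

/-- The part of an element which belongs to another element is a null set. -/
theorem volume_chi_mem_elem (hn : 1 ≤ n) {T T' : Fin M.card} (hne : T ≠ T') :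
    volume {x | x ∈ refSimplex n ∧ M.chi T x ∈ M.elem T'} = 0 := by
  -- A point with no vanishing barycentric coordinate belongs to a single element, so overlaps lie
  -- in the faces.
  refine measure_mono_null (t := ⋃ i, {x : Par n | bary x i = 0}) ?_
    (measure_iUnion_null fun i => volume_bary_eq_zero hn i)
  rintro x ⟨hx, hxT⟩
  by_contra hcon
  simp only [mem_iUnion, mem_ofPred_eq, not_exists] at hcon
  refine hne (M.eq_of_affineParam_mem hx hcon ?_)
  rw [← M.Xbar_elem T hx]
  exact (M.P_mem_elem_iff (M.Xbar_mem T (refSimplex_subset_carrier _ hx))).1 hxT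

theorem sum_restrict_eq {ι : Type*} [Fintype ι] {ν : Measure (Amb n)} {s : ι → Set (Amb n)}
    (hs : ∀ i, MeasurableSet (s i)) (hd : ∀ i j, i ≠ j → ν (s i ∩ s j) = 0)
    (hU : ⋃ i, s i = γ) : ∑ i, ν.restrict (s i) = ν.restrict γ := by
  rw [← hU, Measure.restrict_iUnion_ae (fun i j hij => hd i j hij)
    fun i => (hs i).nullMeasurableSet, Measure.sum_fintype]

/-- Each chart contributes the surface measure of its element, and different elements overlap in
null sets. The measure `surf` thus becomes independent of the triangulation. -/
theorem surf_eq (A : M.Admissible k cbar c L C₁ C₂ δ) (hn : 1 ≤ n) (hcbar : 0 < cbar)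
    (hL : 1 ≤ L) {ν : Measure (Amb n)} (hν : IsSurfaceMeasureOn γ univ ν) :
    M.surf = ν.restrict γ := by
  rw [surf, ← sum_restrict_eq (fun T => (M.isClosed_elem T).measurableSet) ?_ M.iUnion_elem]
  · refine Finset.sum_congr rfl fun T _ => ?_
    rw [A.map_chi_withDensity hL hν (A.h_pos hn hcbar T) isClosed_refSimplex.measurableSet
      (refSimplex_subset_interior _), elem_eq]
  · intro T T' hne
    have hT := A.h_pos hn hcbar T
    refine measure_mono_null ?_ (hν.image_null {x | x ∈ refSimplex n ∧ M.chi T x ∈ M.elem T'}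
      (M.chi T) _ (volume_chi_mem_elem hn hne) ((A.lipschitzOnWith_chi hL hT).mono
        fun x hx => refSimplex_subset_carrier _ hx.1)
      fun x hx => ⟨M.chi_mem T (refSimplex_subset_carrier _ hx.1), mem_univ _⟩)
    rintro y ⟨hy, hy'⟩
    rw [elem_eq] at hy
    obtain ⟨x, hx, rfl⟩ := hy
    exact ⟨x, ⟨hx, hy'⟩, rfl⟩

/-- The closest point projection parametrizes `γ` over the approximate surface. -/
theorem surf_eq_sum_map_closestPoint_X (A : M.Admissible k cbar c L C₁ C₂ δ) (hn : 1 ≤ n)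
    (hk : 1 ≤ k) (hcbar : 0 < cbar) (hL : 1 ≤ L) (Sm : IsSmallThreshold W cbar L r δ)
    (hγ : IsClosedC2Hypersurface γ) (hproj : ProjectionWellDefined γ)
    {ν : Measure (Amb n)} (hν : IsSurfaceMeasureOn γ univ ν) :
    M.surf = ∑ T, Measure.map (fun x => closestPoint γ (M.X k T x))
      ((volume.restrict (refSimplex n)).withDensity fun x => ENNReal.ofReal (M.qd k T x)) := by
  have himage : ∀ T, (fun x => closestPoint γ (M.X k T x)) '' refSimplex n =
      M.drift k '' M.elem T := by
    intro T
    rw [elem_eq, image_image]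
    exact image_congr fun x hx => (M.drift_chi hk hx).symm
  have hlip := A.lipschitzOnWith_closestPoint_X hn hk hcbar hL Sm hγ hproj
  simp_rw [A.map_closestPoint_X_withDensity hn hk hcbar hL Sm hγ hproj hν _
    isClosed_refSimplex.measurableSet subset_rfl]
  rw [A.surf_eq hn hcbar hL hν, sum_restrict_eq]
  · intro T
    exact (isCompact_refSimplex.image_of_continuousOn (hlip T).continuousOn).measurableSet
  · intro T T' hne
    refine measure_mono_null ?_ (hν.image_null {x | x ∈ refSimplex n ∧ M.chi T x ∈ M.elem T'}
      (fun x => closestPoint γ (M.X k T x)) _ (volume_chi_mem_elem hn hne)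
      ((hlip T).mono fun x hx => hx.1)
      fun x hx => ⟨(M.isClosestPoint_X hγ k).1, mem_univ _⟩)
    rintro y ⟨⟨x, hx, rfl⟩, hy'⟩
    -- Injectivity of `drift` pulls an overlap of two image pieces back to an overlap of two
    -- elements, which is null. Its surjectivity makes the pieces cover γ.
    rw [himage] at hy'
    obtain ⟨z, hz, hzx⟩ := hy'
    have hzx' : M.drift k z = M.drift k (M.chi T x) := hzx.trans (M.drift_chi hk hx).symm
    have := A.injOn_drift hn hk hcbar hL Sm hγ hproj (M.elem_subset T' hz)
      (M.chi_mem T (refSimplex_subset_carrier _ hx)) hzx'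
    exact ⟨x, ⟨hx, this ▸ hz⟩, rfl⟩
  · simp_rw [himage]
    rw [← image_iUnion, M.iUnion_elem, A.image_drift hn hk hcbar hL Sm hγ hproj]

end Admissible

end ParamSurface

end SurfaceFEM

/-! ### The local estimate of `v ∘ P_d - v ∘ P` -/

theorem MeasureTheory.Measure.le_smul_withDensity_ofReal {α : Type*} [MeasurableSpace α]
    {μ : Measure α} {q : α → ℝ} {m : ℝ} (hm : 0 < m) (h : ∀ᵐ x ∂μ, m ≤ q x) :
    μ ≤ (ENNReal.ofReal m)⁻¹ • μ.withDensity fun x => ENNReal.ofReal (q x) := by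
  have h1 : ENNReal.ofReal m • μ ≤ μ.withDensity fun x => ENNReal.ofReal (q x) := by
    rw [← withDensity_const]
    exact withDensity_mono (h.mono fun x hx => ENNReal.ofReal_le_ofReal hx)
  have h0 : ENNReal.ofReal m ≠ 0 := (ENNReal.ofReal_pos.2 hm).ne'
  calc μ = (ENNReal.ofReal m)⁻¹ • (ENNReal.ofReal m • μ) := by
        rw [smul_smul, ENNReal.inv_mul_cancel h0 ENNReal.ofReal_ne_top, one_smul]
    _ ≤ _ := by gcongr

theorem MeasureTheory.Measure.withDensity_ofReal_le_smul {α : Type*} [MeasurableSpace α]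
    {μ : Measure α} {q : α → ℝ} {m : ℝ} (h : ∀ᵐ x ∂μ, q x ≤ m) :
    (μ.withDensity fun x => ENNReal.ofReal (q x)) ≤ ENNReal.ofReal m • μ := by
  rw [← withDensity_const]
  exact withDensity_mono (h.mono fun x hx => ENNReal.ofReal_le_ofReal hx)

namespace SurfaceFEM

variable {n : ℕ}

/-- The constant in the push-forward bound for the drift in reference coordinates. -/
noncomputable def pushConst (n : ℕ) (cbar c L C₁ : ℝ) : ℝ := (L * c * cbar * refScale n) ^ n / C₁

/-- The constant in the squared local estimate of `v ∘ P_d - v ∘ P`. -/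
noncomputable def localConst (n : ℕ) (cbar c L C₁ : ℝ) : ℝ :=
  12 * (pushConst n cbar c L C₁ + 1 + 2 ^ n) * L ^ (2 * n + 4)

namespace ParamSurface

variable {γ : Set (Amb n)} {k : ℕ} {W : Finset (RefPatch n)} {M : ParamSurface n γ W}

theorem measurable_q (T : Fin M.card) : Measurable (M.q T) := measurable_areaElement _

theorem measurable_qd (k : ℕ) (T : Fin M.card) : Measurable (M.qd k T) := measurable_areaElement _

namespace Admissible

variable {cbar c L C₁ C₂ δ r : ℝ}

theorem aemeasurable_chi {T : Fin M.card}
    {S : Set (Par n)} (hS : MeasurableSet S)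
    (hSi : S ⊆ interior (M.patch T).carrier) {q : Par n → ℝ≥0∞} :
    AEMeasurable (M.chi T) ((volume.restrict S).withDensity q) :=
  (((M.continuousOn_chi T).mono (hSi.trans interior_subset)).aemeasurable hS).mono_ac
    (withDensity_absolutelyContinuous _ _)

theorem map_chi_withDensity_le (A : M.Admissible k cbar c L C₁ C₂ δ) (hn : 1 ≤ n)
    (hcbar : 0 < cbar) (hL : 1 ≤ L) (hγ : IsClosedC2Hypersurface γ) {T : Fin M.card}
    {S : Set (Par n)} (hS : MeasurableSet S) (hSi : S ⊆ interior (M.patch T).carrier) :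
    Measure.map (M.chi T) ((volume.restrict S).withDensity fun x => ENNReal.ofReal (M.q T x)) ≤
      M.surf.restrict (M.omega T) := by
  obtain ⟨ν, hν⟩ := hγ.exists_isSurfaceMeasureOn
  rw [A.map_chi_withDensity hL hν (A.h_pos hn hcbar T) hS hSi, A.surf_eq hn hcbar hL hν,
    Measure.restrict_restrict (M.isCompact_omega T).measurableSet,
    inter_eq_left.2 (M.omega_subset T), omega_eq]
  exact Measure.restrict_mono (image_mono (hSi.trans interior_subset)) le_rfl

theorem restrict_le_smul_withDensity_q (A : M.Admissible k cbar c L C₁ C₂ δ) (hL : 1 ≤ L)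
    {T : Fin M.card} (hT : 0 < M.h T) {S : Set (Par n)} (hSi : S ⊆ interior (M.patch T).carrier) :
    volume.restrict S ≤ (ENNReal.ofReal ((M.h T / L) ^ n))⁻¹ •
      (volume.restrict S).withDensity fun x => ENNReal.ofReal (M.q T x) := by
  have hL0 : 0 < L := by linarith
  refine Measure.le_smul_withDensity_ofReal (by positivity) ?_
  filter_upwards [ae_restrict_of_ae_restrict_of_subset hSi (A.ae_q_bounds hL hT)] with x hx
  exact hx.1

theorem withDensity_q_le_smul_restrict (A : M.Admissible k cbar c L C₁ C₂ δ) (hL : 1 ≤ L)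
    {T : Fin M.card} (hT : 0 < M.h T) {S : Set (Par n)} (hSi : S ⊆ interior (M.patch T).carrier) :
    ((volume.restrict S).withDensity fun x => ENNReal.ofReal (M.q T x)) ≤
      ENNReal.ofReal ((L * M.h T) ^ n) • volume.restrict S := by
  refine Measure.withDensity_ofReal_le_smul ?_
  filter_upwards [ae_restrict_of_ae_restrict_of_subset hSi (A.ae_q_bounds hL hT)] with x hx
  exact hx.2

theorem inv_ofReal_ne_top {a : ℝ} (ha : 0 < a) : (ENNReal.ofReal a)⁻¹ ≠ ⊤ :=
  ENNReal.inv_ne_top.2 (ENNReal.ofReal_pos.2 ha).ne'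

theorem memLp_comp_chi_withDensity (A : M.Admissible k cbar c L C₁ C₂ δ) (hn : 1 ≤ n)
    (hcbar : 0 < cbar) (hL : 1 ≤ L) (hγ : IsClosedC2Hypersurface γ) {T : Fin M.card}
    {S : Set (Par n)} (hS : MeasurableSet S) (hSi : S ⊆ interior (M.patch T).carrier)
    {E : Type*} [NormedAddCommGroup E] {g : Amb n → E} (hg : MemLp g 2 M.surf) :
    MemLp (fun x => g (M.chi T x)) 2
      ((volume.restrict S).withDensity fun x => ENNReal.ofReal (M.q T x)) := by
  have h1 := hg.mono_measure
    ((A.map_chi_withDensity_le hn hcbar hL hγ hS hSi).trans Measure.restrict_le_self)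
  exact (memLp_map_measure_iff h1.1 (aemeasurable_chi hS hSi)).1 h1

theorem memLp_comp_chi (A : M.Admissible k cbar c L C₁ C₂ δ) (hn : 1 ≤ n)
    (hcbar : 0 < cbar) (hL : 1 ≤ L) (hγ : IsClosedC2Hypersurface γ) {T : Fin M.card}
    {S : Set (Par n)} (hS : MeasurableSet S) (hSi : S ⊆ interior (M.patch T).carrier)
    {E : Type*} [NormedAddCommGroup E] {g : Amb n → E} (hg : MemLp g 2 M.surf) :
    MemLp (fun x => g (M.chi T x)) 2 (volume.restrict S) := by
  have hT := A.h_pos hn hcbar T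
  have hL0 : 0 < L := by linarith
  exact (A.memLp_comp_chi_withDensity hn hcbar hL hγ hS hSi hg).of_measure_le_smul
    (inv_ofReal_ne_top (by positivity)) (A.restrict_le_smul_withDensity_q hL hT hSi)

theorem le_qGamma (A : M.Admissible k cbar c L C₁ C₂ δ) (hn : 1 ≤ n) (hc : 0 < c)
    (T : Fin M.card) {x : Par n} (hx : x ∈ refSimplex n) :
    (c⁻¹ * Metric.diam (M.elemBar T)) ^ n ≤ M.qGamma k T x := by
  have hd := M.diam_pos hn T
  rw [qGamma, areaElement_eq_normDet]
  have := LinearMap.le_normDet_of_bound (fderiv ℝ (M.X k T) x).toLinearMap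
    (m := c⁻¹ * Metric.diam (M.elemBar T)) (by positivity) fun w => (A.shape T x hx w).1
  simpa using this

/-- `q_d` is at least `C₁` times `q_Γ`, which shape regularity bounds below by a power of the
element size. This nondegeneracy bounds the push-forward of the drift in reference coordinates. -/
theorem ae_le_qd (A : M.Admissible k cbar c L C₁ C₂ δ) (hn : 1 ≤ n) (hcbar : 0 < cbar)
    (hc : 0 < c) (hC₁ : 0 < C₁) (T : Fin M.card) :
    ∀ᵐ x ∂volume.restrict (refSimplex n),
      C₁ * (M.h T / (c * cbar * refScale n)) ^ n ≤ M.qd k T x := by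
  have hs := refScale_pos (n := n)
  have hd := M.diam_pos hn T
  have hT := A.h_pos hn hcbar T
  filter_upwards [A.area T, ae_restrict_mem isClosed_refSimplex.measurableSet] with x hx hxT
  have h1 := A.le_qGamma hn hc T hxT
  have h2 : 0 < M.qGamma k T x := lt_of_lt_of_le (by positivity) h1
  have h3 := (le_div_iff₀ h2).1 hx.2.1
  refine le_trans ?_ h3
  gcongr
  refine le_trans ?_ h1
  gcongr
  have h4 := (A.h_bounds hn hcbar T).2
  rw [div_le_iff₀ (by positivity)]
  calc M.h T ≤ _ := h4
    _ = _ := by field_simp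

theorem aemeasurable_closestPoint_X (A : M.Admissible k cbar c L C₁ C₂ δ) (hn : 1 ≤ n)
    (hk : 1 ≤ k) (hcbar : 0 < cbar) (hL : 1 ≤ L) (Sm : IsSmallThreshold W cbar L r δ)
    (hγ : IsClosedC2Hypersurface γ) (hproj : ProjectionWellDefined γ) (T : Fin M.card)
    {S : Set (Par n)} (hS : MeasurableSet S) (hST : S ⊆ refSimplex n) {q : Par n → ℝ≥0∞} :
    AEMeasurable (fun x => closestPoint γ (M.X k T x)) ((volume.restrict S).withDensity q) :=
  (((A.lipschitzOnWith_closestPoint_X hn hk hcbar hL Sm hγ hproj T).continuousOn.mono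
    hST).aemeasurable hS).mono_ac (withDensity_absolutelyContinuous _ _)

theorem map_closestPoint_X_withDensity_le (A : M.Admissible k cbar c L C₁ C₂ δ) (hn : 1 ≤ n)
    (hk : 1 ≤ k) (hcbar : 0 < cbar) (hL : 1 ≤ L) (Sm : IsSmallThreshold W cbar L r δ)
    (hγ : IsClosedC2Hypersurface γ) (hproj : ProjectionWellDefined γ) (T : Fin M.card) :
    Measure.map (fun x => closestPoint γ (M.X k T x))
      ((volume.restrict (refSimplex n)).withDensity fun x => ENNReal.ofReal (M.qd k T x)) ≤
      M.surf := by
  obtain ⟨ν, hν⟩ := hγ.exists_isSurfaceMeasureOn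
  rw [A.map_closestPoint_X_withDensity hn hk hcbar hL Sm hγ hproj hν T
    isClosed_refSimplex.measurableSet subset_rfl, A.surf_eq hn hcbar hL hν]
  refine Measure.restrict_mono ?_ le_rfl
  rintro _ ⟨x, -, rfl⟩
  exact (M.isClosestPoint_X hγ k).1

theorem memLp_comp_closestPoint_X (A : M.Admissible k cbar c L C₁ C₂ δ) (hn : 1 ≤ n)
    (hk : 1 ≤ k) (hcbar : 0 < cbar) (hc : 0 < c) (hC₁ : 0 < C₁) (hL : 1 ≤ L)
    (Sm : IsSmallThreshold W cbar L r δ)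
    (hγ : IsClosedC2Hypersurface γ) (hproj : ProjectionWellDefined γ) (T : Fin M.card)
    {E : Type*} [NormedAddCommGroup E] {g : Amb n → E} (hg : MemLp g 2 M.surf) :
    MemLp (fun x => g (closestPoint γ (M.X k T x))) 2 (volume.restrict (refSimplex n)) := by
  have hs := refScale_pos (n := n)
  have hT := A.h_pos hn hcbar T
  have h1 := hg.mono_measure
    (A.map_closestPoint_X_withDensity_le hn hk hcbar hL Sm hγ hproj T)
  have h2 := (memLp_map_measure_iff h1.1 (A.aemeasurable_closestPoint_X hn hk hcbar hL Sm hγ hproj T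
    isClosed_refSimplex.measurableSet subset_rfl)).1 h1
  exact h2.of_measure_le_smul (inv_ofReal_ne_top (by positivity))
    (Measure.le_smul_withDensity_ofReal (by positivity) (A.ae_le_qd hn hcbar hc hC₁ T))

/-- The map `P_d ∘ P⁻¹` in the reference coordinates of a patch. -/
theorem exists_chart_drift (A : M.Admissible k cbar c L C₁ C₂ δ) (hn : 1 ≤ n)
    (hk : 1 ≤ k) (hcbar : 0 < cbar) (hc : 0 < c) (hC₁ : 0 < C₁) (hL : 1 ≤ L)
    (Sm : IsSmallThreshold W cbar L r δ)
    (hγ : IsClosedC2Hypersurface γ) (hproj : ProjectionWellDefined γ) (T : Fin M.card) :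
    ∃ F : Par n → Par n, Measurable F ∧
      (∀ x ∈ refSimplex n, M.chi T (F x) = closestPoint γ (M.X k T x)) ∧
      (∀ x ∈ refSimplex n, ‖F x - x‖ ≤ 2 * L * M.beta k T / M.h T) ∧
      Measure.map F (volume.restrict (refSimplex n)) ≤
        ENNReal.ofReal (pushConst n cbar c L C₁) • volume := by
  classical
  have hT := A.h_pos hn hcbar T
  have hs := refScale_pos (n := n)
  have hL0 : 0 < L := by linarith
  have hβ := M.beta_nonneg k T
  have hex : ∀ x, x ∈ refSimplex n →
      ∃ z ∈ (M.patch T).carrier, M.chi T z = closestPoint γ (M.X k T x) := by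
    intro x hx
    have := A.mismatch T x hx
    rw [omega_eq] at this
    exact this
  choose! G hGc hG using hex
  -- The extension by the identity only serves global measurability; the estimates concern the
  -- reference simplex.
  set F : Par n → Par n := (refSimplex n).piecewise G id with hF
  have hFG : ∀ x ∈ refSimplex n, F x = G x := fun x hx => piecewise_eq_of_mem _ _ _ hx
  have hGcont : ContinuousOn G (refSimplex n) := by
    refine LipschitzOnWith.continuousOn (K := (L / M.h T * (2 * L * M.h T)).toNNReal)
      (LipschitzOnWith.of_dist_le_mul fun x hx y hy => ?_)
    rw [dist_eq_norm, dist_eq_norm, Real.coe_toNNReal _ (by positivity)]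
    refine (A.norm_sub_le_chi hL hT (hGc x hx) (hGc y hy)).trans ?_
    rw [hG x hx, hG y hy, mul_assoc (L / M.h T)]
    gcongr
    exact A.norm_closestPoint_X_sub_le hn hk hcbar hL Sm hγ hproj hy hx
  have hFm : Measurable F :=
    hGcont.measurable_piecewise continuousOn_id isClosed_refSimplex.measurableSet
  have hFχ : ∀ x ∈ refSimplex n, M.chi T (F x) = closestPoint γ (M.X k T x) := fun x hx => by
    rw [hFG x hx, hG x hx]
  have hFε : ∀ x ∈ refSimplex n, ‖F x - x‖ ≤ 2 * L * M.beta k T / M.h T := by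
    intro x hx
    rw [hFG x hx]
    refine (A.norm_sub_le_chi hL hT (hGc x hx) (refSimplex_subset_carrier _ hx)).trans ?_
    rw [hG x hx]
    calc _ ≤ L / M.h T * (2 * M.beta k T) := by
          gcongr
          exact M.norm_closestPoint_X_sub_chi_le hγ k hx
      _ = _ := by ring
  refine ⟨F, hFm, hFχ, hFε, ?_⟩
  set Ω := interior (M.patch T).carrier with hΩ
  have hFΩ : ∀ x ∈ refSimplex n, F x ∈ Ω := by
    intro x hx
    refine Sm.thickening _ (M.patch_mem T) ?_
    refine Metric.mem_cthickening_of_dist_le _ x _ _ hx ?_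
    rw [dist_eq_norm]
    refine (hFε x hx).trans (le_trans ?_ Sm.radius.le)
    have h1 := A.beta_le_h hn hk hcbar hL Sm.pos T
    have hδ := Sm.pos
    rw [div_le_iff₀ hT]
    calc 2 * L * M.beta k T ≤ 2 * L * (cbar ^ 2 / refScale n * δ * M.h T) := by gcongr
      _ = L * (0 + 2) * (cbar ^ 2 / refScale n) * δ * M.h T := by ring
      _ ≤ _ := by
        gcongr
        · positivity
        · norm_num
  obtain ⟨ν, hν⟩ := hγ.exists_isSurfaceMeasureOn
  set m : ℝ := C₁ * (M.h T / (c * cbar * refScale n)) ^ n with hm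
  have hm0 : 0 < m := by positivity
  have hconst : (ENNReal.ofReal m)⁻¹ * ENNReal.ofReal ((L * M.h T) ^ n) =
      ENNReal.ofReal (pushConst n cbar c L C₁) := by
    rw [← ENNReal.ofReal_inv_of_pos hm0, ← ENNReal.ofReal_mul (by positivity)]
    congr 1
    rw [hm, pushConst, div_pow]
    field_simp
    simp only [mul_pow]
    ring
  refine Measure.le_iff.2 fun E hE => ?_
  rw [Measure.map_apply hFm hE, Measure.restrict_apply (hFm hE), ← hconst]
  set B := F ⁻¹' E ∩ refSimplex n with hB
  have hBm : MeasurableSet B := (hFm hE).inter isClosed_refSimplex.measurableSet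
  have hEΩ : MeasurableSet (E ∩ Ω) := hE.inter isOpen_interior.measurableSet
  -- The volume of the preimage is controlled by the surface measure of its closest point image,
  -- through the lower bound on `q_d`. That image lies in `χ_T(E ∩ Ω)`, whose measure is controlled
  -- by the upper bound on `q`; the powers of `h_T` cancel.
  have e1 : volume B ≤ (ENNReal.ofReal m)⁻¹ *
      ν ((fun x => closestPoint γ (M.X k T x)) '' B) := by
    have h1 := Measure.le_smul_withDensity_ofReal hm0 (ae_restrict_of_ae_restrict_of_subset
      (inter_subset_right (s := F ⁻¹' E)) (A.ae_le_qd hn hcbar hc hC₁ T)) univ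
    rw [Measure.restrict_apply_univ, Measure.smul_apply, smul_eq_mul] at h1
    refine h1.trans (le_of_eq ?_)
    congr 1
    have h2 := congrArg (fun μ => μ univ)
      (A.map_closestPoint_X_withDensity hn hk hcbar hL Sm hγ hproj hν T hBm inter_subset_right)
    simp only [Measure.restrict_apply_univ] at h2
    rw [← h2, Measure.map_apply_of_aemeasurable
      (A.aemeasurable_closestPoint_X hn hk hcbar hL Sm hγ hproj T hBm inter_subset_right)
      MeasurableSet.univ, preimage_univ]
  have e2 : ν (M.chi T '' (E ∩ Ω)) ≤ ENNReal.ofReal ((L * M.h T) ^ n) * volume (E ∩ Ω) := by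
    have h1 := A.withDensity_q_le_smul_restrict hL hT (inter_subset_right (s := E) (t := Ω)) univ
    rw [Measure.smul_apply, Measure.restrict_apply_univ, smul_eq_mul] at h1
    refine le_trans (le_of_eq ?_) h1
    have h2 := congrArg (fun μ => μ univ) (A.map_chi_withDensity hL hν hT hEΩ inter_subset_right)
    simp only [Measure.restrict_apply_univ] at h2
    rw [← h2, Measure.map_apply_of_aemeasurable (aemeasurable_chi hEΩ inter_subset_right)
      MeasurableSet.univ, preimage_univ]
  have e3 : (fun x => closestPoint γ (M.X k T x)) '' B ⊆ M.chi T '' (E ∩ Ω) := by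
    rintro _ ⟨x, ⟨hxE, hxT⟩, rfl⟩
    exact ⟨F x, ⟨hxE, hFΩ x hxT⟩, hFχ x hxT⟩
  calc volume B ≤ _ := e1
    _ ≤ (ENNReal.ofReal m)⁻¹ * (ENNReal.ofReal ((L * M.h T) ^ n) * volume (E ∩ Ω)) := by
        gcongr
        exact (measure_mono e3).trans e2
    _ ≤ (ENNReal.ofReal m)⁻¹ * (ENNReal.ofReal ((L * M.h T) ^ n) * volume E) := by
        gcongr
        exact inter_subset_left
    _ = _ := by rw [Measure.smul_apply, smul_eq_mul, mul_assoc]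

/-- The local estimate of `v ∘ P_d - v ∘ P` by the tangential gradient on the macro patch. -/
theorem lintegral_comp_sub_sq_le (A : M.Admissible k cbar c L C₁ C₂ δ) (hn : 1 ≤ n)
    (hk : 1 ≤ k) (hcbar : 0 < cbar) (hc : 0 < c) (hC₁ : 0 < C₁) (hL : 1 ≤ L)
    (Sm : IsSmallThreshold W cbar L r δ)
    (hγ : IsClosedC2Hypersurface γ) (hproj : ProjectionWellDefined γ) (T : Fin M.card)
    {v : Amb n → ℝ} {gv : Amb n → Amb n} (hv : M.HasWeakGradient v gv) :
    ∫⁻ x, ‖v (closestPoint γ (M.X k T x)) - v (M.chi T x)‖ₑ ^ 2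
        ∂(volume.restrict (refSimplex n)).withDensity (fun x => ENNReal.ofReal (M.q T x)) ≤
      ENNReal.ofReal (localConst n cbar c L C₁ * M.beta k T ^ 2) *
        ∫⁻ y in M.omega T, ‖gv y‖ₑ ^ 2 ∂M.surf := by
  have hT := A.h_pos hn hcbar T
  have hs := refScale_pos (n := n)
  have hL0 : 0 < L := by linarith
  have hTi := refSimplex_subset_interior (M.patch T)
  obtain ⟨F, hFm, hFχ, hFε, hFC⟩ := A.exists_chart_drift hn hk hcbar hc hC₁ hL Sm hγ hproj T
  -- The averaging radius must be positive. For `β_T = 0` the closest point and the chart point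
  -- coincide.
  rcases (M.beta_nonneg k T).eq_or_lt with hβ | hβ
  · have h1 : ∀ᵐ x ∂(volume.restrict (refSimplex n)).withDensity
        (fun x => ENNReal.ofReal (M.q T x)),
        ‖v (closestPoint γ (M.X k T x)) - v (M.chi T x)‖ₑ ^ 2 = 0 := by
      refine (withDensity_absolutelyContinuous _ _).ae_le ?_
      filter_upwards [ae_restrict_mem isClosed_refSimplex.measurableSet] with x hx
      have h2 := M.norm_closestPoint_X_sub_chi_le hγ k (T := T) hx
      rw [← hβ, mul_zero] at h2
      rw [sub_eq_zero.1 (norm_le_zero_iff.1 h2)]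
      simp
    rw [lintegral_congr_ae h1]
    simp
  set Ω := interior (M.patch T).carrier with hΩ
  have hΩm : MeasurableSet Ω := isOpen_interior.measurableSet
  set ε : ℝ := 2 * L * M.beta k T / M.h T with hε
  have hε0 : 0 < ε := by positivity
  -- `3 ε = 6 L β_T / h_T` accounts for the `6` in the `radius` condition: the neighbourhood needed
  -- for mollification stays inside the patch.
  have h3ε : 3 * ε ≤ r := by
    refine le_trans ?_ Sm.radius.le
    have h1 := A.beta_le_h hn hk hcbar hL Sm.pos T
    have hδ := Sm.pos
    rw [hε, ← mul_div_assoc, div_le_iff₀ hT]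
    calc 3 * (2 * L * M.beta k T) ≤ 3 * (2 * L * (cbar ^ 2 / refScale n * δ * M.h T)) := by gcongr
      _ = L * (0 + 6) * (cbar ^ 2 / refScale n) * δ * M.h T := by ring
      _ ≤ _ := by
        gcongr
        positivity
  have hfinΩ : IsFiniteMeasure (volume.restrict Ω) := by
    refine ⟨?_⟩
    rw [Measure.restrict_apply_univ]
    exact (measure_mono interior_subset).trans_lt (isCompact_carrier _).measure_lt_top
  have hvL : IntegrableOn (fun x => v (M.chi T x)) Ω :=
    (A.memLp_comp_chi hn hcbar hL hγ hΩm subset_rfl hv.memLp).integrable one_le_two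
  have hgvL := A.memLp_comp_chi hn hcbar hL hγ hΩm subset_rfl hv.memLp_grad
  -- The weak gradient of `v ∘ χ_T` given by the chain rule in the definition of `HasWeakGradient`.
  set g : Par n → Par n →L[ℝ] ℝ := fun x =>
    (innerSL ℝ (gv (M.chi T x))).comp (fderiv ℝ (M.chi T) x) with hg
  have hgb : ∀ x ∈ Ω, ‖g x‖ ≤ L * M.h T * ‖gv (M.chi T x)‖ := by
    intro x hx
    refine (ContinuousLinearMap.opNorm_comp_le _ _).trans ?_
    rw [innerSL_apply_norm, mul_comm]
    gcongr
    exact A.norm_fderiv_chi_le hL hT hx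
  have hgm : AEStronglyMeasurable g (volume.restrict Ω) := by
    have h1 : AEStronglyMeasurable (fun x => innerSL ℝ (gv (M.chi T x))) (volume.restrict Ω) :=
      (innerSL ℝ).continuous.comp_aestronglyMeasurable hgvL.1
    have h2 : AEStronglyMeasurable (fun x => fderiv ℝ (M.chi T) x) (volume.restrict Ω) :=
      (measurable_fderiv ℝ (M.chi T)).aestronglyMeasurable
    exact (ContinuousLinearMap.compL ℝ (Par n) (Amb n) ℝ).aestronglyMeasurable_comp₂ h1 h2
  have hgL : IntegrableOn g Ω := by
    refine Integrable.mono' ((hgvL.integrable one_le_two).norm.const_mul (L * M.h T)) hgm ?_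
    filter_upwards [ae_restrict_mem hΩm] with x hx
    exact hgb x hx
  have key := lintegral_enorm_comp_sub_sq_le_of_weak (v := fun x => v (M.chi T x)) (g := g)
    isOpen_interior hvL hgL (fun φ h1 h2 h3 w => hv.weak T φ h1 h2 h3 w) isCompact_refSimplex
    hFm hε0 hFε ((Metric.cthickening_mono h3ε _).trans (Sm.thickening _ (M.patch_mem T))) hFC
  have hLHS : ∫⁻ x in refSimplex n, ‖v (M.chi T (F x)) - v (M.chi T x)‖ₑ ^ 2 =
      ∫⁻ x in refSimplex n, ‖v (closestPoint γ (M.X k T x)) - v (M.chi T x)‖ₑ ^ 2 :=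
    setLIntegral_congr_fun isClosed_refSimplex.measurableSet fun x hx => by
      simp only [hFχ x hx]
  rw [hLHS] at key
  have hRHS : ∫⁻ x in Ω, ‖g x‖ₑ ^ 2 ≤ ENNReal.ofReal ((L * M.h T) ^ 2) *
      ((ENNReal.ofReal ((M.h T / L) ^ n))⁻¹ * ∫⁻ y in M.omega T, ‖gv y‖ₑ ^ 2 ∂M.surf) := by
    calc ∫⁻ x in Ω, ‖g x‖ₑ ^ 2
        ≤ ∫⁻ x in Ω, ENNReal.ofReal ((L * M.h T) ^ 2) * ‖gv (M.chi T x)‖ₑ ^ 2 := by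
          refine setLIntegral_mono' hΩm fun x hx => ?_
          rw [ENNReal.ofReal_pow (by positivity), ← mul_pow]
          gcongr
          rw [← ofReal_norm, ← ofReal_norm, ← ENNReal.ofReal_mul (by positivity)]
          exact ENNReal.ofReal_le_ofReal (hgb x hx)
      _ = ENNReal.ofReal ((L * M.h T) ^ 2) * ∫⁻ x in Ω, ‖gv (M.chi T x)‖ₑ ^ 2 :=
          lintegral_const_mul' _ _ ENNReal.ofReal_ne_top
      _ ≤ _ := by
          gcongr
          refine (lintegral_mono' (A.restrict_le_smul_withDensity_q hL hT subset_rfl) le_rfl).trans ?_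
          rw [lintegral_smul_measure, smul_eq_mul]
          gcongr
          have h4 : AEMeasurable (fun y => ‖gv y‖ₑ ^ 2) (Measure.map (M.chi T)
              ((volume.restrict Ω).withDensity fun x => ENNReal.ofReal (M.q T x))) :=
            ((hv.memLp_grad.1.mono_measure ((A.map_chi_withDensity_le hn hcbar hL hγ hΩm
              subset_rfl).trans Measure.restrict_le_self)).enorm).pow_const 2
          rw [← lintegral_map' h4 (aemeasurable_chi hΩm subset_rfl)]
          exact lintegral_mono' (A.map_chi_withDensity_le hn hcbar hL hγ hΩm subset_rfl) le_rfl
  have hp0 : 0 ≤ pushConst n cbar c L C₁ := by unfold pushConst; positivity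
  calc _ ≤ ENNReal.ofReal ((L * M.h T) ^ n) * ∫⁻ x in refSimplex n,
          ‖v (closestPoint γ (M.X k T x)) - v (M.chi T x)‖ₑ ^ 2 := by
        refine (lintegral_mono' (A.withDensity_q_le_smul_restrict hL hT hTi) le_rfl).trans ?_
        rw [lintegral_smul_measure, smul_eq_mul]
    _ ≤ ENNReal.ofReal ((L * M.h T) ^ n) *
        (3 * (ENNReal.ofReal (pushConst n cbar c L C₁) + 1 + 2 ^ Module.finrank ℝ (Par n)) *
          ENNReal.ofReal ε ^ 2 * (ENNReal.ofReal ((L * M.h T) ^ 2) *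
          ((ENNReal.ofReal ((M.h T / L) ^ n))⁻¹ * ∫⁻ y in M.omega T, ‖gv y‖ₑ ^ 2 ∂M.surf))) := by
        gcongr
        exact key.trans (by gcongr)
    -- The powers of `h_T` are `n` from `q`, `-2` from `ε ^ 2`, `2` from `Dχ_T` and `-n` from `1 /
    -- q`: they cancel and `β_T ^ 2` remains. Likewise `L` occurs with exponent `n + 2 + 2 + n`, and
    -- `3 * 2 ^ 2` gives the factor `12`.
    _ = _ := by
        have hfr : Module.finrank ℝ (Par n) = n := by simp
        have h5 : 3 * (ENNReal.ofReal (pushConst n cbar c L C₁) + 1 + 2 ^ n) =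
            ENNReal.ofReal (3 * (pushConst n cbar c L C₁ + 1 + 2 ^ n)) := by
          rw [ENNReal.ofReal_mul (by norm_num), ENNReal.ofReal_add (by positivity) (by positivity),
            ENNReal.ofReal_add hp0 zero_le_one, ENNReal.ofReal_pow (by norm_num)]
          simp
        rw [hfr, h5, ← ENNReal.ofReal_pow hε0.le, ← ENNReal.ofReal_inv_of_pos (by positivity),
          ← mul_assoc (ENNReal.ofReal ((L * M.h T) ^ 2)), ← ENNReal.ofReal_mul (by positivity),
          ← ENNReal.ofReal_mul (by positivity), ← mul_assoc, ← mul_assoc,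
          ← ENNReal.ofReal_mul (by positivity), ← ENNReal.ofReal_mul (by positivity)]
        congr 2
        rw [localConst, hε, div_pow (M.h T) L n, mul_pow L (M.h T) n]
        field_simp
        ring

end Admissible

end ParamSurface

end SurfaceFEM

/-! ### The consistency error as a sum of local terms -/

theorem MeasureTheory.eLpNorm_two_sq {α E : Type*} [MeasurableSpace α] [NormedAddCommGroup E]
    (g : α → E) (μ : Measure α) : eLpNorm g 2 μ ^ 2 = ∫⁻ x, ‖g x‖ₑ ^ 2 ∂μ := by
  have h := eLpNorm_nnreal_pow_eq_lintegral (f := g) (μ := μ) (p := 2) (by norm_num)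
  simpa using h

theorem MeasureTheory.abs_integral_mul_le_eLpNorm_two {α : Type*} [MeasurableSpace α]
    {μ : Measure α} {a b : α → ℝ} (ha : MemLp a 2 μ) (hb : MemLp b 2 μ) :
    |∫ x, a x * b x ∂μ| ≤ (eLpNorm a 2 μ).toReal * (eLpNorm b 2 μ).toReal := by
  have h1 := eLpNorm_smul_le_mul_eLpNorm (p := 2) (q := 2) (r := 1) hb.1 ha.1
  rw [eLpNorm_one_eq_lintegral_enorm] at h1
  have h2 := (enorm_integral_le_lintegral_enorm (μ := μ) fun x => a x * b x).trans h1
  have h3 := ENNReal.toReal_mono (ENNReal.mul_ne_top ha.2.ne hb.2.ne) h2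
  rwa [toReal_enorm, ENNReal.toReal_mul, Real.norm_eq_abs] at h3

open Classical in
-- The sum of the indicator functions is at most `N` everywhere.
theorem MeasureTheory.sum_setLIntegral_le_of_card_le {α ι : Type*} [MeasurableSpace α] [Fintype ι]
    {μ : Measure α} {s : ι → Set α} (hs : ∀ i, MeasurableSet (s i)) {N : ℕ}
    (hN : ∀ y, (Finset.univ.filter fun i => y ∈ s i).card ≤ N) {F : α → ℝ≥0∞}
    (hF : AEMeasurable F μ) : ∑ i, ∫⁻ y in s i, F y ∂μ ≤ N * ∫⁻ y, F y ∂μ := by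
  simp_rw [← fun i => lintegral_indicator (μ := μ) (hs i) F]
  rw [← lintegral_finsetSum' _ fun i _ => hF.indicator (hs i),
    ← lintegral_const_mul' _ _ (ENNReal.natCast_ne_top N)]
  refine lintegral_mono fun y => ?_
  simp only [indicator_apply]
  rw [← Finset.sum_filter, Finset.sum_const, nsmul_eq_mul]
  gcongr
  exact hN y

namespace SurfaceFEM

variable {n : ℕ}

namespace ParamSurface

variable {γ : Set (Amb n)} {k : ℕ} {W : Finset (RefPatch n)} {M : ParamSurface n γ W}

theorem l2norm_nonneg {E : Type*} [NormedAddCommGroup E] (g : Amb n → E) (S : Set (Amb n)) :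
    0 ≤ M.l2norm g S := ENNReal.toReal_nonneg

theorem h1norm_nonneg (v : Amb n → ℝ) (gv : Amb n → Amb n) (S : Set (Amb n)) :
    0 ≤ M.h1norm v gv S := Real.sqrt_nonneg _

theorem h1norm_sq (v : Amb n → ℝ) (gv : Amb n → Amb n) (S : Set (Amb n)) :
    M.h1norm v gv S ^ 2 = M.l2norm v S ^ 2 + M.l2norm gv S ^ 2 :=
  Real.sq_sqrt (by positivity)

theorem l2norm_grad_le_h1norm (v : Amb n → ℝ) (gv : Amb n → Amb n) (S : Set (Amb n)) :
    M.l2norm gv S ≤ M.h1norm v gv S := by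
  refine Real.le_sqrt_of_sq_le ?_
  have := sq_nonneg (M.l2norm v S)
  linarith

theorem l2norm_sq {E : Type*} [NormedAddCommGroup E] (g : Amb n → E) (S : Set (Amb n)) :
    M.l2norm g S ^ 2 = (∫⁻ y in S, ‖g y‖ₑ ^ 2 ∂M.surf).toReal := by
  rw [l2norm, ← ENNReal.toReal_pow, eLpNorm_two_sq]

open Classical in
theorem sum_l2norm_sq_le (hsurf : M.surf.restrict γ = M.surf) {E : Type*} [NormedAddCommGroup E]
    {g : Amb n → E} (hg : MemLp g 2 M.surf) {s : Fin M.card → Set (Amb n)}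
    (hs : ∀ T, MeasurableSet (s T)) {N : ℕ}
    (hN : ∀ y, (Finset.univ.filter fun T => y ∈ s T).card ≤ N) :
    ∑ T, M.l2norm g (s T) ^ 2 ≤ N * M.l2norm g γ ^ 2 := by
  have hfin : ∫⁻ y, ‖g y‖ₑ ^ 2 ∂M.surf ≠ ⊤ := by
    rw [← eLpNorm_two_sq]
    exact ENNReal.pow_ne_top hg.2.ne
  have hfinS : ∀ T, ∫⁻ y in s T, ‖g y‖ₑ ^ 2 ∂M.surf ≠ ⊤ := fun T =>
    ne_top_of_le_ne_top hfin (setLIntegral_le_lintegral _ _)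
  simp_rw [l2norm_sq]
  rw [← ENNReal.toReal_sum fun T _ => hfinS T, hsurf]
  have h := ENNReal.toReal_mono (ENNReal.mul_ne_top (ENNReal.natCast_ne_top N) hfin)
    (sum_setLIntegral_le_of_card_le hs hN (hg.1.enorm.pow_const 2))
  rwa [ENNReal.toReal_mul, ENNReal.toReal_natCast] at h

namespace Admissible

variable {cbar c L C₁ C₂ δ r : ℝ}

theorem surf_restrict (A : M.Admissible k cbar c L C₁ C₂ δ) (hn : 1 ≤ n) (hcbar : 0 < cbar)
    (hL : 1 ≤ L) (hγ : IsClosedC2Hypersurface γ) : M.surf.restrict γ = M.surf := by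
  obtain ⟨ν, hν⟩ := hγ.exists_isSurfaceMeasureOn
  rw [A.surf_eq hn hcbar hL hν, Measure.restrict_restrict hγ.1.measurableSet, inter_self]

theorem sum_l2norm_omega_sq_le (A : M.Admissible k cbar c L C₁ C₂ δ) (hn : 1 ≤ n) (hcbar : 0 < cbar)
    (hL : 1 ≤ L) (hγ : IsClosedC2Hypersurface γ) {E : Type*} [NormedAddCommGroup E]
    {g : Amb n → E} (hg : MemLp g 2 M.surf) :
    ∑ T, M.l2norm g (M.omega T) ^ 2 ≤ (patchCard W : ℝ) ^ 2 * M.l2norm g γ ^ 2 := by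
  have h := sum_l2norm_sq_le (A.surf_restrict hn hcbar hL hγ) hg
    (fun T => (M.isCompact_omega T).measurableSet) M.card_omega_le
  rwa [Nat.cast_mul, ← sq] at h

theorem sum_l2norm_elem_sq_le (A : M.Admissible k cbar c L C₁ C₂ δ) (hn : 1 ≤ n) (hcbar : 0 < cbar)
    (hL : 1 ≤ L) (hγ : IsClosedC2Hypersurface γ) {E : Type*} [NormedAddCommGroup E]
    {g : Amb n → E} (hg : MemLp g 2 M.surf) :
    ∑ T, M.l2norm g (M.elem T) ^ 2 ≤ patchCard W * M.l2norm g γ ^ 2 :=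
  sum_l2norm_sq_le (A.surf_restrict hn hcbar hL hγ) hg
    (fun T => (M.isCompact_elem T).measurableSet) M.card_elem_le

/-- Shape regularity makes `q_Γ` positive, so the quotient in the integrand cancels against the area
element of the integral. -/
theorem ae_practical_mul_qGamma (A : M.Admissible k cbar c L C₁ C₂ δ) (hn : 1 ≤ n) (hc : 0 < c)
    (f v : Amb n → ℝ) (T : Fin M.card) :
    (fun x => M.practical k f v T x * M.qGamma k T x) =ᵐ[volume.restrict (refSimplex n)]
      fun x => (ENNReal.ofReal (M.q T x)).toReal •
        (f (M.chi T x) * v (closestPoint γ (M.X k T x))) := by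
  filter_upwards [ae_restrict_mem isClosed_refSimplex.measurableSet] with x hx
  have hd := M.diam_pos hn T
  have h1 : M.qGamma k T x ≠ 0 := (lt_of_lt_of_le (by positivity) (A.le_qGamma hn hc T hx)).ne'
  rw [practical, ENNReal.toReal_ofReal (show 0 ≤ M.q T x from areaElement_nonneg _ _), smul_eq_mul]
  field_simp

theorem ae_theoretical_mul_qGamma (A : M.Admissible k cbar c L C₁ C₂ δ) (hn : 1 ≤ n) (hc : 0 < c)
    (f v : Amb n → ℝ) (T : Fin M.card) :
    (fun x => M.theoretical k f v T x * M.qGamma k T x) =ᵐ[volume.restrict (refSimplex n)]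
      fun x => (ENNReal.ofReal (M.qd k T x)).toReal •
        (f (closestPoint γ (M.X k T x)) * v (closestPoint γ (M.X k T x))) := by
  filter_upwards [ae_restrict_mem isClosed_refSimplex.measurableSet] with x hx
  have hd := M.diam_pos hn T
  have h1 : M.qGamma k T x ≠ 0 := (lt_of_lt_of_le (by positivity) (A.le_qGamma hn hc T hx)).ne'
  rw [theoretical, ENNReal.toReal_ofReal (show 0 ≤ M.qd k T x from areaElement_nonneg _ _),
    smul_eq_mul]
  field_simp

theorem memLp_comp_closestPoint_X_withDensity (A : M.Admissible k cbar c L C₁ C₂ δ) (hn : 1 ≤ n)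
    (hk : 1 ≤ k) (hcbar : 0 < cbar) (hc : 0 < c) (hC₁ : 0 < C₁) (hL : 1 ≤ L)
    (Sm : IsSmallThreshold W cbar L r δ)
    (hγ : IsClosedC2Hypersurface γ) (hproj : ProjectionWellDefined γ) (T : Fin M.card)
    {g : Amb n → ℝ} (hg : MemLp g 2 M.surf) :
    MemLp (fun x => g (closestPoint γ (M.X k T x))) 2
      ((volume.restrict (refSimplex n)).withDensity fun x => ENNReal.ofReal (M.q T x)) :=
  (A.memLp_comp_closestPoint_X hn hk hcbar hc hC₁ hL Sm hγ hproj T hg).of_measure_le_smul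
    ENNReal.ofReal_ne_top (A.withDensity_q_le_smul_restrict hL (A.h_pos hn hcbar T)
      (refSimplex_subset_interior _))

theorem integrableOnGamma_practical (A : M.Admissible k cbar c L C₁ C₂ δ) (hn : 1 ≤ n)
    (hk : 1 ≤ k) (hcbar : 0 < cbar) (hc : 0 < c) (hC₁ : 0 < C₁) (hL : 1 ≤ L)
    (Sm : IsSmallThreshold W cbar L r δ)
    (hγ : IsClosedC2Hypersurface γ) (hproj : ProjectionWellDefined γ)
    {f v : Amb n → ℝ} (hf : MemLp f 2 M.surf) (hv : MemLp v 2 M.surf) :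
    M.IntegrableOnGamma k (M.practical k f v) := by
  intro T
  refine (integrable_congr (A.ae_practical_mul_qGamma hn hc f v T)).2 ?_
  rw [← integrable_withDensity_iff_integrable_smul' (measurable_q T).ennreal_ofReal
    (Filter.Eventually.of_forall fun _ => ENNReal.ofReal_lt_top)]
  exact (A.memLp_comp_chi_withDensity hn hcbar hL hγ isClosed_refSimplex.measurableSet
    (refSimplex_subset_interior _) hf).integrable_mul
    (A.memLp_comp_closestPoint_X_withDensity hn hk hcbar hc hC₁ hL Sm hγ hproj T hv)

theorem integralGamma_practical (A : M.Admissible k cbar c L C₁ C₂ δ) (hn : 1 ≤ n) (hc : 0 < c)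
    (f v : Amb n → ℝ) : M.integralGamma k (M.practical k f v) =
      ∑ T, ∫ x, f (M.chi T x) * v (closestPoint γ (M.X k T x))
        ∂(volume.restrict (refSimplex n)).withDensity fun x => ENNReal.ofReal (M.q T x) := by
  refine Finset.sum_congr rfl fun T _ => ?_
  rw [integral_congr_ae (A.ae_practical_mul_qGamma hn hc f v T),
    integral_withDensity_eq_integral_toReal_smul (measurable_q T).ennreal_ofReal
      (Filter.Eventually.of_forall fun _ => ENNReal.ofReal_lt_top)]

theorem integrableOnGamma_theoretical (A : M.Admissible k cbar c L C₁ C₂ δ) (hn : 1 ≤ n)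
    (hk : 1 ≤ k) (hcbar : 0 < cbar) (hc : 0 < c) (hL : 1 ≤ L)
    (Sm : IsSmallThreshold W cbar L r δ)
    (hγ : IsClosedC2Hypersurface γ) (hproj : ProjectionWellDefined γ)
    {f v : Amb n → ℝ} (hf : MemLp f 2 M.surf) (hv : MemLp v 2 M.surf) :
    M.IntegrableOnGamma k (M.theoretical k f v) := by
  intro T
  refine (integrable_congr (A.ae_theoretical_mul_qGamma hn hc f v T)).2 ?_
  rw [← integrable_withDensity_iff_integrable_smul' (measurable_qd k T).ennreal_ofReal
    (Filter.Eventually.of_forall fun _ => ENNReal.ofReal_lt_top)]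
  have h1 : Integrable (fun y => f y * v y) M.surf := hf.integrable_mul hv
  exact (h1.mono_measure (A.map_closestPoint_X_withDensity_le hn hk hcbar hL Sm hγ hproj T)
    ).comp_aemeasurable (A.aemeasurable_closestPoint_X hn hk hcbar hL Sm hγ hproj T
      isClosed_refSimplex.measurableSet subset_rfl)

/-- Both sides are the integral of `f v` over γ, once in the closest point parametrization and once
in the charts. This is where bijectivity of the drift pays off: no error arises from the first
integral. -/
theorem integralGamma_theoretical (A : M.Admissible k cbar c L C₁ C₂ δ) (hn : 1 ≤ n)
    (hk : 1 ≤ k) (hcbar : 0 < cbar) (hc : 0 < c) (hL : 1 ≤ L)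
    (Sm : IsSmallThreshold W cbar L r δ)
    (hγ : IsClosedC2Hypersurface γ) (hproj : ProjectionWellDefined γ)
    {f v : Amb n → ℝ} (hf : MemLp f 2 M.surf) (hv : MemLp v 2 M.surf) :
    M.integralGamma k (M.theoretical k f v) =
      ∑ T, ∫ x, f (M.chi T x) * v (M.chi T x)
        ∂(volume.restrict (refSimplex n)).withDensity fun x => ENNReal.ofReal (M.q T x) := by
  obtain ⟨ν, hν⟩ := hγ.exists_isSurfaceMeasureOn
  have h1 : Integrable (fun y => f y * v y) M.surf := hf.integrable_mul hv
  have hchi : ∀ T, Integrable (fun y => f y * v y) (Measure.map (M.chi T)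
      ((volume.restrict (refSimplex n)).withDensity fun x => ENNReal.ofReal (M.q T x))) := fun T =>
    h1.mono_measure ((A.map_chi_withDensity_le hn hcbar hL hγ isClosed_refSimplex.measurableSet
      (refSimplex_subset_interior _)).trans Measure.restrict_le_self)
  have hcp := fun T => h1.mono_measure
    (A.map_closestPoint_X_withDensity_le hn hk hcbar hL Sm hγ hproj T)
  have e1 : ∫ y, f y * v y ∂M.surf = ∑ T, ∫ x, f (M.chi T x) * v (M.chi T x)
      ∂(volume.restrict (refSimplex n)).withDensity fun x => ENNReal.ofReal (M.q T x) := by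
    rw [surf, integral_finsetSum_measure fun T _ => hchi T]
    refine Finset.sum_congr rfl fun T _ => ?_
    exact integral_map (aemeasurable_chi isClosed_refSimplex.measurableSet
      (refSimplex_subset_interior _)) (hchi T).1
  rw [← e1, A.surf_eq_sum_map_closestPoint_X hn hk hcbar hL Sm hγ hproj hν,
    integral_finsetSum_measure fun T _ => hcp T]
  refine Finset.sum_congr rfl fun T _ => ?_
  rw [integral_map (A.aemeasurable_closestPoint_X hn hk hcbar hL Sm hγ hproj T
      isClosed_refSimplex.measurableSet subset_rfl) (hcp T).1,
    integral_congr_ae (A.ae_theoretical_mul_qGamma hn hc f v T),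
    integral_withDensity_eq_integral_toReal_smul (measurable_qd k T).ennreal_ofReal
      (Filter.Eventually.of_forall fun _ => ENNReal.ofReal_lt_top)]

theorem localConst_nonneg (hcbar : 0 < cbar) (hc : 0 < c) (hC₁ : 0 < C₁) (hL : 1 ≤ L) :
    0 ≤ localConst n cbar c L C₁ := by
  have hs := refScale_pos (n := n)
  unfold localConst pushConst
  positivity

theorem l2_comp_sub_le (A : M.Admissible k cbar c L C₁ C₂ δ) (hn : 1 ≤ n)
    (hk : 1 ≤ k) (hcbar : 0 < cbar) (hc : 0 < c) (hC₁ : 0 < C₁) (hL : 1 ≤ L)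
    (Sm : IsSmallThreshold W cbar L r δ)
    (hγ : IsClosedC2Hypersurface γ) (hproj : ProjectionWellDefined γ) (T : Fin M.card)
    {v : Amb n → ℝ} {gv : Amb n → Amb n} (hv : M.HasWeakGradient v gv) :
    (eLpNorm (fun x => v (closestPoint γ (M.X k T x)) - v (M.chi T x)) 2
        ((volume.restrict (refSimplex n)).withDensity fun x => ENNReal.ofReal (M.q T x))).toReal ≤
      Real.sqrt (localConst n cbar c L C₁) * (M.beta k T * M.l2norm gv (M.omega T)) := by
  have hK := localConst_nonneg (n := n) hcbar hc hC₁ hL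
  have hβ := M.beta_nonneg k T
  have h := A.lintegral_comp_sub_sq_le hn hk hcbar hc hC₁ hL Sm hγ hproj T hv
  have hfin : ∫⁻ y in M.omega T, ‖gv y‖ₑ ^ 2 ∂M.surf ≠ ⊤ := by
    rw [← eLpNorm_two_sq]
    exact ENNReal.pow_ne_top (hv.memLp_grad.mono_measure Measure.restrict_le_self).2.ne
  have h1 := ENNReal.toReal_mono (ENNReal.mul_ne_top ENNReal.ofReal_ne_top hfin) h
  rw [← eLpNorm_two_sq, ENNReal.toReal_pow, ENNReal.toReal_mul,
    ENNReal.toReal_ofReal (by positivity), ← l2norm_sq] at h1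
  refine le_of_sq_le_sq ?_ (mul_nonneg (Real.sqrt_nonneg _) (mul_nonneg hβ (l2norm_nonneg _ _)))
  rw [mul_pow, Real.sq_sqrt hK, mul_pow]
  linarith

/-- The consistency error is bounded by local norms of the gradient of the test function. -/
theorem abs_integralGamma_sub_le (A : M.Admissible k cbar c L C₁ C₂ δ) (hn : 1 ≤ n)
    (hk : 1 ≤ k) (hcbar : 0 < cbar) (hc : 0 < c) (hC₁ : 0 < C₁) (hL : 1 ≤ L)
    (Sm : IsSmallThreshold W cbar L r δ)
    (hγ : IsClosedC2Hypersurface γ) (hproj : ProjectionWellDefined γ)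
    {f v : Amb n → ℝ} {gv : Amb n → Amb n} (hf : MemLp f 2 M.surf)
    (hv : M.HasWeakGradient v gv) :
    |M.integralGamma k (M.theoretical k f v) - M.integralGamma k (M.practical k f v)| ≤
      Real.sqrt (localConst n cbar c L C₁) *
        ∑ T, M.beta k T * M.l2norm f (M.elem T) * M.l2norm gv (M.omega T) := by
  rw [A.integralGamma_theoretical hn hk hcbar hc hL Sm hγ hproj hf hv.memLp,
    A.integralGamma_practical hn hc, ← Finset.sum_sub_distrib, Finset.mul_sum]
  refine (Finset.abs_sum_le_sum_abs _ _).trans (Finset.sum_le_sum fun T _ => ?_)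
  set m := (volume.restrict (refSimplex n)).withDensity fun x => ENNReal.ofReal (M.q T x) with hm
  have hTm : MeasurableSet (refSimplex n) := isClosed_refSimplex.measurableSet
  have hTi := refSimplex_subset_interior (M.patch T)
  have hfL : MemLp (fun x => f (M.chi T x)) 2 m :=
    A.memLp_comp_chi_withDensity hn hcbar hL hγ hTm hTi hf
  have hvL : MemLp (fun x => v (M.chi T x)) 2 m :=
    A.memLp_comp_chi_withDensity hn hcbar hL hγ hTm hTi hv.memLp
  have hpL : MemLp (fun x => v (closestPoint γ (M.X k T x))) 2 m :=
    A.memLp_comp_closestPoint_X_withDensity hn hk hcbar hc hC₁ hL Sm hγ hproj T hv.memLp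
  -- The data factor `f ∘ χ_T` and the weight `q` are now common, so only the test function differs.
  have e0 : ∫ x, f (M.chi T x) * v (closestPoint γ (M.X k T x)) ∂m -
      ∫ x, f (M.chi T x) * v (M.chi T x) ∂m =
      ∫ x, f (M.chi T x) * (v (closestPoint γ (M.X k T x)) - v (M.chi T x)) ∂m := by
    simp_rw [mul_sub]
    exact (integral_sub (hfL.integrable_mul hpL) (hfL.integrable_mul hvL)).symm
  rw [abs_sub_comm, e0]
  refine (abs_integral_mul_le_eLpNorm_two hfL (hpL.sub hvL)).trans ?_
  have e1 : (eLpNorm (fun x => f (M.chi T x)) 2 m).toReal ≤ M.l2norm f (M.elem T) := by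
    obtain ⟨ν, hν⟩ := hγ.exists_isSurfaceMeasureOn
    have h1 : Measure.map (M.chi T) m = M.surf.restrict (M.elem T) := by
      rw [A.map_chi_withDensity hL hν (A.h_pos hn hcbar T) hTm hTi, A.surf_eq hn hcbar hL hν,
        Measure.restrict_restrict (M.isCompact_elem T).measurableSet,
        inter_eq_left.2 (M.elem_subset T), elem_eq]
    have h2 := hf.mono_measure (Measure.restrict_le_self (s := M.elem T))
    rw [l2norm, ← h1, eLpNorm_map_measure (by rw [h1]; exact h2.1) (aemeasurable_chi hTm hTi)]
    rfl
  have e2 := A.l2_comp_sub_le hn hk hcbar hc hC₁ hL Sm hγ hproj T hv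
  calc _ ≤ M.l2norm f (M.elem T) *
        (Real.sqrt (localConst n cbar c L C₁) * (M.beta k T * M.l2norm gv (M.omega T))) :=
      mul_le_mul e1 e2 ENNReal.toReal_nonneg (l2norm_nonneg _ _)
    _ = _ := by ring

end Admissible

end ParamSurface

end SurfaceFEM

/-! ### Summation over the elements and the final constants -/

namespace SurfaceFEM

namespace ParamSurface

variable {n k : ℕ} {γ : Set (Amb n)} {W : Finset (RefPatch n)} {M : ParamSurface n γ W}

/-- Cauchy–Schwarz for finite sums, with `a T` a local norm of the test function and `N` the overlap
constant. It serves both the full `H¹` norm and the gradient alone. -/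
theorem sum_mul_le_of_sum_sq_le {f : Amb n → ℝ} {a : Fin M.card → ℝ} {b N : ℝ} (hb : 0 ≤ b)
    (hN : 0 ≤ N) (hab : ∑ T, a T ^ 2 ≤ N ^ 2 * b ^ 2) :
    ∑ T, M.beta k T * M.l2norm f (M.elem T) * a T ≤
      N * (Real.sqrt (∑ T, M.beta k T ^ 2 * M.l2norm f (M.elem T) ^ 2) * b) := by
  refine (Real.sum_mul_le_sqrt_mul_sqrt _ _ _).trans ?_
  simp_rw [mul_pow]
  rw [mul_left_comm]
  refine mul_le_mul_of_nonneg_left ?_ (Real.sqrt_nonneg _)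
  refine Real.sqrt_le_iff.2 ⟨by positivity, ?_⟩
  rwa [mul_pow]

namespace Admissible

variable {cbar c L C₁ C₂ δ r : ℝ}

theorem sum_beta_mul_h1norm_le (A : M.Admissible k cbar c L C₁ C₂ δ) (hn : 1 ≤ n)
    (hcbar : 0 < cbar) (hL : 1 ≤ L) (hγ : IsClosedC2Hypersurface γ) {f v : Amb n → ℝ}
    {gv : Amb n → Amb n} (hv : M.HasWeakGradient v gv) :
    ∑ T, M.beta k T * M.l2norm f (M.elem T) * M.h1norm v gv (M.omega T) ≤
      patchCard W * (Real.sqrt (∑ T, M.beta k T ^ 2 * M.l2norm f (M.elem T) ^ 2) *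
        M.h1norm v gv γ) := by
  refine sum_mul_le_of_sum_sq_le (h1norm_nonneg _ _ _) (Nat.cast_nonneg _) ?_
  simp_rw [h1norm_sq]
  rw [Finset.sum_add_distrib, mul_add]
  exact add_le_add (A.sum_l2norm_omega_sq_le hn hcbar hL hγ hv.memLp)
    (A.sum_l2norm_omega_sq_le hn hcbar hL hγ hv.memLp_grad)

theorem sqrt_sum_beta_le (A : M.Admissible k cbar c L C₁ C₂ δ) (hn : 1 ≤ n)
    (hcbar : 0 < cbar) (hL : 1 ≤ L) (hγ : IsClosedC2Hypersurface γ) {f : Amb n → ℝ}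
    (hf : MemLp f 2 M.surf) :
    Real.sqrt (∑ T, M.beta k T ^ 2 * M.l2norm f (M.elem T) ^ 2) ≤
      patchCard W * (M.l2norm f γ * M.betaMax k) := by
  have hb := M.betaMax_nonneg k
  have hfγ : 0 ≤ M.l2norm f γ := l2norm_nonneg _ _
  have hN1 : (1 : ℝ) ≤ patchCard W := Nat.one_le_cast.2 (Nat.le_add_left 1 _)
  refine Real.sqrt_le_iff.2 ⟨by positivity, ?_⟩
  calc ∑ T, M.beta k T ^ 2 * M.l2norm f (M.elem T) ^ 2
      ≤ ∑ T, M.betaMax k ^ 2 * M.l2norm f (M.elem T) ^ 2 := by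
        refine Finset.sum_le_sum fun T _ => ?_
        have := M.beta_nonneg k T
        gcongr
        exact M.beta_le_betaMax k T
    _ = M.betaMax k ^ 2 * ∑ T, M.l2norm f (M.elem T) ^ 2 := by rw [Finset.mul_sum]
    _ ≤ M.betaMax k ^ 2 * (patchCard W * M.l2norm f γ ^ 2) := by
        gcongr
        exact A.sum_l2norm_elem_sq_le hn hcbar hL hγ hf
    _ ≤ M.betaMax k ^ 2 * ((patchCard W : ℝ) ^ 2 * M.l2norm f γ ^ 2) := by
        gcongr
        exact le_self_pow₀ hN1 two_ne_zero
    _ = _ := by ring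

/-- Keeping only the gradient norm lets the normalization of the test functions in the supremum
enter directly. -/
theorem termII_le (A : M.Admissible k cbar c L C₁ C₂ δ) (hn : 1 ≤ n)
    (hk : 1 ≤ k) (hcbar : 0 < cbar) (hc : 0 < c) (hC₁ : 0 < C₁) (hL : 1 ≤ L)
    (Sm : IsSmallThreshold W cbar L r δ)
    (hγ : IsClosedC2Hypersurface γ) (hproj : ProjectionWellDefined γ)
    {f v : Amb n → ℝ} {gv : Amb n → Amb n} (hf : MemLp f 2 M.surf)
    (hv : M.HasWeakGradient v gv) :
    M.termII k f v ≤ Real.sqrt (localConst n cbar c L C₁) * patchCard W *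
      (Real.sqrt (∑ T, M.beta k T ^ 2 * M.l2norm f (M.elem T) ^ 2) * M.l2norm gv γ) := by
  refine (le_abs_self _).trans
    ((A.abs_integralGamma_sub_le hn hk hcbar hc hC₁ hL Sm hγ hproj hf hv).trans ?_)
  rw [mul_assoc]
  refine mul_le_mul_of_nonneg_left ?_ (Real.sqrt_nonneg _)
  exact sum_mul_le_of_sum_sq_le (l2norm_nonneg _ _) (Nat.cast_nonneg _)
    (A.sum_l2norm_omega_sq_le hn hcbar hL hγ hv.memLp_grad)

end Admissible

end ParamSurface

end SurfaceFEM

theorem mainTheorem4 (n k : ℕ) (hn : 1 ≤ n) (hk : 1 ≤ k) (W : Finset (RefPatch n))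
    (cbar c L C₁ C₂ : ℝ) (hcbar : 0 < cbar) (hc : 0 < c) (hL : 1 ≤ L) (hC₁ : 0 < C₁)
    (hC₂ : 0 < C₂) :
    ∃ δ > 0, ∃ D > 0, ∀ (γ : Set (Amb n)), IsClosedC2Hypersurface γ → ProjectionWellDefined γ →
      ∀ M : ParamSurface n γ W, M.Admissible k cbar c L C₁ C₂ δ →
      ∀ f : Amb n → ℝ, MemLp f 2 M.surf →
        (∀ (v : Amb n → ℝ) (gv : Amb n → Amb n), M.HasWeakGradient v gv →
          M.IntegrableOnGamma k (M.theoretical k f v) ∧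
          M.IntegrableOnGamma k (M.practical k f v) ∧
          |M.integralGamma k (M.theoretical k f v) - M.integralGamma k (M.practical k f v)| ≤
            D * ∑ T, M.beta k T * M.l2norm f (M.elem T) * M.h1norm v gv (M.omega T) ∧
          ∑ T, M.beta k T * M.l2norm f (M.elem T) * M.h1norm v gv (M.omega T) ≤
            D * (Real.sqrt (∑ T, M.beta k T ^ 2 * M.l2norm f (M.elem T) ^ 2) *
              M.h1norm v gv γ) ∧
          Real.sqrt (∑ T, M.beta k T ^ 2 * M.l2norm f (M.elem T) ^ 2) * M.h1norm v gv γ ≤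
            D * (M.l2norm f γ * M.h1norm v gv γ * M.betaMax k)) ∧
        sSup (M.termIIValues k f) ≤
          ((D * Real.sqrt (∑ T, (M.l2norm f (M.elem T) * M.beta k T) ^ 2) : ℝ) : EReal) ∧
        Real.sqrt (∑ T, (M.l2norm f (M.elem T) * M.beta k T) ^ 2) ≤
          D * (M.l2norm f γ * M.betaMax k) := by
  obtain ⟨r, -, δ, Sm⟩ := exists_isSmallThreshold W cbar hL
  set K : ℝ := Real.sqrt (localConst n cbar c L C₁) with hK
  set N : ℝ := (patchCard W : ℝ) with hN
  have hK0 : 0 ≤ K := Real.sqrt_nonneg _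
  have hN1 : 1 ≤ N := Nat.one_le_cast.2 (Nat.le_add_left 1 _)
  have hN0 : 0 ≤ N := zero_le_one.trans hN1
  have hKN : 0 ≤ K * N := mul_nonneg hK0 hN0
  -- One constant is to dominate `K`, `N` and `K * N`, and to be positive even if `K` vanishes; `(K
  -- + 1) * N` does so because `N ≥ 1`.
  have hD0 : 0 < (K + 1) * N := mul_pos (by linarith) (by linarith)
  have hD1 : K ≤ (K + 1) * N := le_trans (by linarith) (le_mul_of_one_le_right (by linarith) hN1)
  have hD2 : N ≤ (K + 1) * N := by linarith
  have hD3 : K * N ≤ (K + 1) * N := by linarith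
  refine ⟨δ, Sm.pos, (K + 1) * N, hD0, ?_⟩
  intro γ hγ hproj M A f hf
  set D : ℝ := (K + 1) * N with hD
  set R : ℝ := Real.sqrt (∑ T, M.beta k T ^ 2 * M.l2norm f (M.elem T) ^ 2) with hR
  have hR0 : 0 ≤ R := Real.sqrt_nonneg _
  have hRle : R ≤ D * (M.l2norm f γ * M.betaMax k) :=
    (A.sqrt_sum_beta_le hn hcbar hL hγ hf).trans (mul_le_mul_of_nonneg_right hD2
      (mul_nonneg (ParamSurface.l2norm_nonneg _ _) (M.betaMax_nonneg k)))
  have hR' : Real.sqrt (∑ T, (M.l2norm f (M.elem T) * M.beta k T) ^ 2) = R :=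
    congrArg Real.sqrt (Finset.sum_congr rfl fun T _ => by ring)
  have hterm : ∀ T, 0 ≤ M.beta k T * M.l2norm f (M.elem T) := fun T =>
    mul_nonneg (M.beta_nonneg k T) (ParamSurface.l2norm_nonneg _ _)
  rw [hR']
  refine ⟨fun v gv hv => ⟨A.integrableOnGamma_theoretical hn hk hcbar hc hL Sm hγ hproj hf hv.memLp,
    A.integrableOnGamma_practical hn hk hcbar hc hC₁ hL Sm hγ hproj hf hv.memLp, ?_, ?_, ?_⟩,
    ?_, hRle⟩
  · refine (A.abs_integralGamma_sub_le hn hk hcbar hc hC₁ hL Sm hγ hproj hf hv).trans ?_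
    refine mul_le_mul hD1 (Finset.sum_le_sum fun T _ => ?_) (Finset.sum_nonneg fun T _ => ?_) hD0.le
    · exact mul_le_mul_of_nonneg_left (ParamSurface.l2norm_grad_le_h1norm v gv _) (hterm T)
    · exact mul_nonneg (hterm T) (ParamSurface.l2norm_nonneg _ _)
  · exact (A.sum_beta_mul_h1norm_le hn hcbar hL hγ hv).trans (mul_le_mul_of_nonneg_right hD2
      (mul_nonneg hR0 (ParamSurface.h1norm_nonneg _ _ _)))
  · calc R * M.h1norm v gv γ
        ≤ D * (M.l2norm f γ * M.betaMax k) * M.h1norm v gv γ :=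
          mul_le_mul_of_nonneg_right hRle (ParamSurface.h1norm_nonneg _ _ _)
      _ = _ := by ring
  -- The supremum is taken in the complete lattice `EReal`, so bounding each value suffices, also
  -- when there is no admissible test function.
  · refine sSup_le ?_
    rintro s ⟨v, gv, hv, -, hg1, rfl⟩
    rw [EReal.coe_le_coe_iff]
    have h1 := A.termII_le hn hk hcbar hc hC₁ hL Sm hγ hproj hf hv
    rw [hg1, mul_one] at h1
    exact h1.trans (mul_le_mul_of_nonneg_right hD3 hR0)
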